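/- Let $\Sigma$ be a closed (compact, without boundary) smooth 3-manifold oriented by a volume form $\mathsf{vol}_0$. Internal indices $i,j,k,\dots\in\{1,2,3\}$ are raised and lowered with $\delta_{ij}$, repeated indices are summed, and $\varepsilon_{ijk}$ is the Levi-Civita symbol. The configuration space $Q$ of the extended Husain–Kuchař model, with action $\int_{\mathbb R\times\Sigma}\big(\tfrac12\varepsilon_{ijk}\mathbf e^i\wedge\mathbf e^j\wedge\mathbf F^k-\mathbf d\boldsymbol\phi\wedge\mathbf e_i\wedge\mathbf F^i\big)$, consists of all $(e_{\mathrm t}^i,e^i,A_{\mathrm t}^i,A^i,\phi)\in C^\infty(\Sigma)^3\times\Omega^1(\Sigma)^3\times C^\infty(\Sigma)^3\times\Omega^1(\Sigma)^3\times C^\infty(\Sigma)$ such that $(e^i)$ is a coframe. Put $F^i=\mathrm dA^i+\frac12\varepsilon^i{}_{jk}A^j\wedge A^k$ and $D\beta^i=\mathrm d\beta^i+\varepsilon^i{}_{jk}A^j\wedge\beta^k$. The Lagrangian obtained from the action is $$L(\mathrm v)=\int_\Sigma\Big(\big(\tfrac12\varepsilon_{ijk}e^i\wedge e^j+e_k\wedge\mathrm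 d\phi\big)\wedge v_A^k+A_{\mathrm t}^iD\big(\tfrac12\varepsilon_{ijk}e^j\wedge e^k+e_i\wedge\mathrm d\phi\big)-(e_i\wedge F^i)v_\phi+e_{\mathrm t}^i\big(\varepsilon_{ijk}e^j\wedge F^k+F_i\wedge\mathrm d\phi\big)\Big).$$ **Primary constraints.** The fibre derivative $\langle FL(\mathrm v),\mathrm w\rangle=\frac{d}{ds}\big|_{0}L(\mathrm v+s\mathrm w)$ and the energy $\langle FL(\mathrm v),\mathrm v\rangle-L(\mathrm v)$ depend only on the base point of $\mathrm v$. Hence the primary constraint submanifold $\mathsf M_0=FL(TQ)\subset T^*Q$ is the graph of a section of $T^*Q\to Q$, identified with $Q$, and the energy defines a Hamiltonian $H$ on it. Let $\omega$ be the pull-back to $\mathsf M_0\cong Q$ of the canonical symplectic form, $\Omega\big((Z,\mathbf Z_{\mathbf p}),(Y,\mathbf Y_{\mathbf p})\big)=\mathbf Y_{\mathbf p}(Z)-\mathbf Z_{\mathbf p}(Y)$. **Secondary constraints.** For $q\in Q$ and $Z=(Z_{e_{\mathrm t}}^i,Z_e^i,Z_{A_{\mathrm t}}^i,Z_A^i,Z_\phi)\in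 T_qQ$ put $X_A^i=Z_A^i-DA_{\mathrm t}^i$ and $X_e^i=Z_e^i-De_{\mathrm t}^i-\varepsilon^i{}_{jk}e^jA_{\mathrm t}^k$. Then $\omega(Z,Y)=dH(Y)$ for all $Y\in T_qQ$ if and only if the secondary constraints $$\text{(L1)}\ \ \varepsilon_{ijk}e^j\wedge F^k+\mathrm d\phi\wedge F_i=0,\qquad\text{(L2)}\ \ \varepsilon_{ijk}e^j\wedge De^k-\mathrm d\phi\wedge De_i=0$$ hold at $q$ together with $$\text{(EE1)}\ \ (\varepsilon_{ijk}e^j+\delta_{ik}\mathrm d\phi)\wedge X_A^k=(\varepsilon_{ijk}e_{\mathrm t}^j+\delta_{ik}Z_\phi)F^k,$$ $$\text{(EE2)}\ \ (\varepsilon_{ijk}e^j-\delta_{ik}\mathrm d\phi)\wedge X_e^k=(\varepsilon_{ijk}e_{\mathrm t}^j-\delta_{ik}Z_\phi)De^k,$$ $$\text{(EE3)}\ \ De_i\wedge X_A^i+F_i\wedge X_e^i=0.$$ Let $\mathsf M_1\subset\mathsf M_0\cong Q$ be the set defined by (L1)–(L2). **Solution.** Let $\mathsf{vol}_e=\frac1{3!}\varepsilon_{ijk}e^i\wedge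 e^j\wedge e^k$, write $\mathrm d\phi=\alpha_ie^i$, i.e. $\alpha_i$ is the function with $\alpha_i\,\mathsf{vol}_e=\mathrm d\phi\wedge\frac12\varepsilon_{ijk}e^j\wedge e^k$, and let $\mathbb F_{ij},\mathbb B_{ij}$ be the functions with $F_i\wedge e_j=\mathbb F_{ij}\mathsf{vol}_e$, $De_i\wedge e_j=\mathbb B_{ij}\mathsf{vol}_e$; put $\alpha^2=\alpha_i\alpha^i$, $e_{\mathrm t}\cdot\alpha=e_{\mathrm t}^i\alpha_i$, $\mathbb F=\mathbb F^i{}_i$, $\mathbb B=\mathbb B^i{}_i$. On $\mathsf M_1$, equation (EE1) is equivalent to $X_A^i=W^i{}_je^j$ and (EE2) is equivalent to $X_e^i=E^i{}_je^j$, where $$W_{ij}=\frac{1}{1+\alpha^2}\big(\delta_i{}^k+\alpha_i\alpha^k-\varepsilon_i{}^{k\ell}\alpha_\ell\big)M_{kj},\qquad E_{ij}=\frac{1}{1+\alpha^2}\big(\delta_i{}^k+\alpha_i\alpha^k+\varepsilon_i{}^{k\ell}\alpha_\ell\big)N_{kj},$$ $$M_{ij}=e_{\mathrm t}^k\mathbb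 F_{ki}\alpha_j-\varepsilon_{jpq}e_{\mathrm t}^p\mathbb F^q{}_i-Z_\phi\mathbb F_{ji}+\mathbb F\big(\tfrac12\delta_{ij}Z_\phi+\tfrac12\delta_{ij}(e_{\mathrm t}\cdot\alpha)-e_{\mathrm ti}\alpha_j\big),$$ $$N_{ij}=-e_{\mathrm t}^k\mathbb B_{ki}\alpha_j-\varepsilon_{jpq}e_{\mathrm t}^p\mathbb B^q{}_i+Z_\phi\mathbb B_{ji}-\mathbb B\big(\tfrac12\delta_{ij}Z_\phi+\tfrac12\delta_{ij}(e_{\mathrm t}\cdot\alpha)-e_{\mathrm ti}\alpha_j\big).$$ For these $X_A^i,X_e^i$ equation (EE3) holds identically on $\mathsf M_1$, so that on $\mathsf M_1$ the equation $\imath_Z\omega=dH$ is equivalent to $X_A^i=W^i{}_je^j$, $X_e^i=E^i{}_je^j$. Consequently $Z_{e_{\mathrm t}}^i$, $Z_{A_{\mathrm t}}^i$ and $Z_\phi$ are arbitrary: for each $q\in\mathsf M_1$ and each choice of these smooth functions there is exactly one solution $Z$ with these components. **Tangency.** For $q\in\mathsf M_1$ every solution $Z$ of $\imath_Z\omega=dH$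 at $q$ is tangent to $\mathsf M_1$, i.e. the derivatives at $q$ in the direction $Z$ of the left-hand sides of (L1) and (L2) vanish. So no further constraints arise: $\mathsf M_1$ is exactly the set of points of $\mathsf M_0$ at which $\imath_Z\omega=dH$ has a solution, and also the set of points of $\mathsf M_1$ at which it has a solution tangent to $\mathsf M_1$. -/

import Mathlib

open scoped Manifold ContDiff

noncomputable section

namespace EHK

/-! ### Differential forms on a 3-manifold -/

/-- The model space of a 3-manifold. -/
abbrev E3 : Type := EuclideanSpace ℝ (Fin 3)

/-- (Not necessarily smooth) differential `k`-forms on the 3-manifold `S`. In Mathlib the tangent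
space at `p` is, by definition, the model space `E3`, identified with it through the preferred
chart at `p`. -/
abbrev Form (S : Type*) (k : ℕ) : Type _ := S → E3 [⋀^Fin k]→L[ℝ] ℝ

section Forms

variable {S : Type*} [TopologicalSpace S] [ChartedSpace E3 S]

/-- The expression of a `k`-form in the preferred chart at `x`: the pull-back under the inverse of
that chart (meaningful on the target of the chart). -/
def inChart [IsManifold (𝓡 3) ∞ S] {k : ℕ} (x : S) (β : Form S k) : E3 → E3 [⋀^Fin k]→L[ℝ] ℝ :=
  fun y =>
    let p : S := (extChartAt (𝓡 3) x).symm y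
    (β p).compContinuousLinearMap (tangentCoordChange (𝓡 3) x p p)

/-- `Ω^k(S)`: the space of smooth `k`-forms. -/
def Omega (S : Type*) [TopologicalSpace S] [ChartedSpace E3 S] [IsManifold (𝓡 3) ∞ S] (k : ℕ) :
    Submodule ℝ (Form S k) where
  carrier := {β | ∀ x : S, ContDiffOn ℝ ∞ (inChart x β) (extChartAt (𝓡 3) x).target}
  add_mem' := fun ha hb x => (ha x).add (hb x)
  zero_mem' := fun _ => contDiffOn_const (c := (0 : E3 [⋀^Fin k]→L[ℝ] ℝ))
  smul_mem' := fun c _ ha x => contDiffOn_const.smul (s := (extChartAt (𝓡 3) x).target)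
    (f := fun _ => c) (ha x)

/-- The differential `df` of a function. -/
def dFun (f : S → ℝ) : Form S 1 := fun p =>
  ContinuousAlternatingMap.ofSubsingleton ℝ E3 ℝ (0 : Fin 1)
    (mfderiv (𝓡 3) 𝓘(ℝ, ℝ) f p : E3 →L[ℝ] ℝ)

/-- The exterior derivative `dβ`, computed at `p` in the preferred chart at `p`. -/
def extD [IsManifold (𝓡 3) ∞ S] {k : ℕ} (β : Form S k) : Form S (k + 1) := fun p =>
  extDeriv (inChart p β) (extChartAt (𝓡 3) p p)

/-- The wedge product `α ∧ β` of a 1-form and a `k`-form,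
`(α ∧ β)(v₀, …, v_k) = ∑ i, (-1) ^ i * α(v_i) * β(v₀, …, v̂_i, …, v_k)`. -/
def wedge {k : ℕ} (α : Form S 1) (β : Form S k) : Form S (k + 1) := fun p =>
  ContinuousAlternatingMap.alternatizeUncurryFin
    (((ContinuousAlternatingMap.ofSubsingleton ℝ E3 ℝ (0 : Fin 1)).symm (α p)).smulRight (β p))

/-- The product of a function and a form. -/
def fmul {k : ℕ} (f : S → ℝ) (β : Form S k) : Form S k := fun p => f p • β p

/-- The standard frame of the tangent space. -/
def stdFrame : Fin 3 → E3 := fun i => EuclideanSpace.single i (1 : ℝ)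

/-- The quotient `(β / v)` of a top form by a volume form: `β = (β / v) v`. -/
def ratio (β v : Form S 3) : S → ℝ := fun p => β p stdFrame / v p stdFrame

/-- A partition of unity subordinate to the domains of the preferred charts. -/
def chartPartition (S : Type*) [TopologicalSpace S] [ChartedSpace E3 S] [IsManifold (𝓡 3) ∞ S]
    [CompactSpace S] [T2Space S] : SmoothPartitionOfUnity S (𝓡 3) S Set.univ :=
  (SmoothPartitionOfUnity.exists_isSubordinate_chartAt_source (𝓡 3) S).choose

/-- The integral of a (smooth) 3-form `β` over the closed manifold `S`, oriented by the volume form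
`vol₀`: the sum over the partition of unity of the integrals in charts, with the sign that says
whether the chart is positively oriented. -/
def integral [IsManifold (𝓡 3) ∞ S] [CompactSpace S] [T2Space S] (vol₀ β : Form S 3) : ℝ :=
  ∑ᶠ x : S, ∫ y in (extChartAt (𝓡 3) x).target,
    chartPartition S x ((extChartAt (𝓡 3) x).symm y) *
      Real.sign (inChart x vol₀ y stdFrame) * inChart x β y stdFrame

end Forms

local infixr:70 " ⋏ " => wedge
local infixr:73 " ⊙ " => fmul

/-! ### The fields -/

/-- The Levi-Civita symbol (indices `0, 1, 2`). -/
def eps (i j k : Fin 3) : ℝ :=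
  (((j : ℕ) : ℝ) - ((i : ℕ) : ℝ)) * (((k : ℕ) : ℝ) - ((j : ℕ) : ℝ)) *
    (((k : ℕ) : ℝ) - ((i : ℕ) : ℝ)) / 2

/-- The Kronecker delta. -/
def delta (i j : Fin 3) : ℝ := if i = j then 1 else 0

/-- `C^∞(S)`. -/
abbrev SmoothFun (S : Type*) [TopologicalSpace S] [ChartedSpace E3 S] : Type _ :=
  C^∞⟮𝓡 3, S; 𝓘(ℝ, ℝ), ℝ⟯

/-- The vector space `C^∞(S)³ × Ω¹(S)³ × C^∞(S)³ × Ω¹(S)³ × C^∞(S)` of all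
`(e_t^i, e^i, A_t^i, A^i, φ)`, which is also the space of velocities and of tangent vectors. -/
abbrev Fields (S : Type*) [TopologicalSpace S] [ChartedSpace E3 S] [IsManifold (𝓡 3) ∞ S] :
    Type _ :=
  (Fin 3 → SmoothFun S) × (Fin 3 → Omega S 1) × (Fin 3 → SmoothFun S) × (Fin 3 → Omega S 1) ×
    SmoothFun S

section Theory

variable {S : Type*} [TopologicalSpace S] [ChartedSpace E3 S]

section Components

variable [IsManifold (𝓡 3) ∞ S]

/-- The component `e_t^i`. -/
def cet (q : Fields S) (i : Fin 3) : S → ℝ := q.1 i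
/-- The component `e^i`. -/
def ce (q : Fields S) (i : Fin 3) : Form S 1 := q.2.1 i
/-- The component `A_t^i`. -/
def cAt (q : Fields S) (i : Fin 3) : S → ℝ := q.2.2.1 i
/-- The component `A^i`. -/
def cA (q : Fields S) (i : Fin 3) : Form S 1 := q.2.2.2.1 i
/-- The component `φ`. -/
def cphi (q : Fields S) : S → ℝ := q.2.2.2.2

/-- The configuration space `Q`: the `e^i` form a coframe. -/
def configSpace (S : Type*) [TopologicalSpace S] [ChartedSpace E3 S] [IsManifold (𝓡 3) ∞ S] :
    Set (Fields S) :=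
  {q | ∀ p : S, LinearIndependent ℝ fun i : Fin 3 => ce q i p}

/-- `D f^i = df^i + ε^i_{jk} A^j f^k` on triples of functions. -/
def covD0 (A : Fin 3 → Form S 1) (f : Fin 3 → S → ℝ) (i : Fin 3) : Form S 1 :=
  dFun (f i) + ∑ j, ∑ k, eps i j k • (f k ⊙ A j)

/-- `D β^i = dβ^i + ε^i_{jk} A^j ∧ β^k` on triples of forms. -/
def covD {n : ℕ} (A : Fin 3 → Form S 1) (β : Fin 3 → Form S n) (i : Fin 3) : Form S (n + 1) :=
  extD (β i) + ∑ j, ∑ k, eps i j k • (A j ⋏ β k)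

/-- The curvature `F^i = dA^i + ½ ε^i_{jk} A^j ∧ A^k`. -/
def curv (A : Fin 3 → Form S 1) (i : Fin 3) : Form S 2 :=
  extD (A i) + (1 / 2 : ℝ) • ∑ j, ∑ k, eps i j k • (A j ⋏ A k)

/-- The curvature of the connection component of a configuration. -/
def cF (q : Fields S) (i : Fin 3) : Form S 2 := curv (cA q) i

/-- `D e^i`. -/
def cDe (q : Fields S) (i : Fin 3) : Form S 2 := covD (cA q) (ce q) i

/-- `½ ε_{ijk} e^j ∧ e^k + e_i ∧ dφ`. -/
def cH (q : Fields S) (i : Fin 3) : Form S 2 :=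
  (1 / 2 : ℝ) • ∑ j, ∑ k, eps i j k • (ce q j ⋏ ce q k) + ce q i ⋏ dFun (cphi q)

/-- `ε_{ijk} e^j ∧ F^k + dφ ∧ F_i`, the left-hand side of the first secondary constraint. (A 2-form
commutes with every form, so also `F_i ∧ dφ` is written with the 1-form on the left.) -/
def constraint1 (q : Fields S) (i : Fin 3) : Form S 3 :=
  ∑ j, ∑ k, eps i j k • (ce q j ⋏ cF q k) + dFun (cphi q) ⋏ cF q i

/-- `ε_{ijk} e^j ∧ De^k - dφ ∧ De_i`, the left-hand side of the second secondary constraint. -/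
def constraint2 (q : Fields S) (i : Fin 3) : Form S 3 :=
  ∑ j, ∑ k, eps i j k • (ce q j ⋏ cDe q k) - dFun (cphi q) ⋏ cDe q i

end Components

/-! ### Lagrangian, fibre derivative, pre-symplectic form and Hamiltonian -/

section Dynamics

variable [IsManifold (𝓡 3) ∞ S] [CompactSpace S] [T2Space S]

/-- The Lagrangian of the extended Husain-Kuchař model at the velocity `v` over `q`,
`∫ ( (½ ε_{ijk} e^i ∧ e^j + e_k ∧ dφ) ∧ v_A^k + A_t^i D(½ ε_{ijk} e^j ∧ e^k + e_i ∧ dφ)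
  - (e_i ∧ F^i) v_φ + e_t^i (ε_{ijk} e^j ∧ F^k + F_i ∧ dφ) )`. -/
def lagrangian (vol₀ : Form S 3) (q v : Fields S) : ℝ :=
  integral vol₀ (∑ i, (cA v i ⋏ cH q i + cAt q i ⊙ covD (cA q) (cH q) i
    - cphi v ⊙ (ce q i ⋏ cF q i) + cet q i ⊙ constraint1 q i))

/-- The fibre derivative `⟨FL(v), w⟩`, for the velocity `v` over `q`. -/
def fiberDeriv (vol₀ : Form S 3) (q v w : Fields S) : ℝ :=
  deriv (fun s : ℝ => lagrangian vol₀ q (v + s • w)) 0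

/-- The energy `⟨FL(v), v⟩ - L(v)`, for the velocity `v` over `q`. -/
def energy (vol₀ : Form S 3) (q v : Fields S) : ℝ :=
  fiberDeriv vol₀ q v v - lagrangian vol₀ q v

/-- The primary constraint submanifold `M₀ ⊂ T*Q`: the image of the fibre derivative, as a set of
pairs of a base point and a covector. -/
def primarySubmanifold (vol₀ : Form S 3) : Set (Fields S × Module.Dual ℝ (Fields S)) :=
  {m | m.1 ∈ configSpace S ∧ ∃ v, ∀ w, m.2 w = fiberDeriv vol₀ m.1 v w}

/-- The momentum of the point of `M₀` over `q` (the fibre derivative does not depend on the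
velocity). -/
def momentum (vol₀ : Form S 3) (q w : Fields S) : ℝ := fiberDeriv vol₀ q 0 w

/-- The momentum component at `q` of the vector tangent to `M₀` with base component `Y`. -/
def momentumVariation (vol₀ : Form S 3) (q Y w : Fields S) : ℝ :=
  deriv (fun s : ℝ => momentum vol₀ (q + s • Y) w) 0

/-- The canonical symplectic form of `T*Q` on tangent vectors `(Z, P)` and `(Y, R)` (base component,
momentum component). -/
def canonicalForm (Z Y : Fields S) (P R : Fields S → ℝ) : ℝ := R Z - P Y

/-- The pre-symplectic form `ω` on `M₀ ≅ Q`: the pull-back of the canonical form under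
`q ↦ (q, momentum q)`. -/
def omega (vol₀ : Form S 3) (q Z Y : Fields S) : ℝ :=
  canonicalForm Z Y (momentumVariation vol₀ q Z) (momentumVariation vol₀ q Y)

/-- The Hamiltonian on `M₀ ≅ Q` (the energy does not depend on the velocity). -/
def hamiltonian (vol₀ : Form S 3) (q : Fields S) : ℝ := energy vol₀ q 0

/-- `dH(Y)` at `q`. -/
def dHamiltonian (vol₀ : Form S 3) (q Y : Fields S) : ℝ :=
  deriv (fun s : ℝ => hamiltonian vol₀ (q + s • Y)) 0

/-- The equation `ι_Z ω = dH` at the point `q` of `M₀ ≅ Q`. -/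
def GNH (vol₀ : Form S 3) (q Z : Fields S) : Prop :=
  ∀ Y : Fields S, omega vol₀ q Z Y = dHamiltonian vol₀ q Y

end Dynamics

/-! ### The secondary constraint submanifold and the equations for the vector fields -/

variable [IsManifold (𝓡 3) ∞ S]

/-- The submanifold `M₁` of `M₀ ≅ Q` defined by the secondary constraints. -/
def secondarySubmanifold (S : Type*) [TopologicalSpace S] [ChartedSpace E3 S]
    [IsManifold (𝓡 3) ∞ S] : Set (Fields S) :=
  {q | q ∈ configSpace S ∧ (∀ i, constraint1 q i = 0) ∧ (∀ i, constraint2 q i = 0)}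

/-- `Z` is tangent to `M₁` at `q`: the derivatives of the secondary constraints at `q` in the
direction `Z` vanish. -/
def TangentToSecondary (q Z : Fields S) : Prop :=
  ∀ (i : Fin 3) (p : S),
    HasDerivAt (fun s : ℝ => constraint1 (q + s • Z) i p) 0 0 ∧
      HasDerivAt (fun s : ℝ => constraint2 (q + s • Z) i p) 0 0

/-- `X_A^i = Z_A^i - D A_t^i`. -/
def XA (q Z : Fields S) (i : Fin 3) : Form S 1 := cA Z i - covD0 (cA q) (cAt q) i

/-- `X_e^i = Z_e^i - D e_t^i - ε^i_{jk} e^j A_t^k`. -/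
def Xe (q Z : Fields S) (i : Fin 3) : Form S 1 :=
  ce Z i - covD0 (cA q) (cet q) i - ∑ j, ∑ k, eps i j k • (cAt q k ⊙ ce q j)

/-- `(ε_{ijk} e^j + δ_{ik} dφ) ∧ X_A^k = (ε_{ijk} e_t^j + δ_{ik} Z_φ) F^k`. -/
def EqA (q Z : Fields S) : Prop := ∀ i : Fin 3,
  ∑ j, ∑ k, eps i j k • (ce q j ⋏ XA q Z k) + dFun (cphi q) ⋏ XA q Z i =
    ∑ j, ∑ k, eps i j k • (cet q j ⊙ cF q k) + cphi Z ⊙ cF q i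

/-- `(ε_{ijk} e^j - δ_{ik} dφ) ∧ X_e^k = (ε_{ijk} e_t^j - δ_{ik} Z_φ) De^k`. -/
def EqE (q Z : Fields S) : Prop := ∀ i : Fin 3,
  ∑ j, ∑ k, eps i j k • (ce q j ⋏ Xe q Z k) - dFun (cphi q) ⋏ Xe q Z i =
    ∑ j, ∑ k, eps i j k • (cet q j ⊙ cDe q k) - cphi Z ⊙ cDe q i

/-- `De_i ∧ X_A^i + F_i ∧ X_e^i = 0`. -/
def EqPhi (q Z : Fields S) : Prop :=
  ∑ i, (XA q Z i ⋏ cDe q i + Xe q Z i ⋏ cF q i) = 0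

/-- `vol_e = (1/3!) ε_{ijk} e^i ∧ e^j ∧ e^k`. -/
def volE (q : Fields S) : Form S 3 :=
  (1 / 6 : ℝ) • ∑ i, ∑ j, ∑ k, eps i j k • (ce q i ⋏ ce q j ⋏ ce q k)

/-- The coefficients `α_i` in `dφ = α_i e^i`, as `α_i = (dφ ∧ ½ ε_{ijk} e^j ∧ e^k / vol_e)`. -/
def alpha (q : Fields S) (i : Fin 3) : S → ℝ :=
  ratio (dFun (cphi q) ⋏ ((1 / 2 : ℝ) • ∑ j, ∑ k, eps i j k • (ce q j ⋏ ce q k))) (volE q)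

/-- `α² = α_i α^i`. -/
def alphaSq (q : Fields S) (p : S) : ℝ := ∑ i, alpha q i p ^ 2

/-- `e_t · α = e_t^i α_i`. -/
def etAlpha (q : Fields S) (p : S) : ℝ := ∑ i, cet q i p * alpha q i p

/-- `𝔽_{ij} = (F_i ∧ e_j / vol_e)`. -/
def FF (q : Fields S) (i j : Fin 3) : S → ℝ := ratio (ce q j ⋏ cF q i) (volE q)

/-- `𝔹_{ij} = (De_i ∧ e_j / vol_e)`. -/
def BB (q : Fields S) (i j : Fin 3) : S → ℝ := ratio (ce q j ⋏ cDe q i) (volE q)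

/-- The trace `𝔽`. -/
def trF (q : Fields S) (p : S) : ℝ := ∑ i, FF q i i p

/-- The trace `𝔹`. -/
def trB (q : Fields S) (p : S) : ℝ := ∑ i, BB q i i p

/-- `M_{ij} = e_t^k 𝔽_{ki} α_j - ε_{jkl} e_t^k 𝔽^l_i - Z_φ 𝔽_{ji}
  + 𝔽 (½ δ_{ij} Z_φ + ½ δ_{ij} (e_t·α) - e_{ti} α_j)`. -/
def matM (q : Fields S) (zphi : S → ℝ) (i j : Fin 3) (p : S) : ℝ :=
  (∑ k, cet q k p * FF q k i p) * alpha q j p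
    - (∑ k, ∑ l, eps j k l * cet q k p * FF q l i p)
    - zphi p * FF q j i p
    + trF q p * (1 / 2 * delta i j * zphi p + 1 / 2 * delta i j * etAlpha q p
        - cet q i p * alpha q j p)

/-- `N_{ij} = - e_t^k 𝔹_{ki} α_j - ε_{jkl} e_t^k 𝔹^l_i + Z_φ 𝔹_{ji}
  - 𝔹 (½ δ_{ij} Z_φ + ½ δ_{ij} (e_t·α) - e_{ti} α_j)`. -/
def matN (q : Fields S) (zphi : S → ℝ) (i j : Fin 3) (p : S) : ℝ :=
  - (∑ k, cet q k p * BB q k i p) * alpha q j p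
    - (∑ k, ∑ l, eps j k l * cet q k p * BB q l i p)
    + zphi p * BB q j i p
    - trB q p * (1 / 2 * delta i j * zphi p + 1 / 2 * delta i j * etAlpha q p
        - cet q i p * alpha q j p)

/-- `W_{ij} = (1 + α²)⁻¹ (δ_i^k + α_i α^k - ε_i^{kl} α_l) M_{kj}`. -/
def matW (q : Fields S) (zphi : S → ℝ) (i j : Fin 3) (p : S) : ℝ :=
  1 / (1 + alphaSq q p) * ∑ k, (delta i k + alpha q i p * alpha q k p
    - ∑ l, eps i k l * alpha q l p) * matM q zphi k j p

/-- `E_{ij} = (1 + α²)⁻¹ (δ_i^k + α_i α^k + ε_i^{kl} α_l) N_{kj}`. -/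
def matE (q : Fields S) (zphi : S → ℝ) (i j : Fin 3) (p : S) : ℝ :=
  1 / (1 + alphaSq q p) * ∑ k, (delta i k + alpha q i p * alpha q k p
    + ∑ l, eps i k l * alpha q l p) * matN q zphi k j p

/-- `X_A^i = W^i_j e^j`. -/
def SolA (q Z : Fields S) : Prop := ∀ i : Fin 3, XA q Z i = ∑ j, matW q (cphi Z) i j ⊙ ce q j

/-- `X_e^i = E^i_j e^j`. -/
def SolE (q Z : Fields S) : Prop := ∀ i : Fin 3, Xe q Z i = ∑ j, matE q (cphi Z) i j ⊙ ce q j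

end Theory

end EHK

end

open scoped Manifold ContDiff Topology

set_option linter.unusedSimpArgs false
set_option linter.unusedSectionVars false

namespace EHK

local infixr:70 " ⋏ " => wedge
local infixr:73 " ⊙ " => fmul

/-! ### Exterior calculus on the manifold through its chart expressions. -/

section ChartCalculus

/-! The Lagrangian is affine in the velocity, with integrand `momentumForm q v + potentialForm q`.
Hence the fibre derivative is integration of `momentumForm q`, the energy is minus the integral of
`potentialForm q`, and neither depends on the velocity. Along a line `q + s • Y` the forms built
from the fields are polynomial in `s`, so their derivatives at 0 exist pointwise and commute with
every linear map on smooth forms, in particular with `extD` and `integral`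
(`exists_deriv_of_mem_polyCurves`).

The integrand of ω(Z, Y) - dH(Y) differs by an exact form from `eulerForm q Z Y`, where Y occurs
undifferentiated (`exists_varForm_eq_eulerForm_add_extD`). Stokes' theorem (`integral_extD`) removes
the exact form, and the fundamental lemma of the calculus of variations, applied to one component of
Y at a time, makes the coefficients vanish. These are (L1), (EE1), (EE2), (EE3) and, by `covD_cH`,
(L2); this is `gnh_iff`.

What remains is mostly linear algebra at a point, in the frame dual to the coframe. The map X ↦
(ε_{ijk} e^j + δ_{ik} dφ) ∧ X^k becomes an endomorphism `coframeOp α` of 3 × 3 matrices; replacing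
dφ by -dφ replaces α by -α. The antisymmetric part of X is, up to sign, the constraint expression
evaluated on the image of X (`coframeOp_antisymm`). Consequently `coframeOp α` is bijective, and
(L1) forces F to be the image of a symmetric matrix Y, and (L2) forces De to be the image under
`coframeOp (-α)` of a symmetric Y'. The entries of Y and Y' are free parameters. In terms of them
(EE1) and (EE2) are solved by inverting δ_{ik} + ε_{ikl} α_l, whose determinant is 1 + α² > 0, and
(EE3) follows because `coframeOp α` and `coframeOp (-α)` are adjoint (`scalar_equation_identity`).

For tangency, the covariant derivative of (EE1), with the Bianchi identity, turns the variation of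
(L1) into the algebraic expression ε_{ijk} (X_e^j ∧ F^k + X_A^k ∧ De^j), which the explicit
solutions annihilate (`tangency_identity_F`). The covariant derivative of (EE2), with D² given by
the curvature, turns the variation of (L2) into an expression in X_A and F, which vanishes by (EE1)
and (L1) (`tangency_identity_B`). -/

theorem wedge_apply {S : Type*} {k : ℕ} (α : Form S 1) (β : Form S k) (p : S) (v : Fin (k + 1) → E3) :
    (α ⋏ β) p v = ∑ i : Fin (k + 1), (-1) ^ (i : ℕ) • (α p ![v i] * β p (i.removeNth v)) := by
  simp only [wedge, ContinuousAlternatingMap.alternatizeUncurryFin_apply,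
    ContinuousLinearMap.smulRight_apply, ContinuousAlternatingMap.smul_apply, smul_eq_mul]
  refine Finset.sum_congr rfl fun i _ => ?_
  congr 2
  have : ((ContinuousAlternatingMap.ofSubsingleton ℝ E3 ℝ (0 : Fin 1)).symm (α p)) (v i)
      = α p (fun _ => v i) := rfl
  rw [this]
  congr 1
  ext j
  simp

/-- The wedge product at a point as a continuous bilinear map. -/
noncomputable def wedgeL (k : ℕ) :
    (E3 [⋀^Fin 1]→L[ℝ] ℝ) →L[ℝ] (E3 [⋀^Fin k]→L[ℝ] ℝ) →L[ℝ] (E3 [⋀^Fin (k + 1)]→L[ℝ] ℝ) :=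
  ((ContinuousLinearMap.compL ℝ (E3 [⋀^Fin k]→L[ℝ] ℝ) (E3 →L[ℝ] (E3 [⋀^Fin k]→L[ℝ] ℝ))
      (E3 [⋀^Fin (k + 1)]→L[ℝ] ℝ)
    (ContinuousAlternatingMap.alternatizeUncurryFinCLM ℝ E3 ℝ)).comp
    (ContinuousLinearMap.smulRightL ℝ E3 (E3 [⋀^Fin k]→L[ℝ] ℝ))).comp
    ((ContinuousAlternatingMap.ofSubsingletonLIE (𝕜 := ℝ) (E := E3) (F := ℝ) (0 : Fin 1)).symm :
      (E3 [⋀^Fin 1]→L[ℝ] ℝ) →L[ℝ] (E3 →L[ℝ] ℝ))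

theorem wedge_eq_wedgeL {S : Type*} {k : ℕ} (α : Form S 1) (β : Form S k) (p : S) :
    (α ⋏ β) p = wedgeL k (α p) (β p) := rfl

/-- Points near `φ_x p` are of the form `φ_x z` with `z` in a second chart domain. -/
theorem eventually_transition {S : Type*} [TopologicalSpace S] [ChartedSpace E3 S]
    {x x' p : S}
    (hx : p ∈ (extChartAt (𝓡 3) x).source) (hx' : p ∈ (extChartAt (𝓡 3) x').source) :
    ∀ᶠ y in 𝓝 (extChartAt (𝓡 3) x p), y ∈ (extChartAt (𝓡 3) x).target ∧
      (extChartAt (𝓡 3) x).symm y ∈ (extChartAt (𝓡 3) x').source := by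
  refine Filter.Eventually.and ?_ ?_
  · exact (isOpen_extChartAt_target x).mem_nhds ((extChartAt (𝓡 3) x).map_source hx)
  · have h := (continuousAt_extChartAt_symm' (I := 𝓡 3) hx).preimage_mem_nhds
      (t := (extChartAt (𝓡 3) x').source)
    exact h (by
      rw [(extChartAt (𝓡 3) x).left_inv hx]
      exact (isOpen_extChartAt_source x').mem_nhds hx')

variable {S : Type*} [TopologicalSpace S] [ChartedSpace E3 S] [IsManifold (𝓡 3) ∞ S]

theorem inChart_add {k : ℕ} (x : S) (α β : Form S k) :
    inChart x (α + β) = inChart x α + inChart x β := rfl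

theorem inChart_smul {k : ℕ} (x : S) (c : ℝ) (β : Form S k) :
    inChart x (c • β) = c • inChart x β := rfl

theorem inChart_fmul {k : ℕ} (x : S) (f : S → ℝ) (β : Form S k) (y : E3) :
    inChart x (f ⊙ β) y = f ((extChartAt (𝓡 3) x).symm y) • inChart x β y := rfl

theorem inChart_apply {k : ℕ} (x : S) (β : Form S k) (y : E3) (v : Fin k → E3) :
    inChart x β y v = β ((extChartAt (𝓡 3) x).symm y) (fun i =>
      tangentCoordChange (𝓡 3) x ((extChartAt (𝓡 3) x).symm y)
        ((extChartAt (𝓡 3) x).symm y) (v i)) := rfl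

/-- Change of chart. -/
theorem inChart_eq_comp {k : ℕ} (x x' : S) (β : Form S k) {p : S}
    (hx : p ∈ (extChartAt (𝓡 3) x).source) (hx' : p ∈ (extChartAt (𝓡 3) x').source) :
    inChart x β (extChartAt (𝓡 3) x p) =
      (inChart x' β (extChartAt (𝓡 3) x' p)).compContinuousLinearMap
        (tangentCoordChange (𝓡 3) x x' p) := by
  ext v
  rw [inChart_apply, ContinuousAlternatingMap.compContinuousLinearMap_apply, inChart_apply,
    (extChartAt (𝓡 3) x).left_inv hx, (extChartAt (𝓡 3) x').left_inv hx']
  congr 1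
  ext1 i
  rw [Function.comp_apply, tangentCoordChange_comp ⟨⟨hx, hx'⟩, mem_extChartAt_source p⟩]

/-- A form is recovered from its expression in the preferred chart. -/
theorem inChart_self {k : ℕ} (p : S) (β : Form S k) :
    inChart p β (extChartAt (𝓡 3) p p) = β p := by
  ext v
  rw [inChart_apply, (extChartAt (𝓡 3) p).left_inv (mem_extChartAt_source p)]
  congr 1
  ext1 i
  rw [tangentCoordChange_self (mem_extChartAt_source p)]

theorem hasFDerivAt_transition {x x' p : S}
    (hx : p ∈ (extChartAt (𝓡 3) x).source) (hx' : p ∈ (extChartAt (𝓡 3) x').source) :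
    HasFDerivAt (extChartAt (𝓡 3) x' ∘ (extChartAt (𝓡 3) x).symm)
      (tangentCoordChange (𝓡 3) x x' p) (extChartAt (𝓡 3) x p) := by
  have h := hasFDerivWithinAt_tangentCoordChange (I := 𝓡 3) ⟨hx, hx'⟩
  rwa [modelWithCornersSelf_coe, Set.range_id, hasFDerivWithinAt_univ] at h

theorem contDiffAt_transition {x x' p : S}
    (hx : p ∈ (extChartAt (𝓡 3) x).source) (hx' : p ∈ (extChartAt (𝓡 3) x').source) :
    ContDiffAt ℝ ∞ (extChartAt (𝓡 3) x' ∘ (extChartAt (𝓡 3) x).symm)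
      (extChartAt (𝓡 3) x p) := by
  have h := contDiffWithinAt_ext_coord_change (I := 𝓡 3) (n := ∞) x' x
    (y := extChartAt (𝓡 3) x p) (by
      rw [PartialEquiv.trans_source]
      exact ⟨(extChartAt (𝓡 3) x).map_source hx, by
        rwa [Set.mem_preimage, (extChartAt (𝓡 3) x).left_inv hx]⟩)
  rwa [modelWithCornersSelf_coe, Set.range_id, contDiffWithinAt_univ] at h

theorem contDiffAt_inChart {k : ℕ} {β : Form S k} (hβ : β ∈ Omega S k) (x : S) {y : E3}
    (hy : y ∈ (extChartAt (𝓡 3) x).target) : ContDiffAt ℝ ∞ (inChart x β) y :=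
  (hβ x).contDiffAt ((isOpen_extChartAt_target x).mem_nhds hy)

theorem differentiableAt_inChart {k : ℕ} {β : Form S k} (hβ : β ∈ Omega S k) (x : S) {y : E3}
    (hy : y ∈ (extChartAt (𝓡 3) x).target) : DifferentiableAt ℝ (inChart x β) y :=
  (contDiffAt_inChart hβ x hy).differentiableAt (by simp)

/-- The exterior derivative may be computed in any chart. -/
theorem inChart_extD {k : ℕ} {β : Form S k} (hβ : β ∈ Omega S k) (x : S) {y : E3}
    (hy : y ∈ (extChartAt (𝓡 3) x).target) :
    inChart x (extD β) y = extDeriv (inChart x β) y := by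
  obtain ⟨p, hp, rfl⟩ : ∃ p ∈ (extChartAt (𝓡 3) x).source, extChartAt (𝓡 3) x p = y :=
    ⟨_, (extChartAt (𝓡 3) x).map_target hy, (extChartAt (𝓡 3) x).right_inv hy⟩
  have hpp := mem_extChartAt_source (I := 𝓡 3) p
  have hcomp : (extChartAt (𝓡 3) p ∘ (extChartAt (𝓡 3) x).symm) (extChartAt (𝓡 3) x p) =
      extChartAt (𝓡 3) p p := by
    rw [Function.comp_apply, (extChartAt (𝓡 3) x).left_inv hp]
  -- Near the point the expression in the chart at `x` is the pull-back of the one in the chart at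
  -- `p` under the transition map. Writing the Jacobian as the `fderiv` of that map gives the shape
  -- required by `extDeriv_pullback`.
  have hev : inChart x β =ᶠ[𝓝 (extChartAt (𝓡 3) x p)]
      fun z => (inChart p β ((extChartAt (𝓡 3) p ∘ (extChartAt (𝓡 3) x).symm) z)).compContinuousLinearMap
        (fderiv ℝ (extChartAt (𝓡 3) p ∘ (extChartAt (𝓡 3) x).symm) z) := by
    filter_upwards [eventually_transition hp hpp] with z hz
    have hz1 := (extChartAt (𝓡 3) x).map_target hz.1
    have h1 := inChart_eq_comp x p β hz1 hz.2
    have h2 := (hasFDerivAt_transition hz1 hz.2).fderiv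
    rw [(extChartAt (𝓡 3) x).right_inv hz.1] at h1 h2
    rw [h1, h2]
    rfl
  rw [hev.extDeriv_eq, extDeriv_pullback (r := ∞) _ (contDiffAt_transition hp hpp)
    (by rw [minSmoothness_of_isRCLikeNormedField]; exact ENat.LEInfty.out),
    (hasFDerivAt_transition hp hpp).fderiv, inChart_eq_comp x p _ hp hpp, inChart_self, hcomp]
  · rfl
  · rw [hcomp]
    exact differentiableAt_inChart hβ p (mem_extChartAt_target p)

theorem extD_mem {k : ℕ} {β : Form S k} (hβ : β ∈ Omega S k) : extD β ∈ Omega S (k + 1) := by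
  intro x
  have h1 : ContDiffOn ℝ ∞ (extDeriv (inChart x β)) (extChartAt (𝓡 3) x).target :=
    (ContinuousAlternatingMap.alternatizeUncurryFinCLM ℝ E3 ℝ).contDiff.comp_contDiffOn
      ((hβ x).fderiv_of_isOpen (isOpen_extChartAt_target x) (by simp))
  exact h1.congr fun y hy => inChart_extD hβ x hy

theorem contDiffOn_comp_symm {f : S → ℝ} (hf : ContMDiff (𝓡 3) 𝓘(ℝ, ℝ) ∞ f) (x : S) :
    ContDiffOn ℝ ∞ (f ∘ (extChartAt (𝓡 3) x).symm) (extChartAt (𝓡 3) x).target := by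
  rw [← contMDiffOn_iff_contDiffOn]
  exact hf.comp_contMDiffOn (contMDiffOn_extChartAt_symm x)

theorem contMDiff_of_contDiffOn_comp_symm {f : S → ℝ}
    (hf : ∀ x, ContDiffOn ℝ ∞ (f ∘ (extChartAt (𝓡 3) x).symm) (extChartAt (𝓡 3) x).target) :
    ContMDiff (𝓡 3) 𝓘(ℝ, ℝ) ∞ f := by
  intro x
  have h1 : ContMDiffOn (𝓡 3) 𝓘(ℝ, ℝ) ∞
      ((f ∘ (extChartAt (𝓡 3) x).symm) ∘ extChartAt (𝓡 3) x) (chartAt E3 x).source := by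
    refine (contMDiffOn_iff_contDiffOn.2 (hf x)).comp contMDiffOn_extChartAt ?_
    intro p hp
    exact (extChartAt (𝓡 3) x).map_source (by simpa [extChartAt_source] using hp)
  have h2 := h1.contMDiffAt (x := x) ((chartAt E3 x).open_source.mem_nhds (mem_chart_source E3 x))
  refine h2.congr_of_eventuallyEq ?_
  filter_upwards [(chartAt E3 x).open_source.mem_nhds (mem_chart_source E3 x)] with p hp
  simp only [Function.comp_apply]
  rw [(extChartAt (𝓡 3) x).left_inv (by simpa [extChartAt_source] using hp)]

theorem fmul_mem {k : ℕ} {f : S → ℝ} (hf : ContMDiff (𝓡 3) 𝓘(ℝ, ℝ) ∞ f) {β : Form S k}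
    (hβ : β ∈ Omega S k) : f ⊙ β ∈ Omega S k := fun x =>
  (contDiffOn_comp_symm hf x).smul (hβ x)

theorem inChart_wedge {k : ℕ} (x : S) (α : Form S 1) (β : Form S k) (y : E3) :
    inChart x (α ⋏ β) y = wedgeL k (inChart x α y) (inChart x β y) := by
  ext v
  have h1 := wedge_apply (S := E3) (fun _ => inChart x α y) (fun _ => inChart x β y) y v
  rw [wedge_eq_wedgeL] at h1
  rw [h1, inChart_apply, wedge_apply]
  refine Finset.sum_congr rfl fun i _ => ?_
  simp only [inChart_apply]
  congr 4
  ext1 j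
  simp

theorem contDiffOn_bilinear_apply {V₁ V₂ V₃ : Type*} [NormedAddCommGroup V₁] [NormedSpace ℝ V₁]
    [NormedAddCommGroup V₂] [NormedSpace ℝ V₂] [NormedAddCommGroup V₃] [NormedSpace ℝ V₃]
    (w : V₁ →L[ℝ] V₂ →L[ℝ] V₃) {f : E3 → V₁} {g : E3 → V₂} {s : Set E3}
    (hf : ContDiffOn ℝ ∞ f s) (hg : ContDiffOn ℝ ∞ g s) :
    ContDiffOn ℝ ∞ (fun y => w (f y) (g y)) s :=
  w.isBoundedBilinearMap.contDiff.comp_contDiffOn (hf.prodMk hg)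

theorem wedge_mem {k : ℕ} {α : Form S 1} (hα : α ∈ Omega S 1) {β : Form S k}
    (hβ : β ∈ Omega S k) : α ⋏ β ∈ Omega S (k + 1) := by
  intro x
  have h : ContDiffOn ℝ ∞ (fun y => wedgeL k (inChart x α y) (inChart x β y))
      (extChartAt (𝓡 3) x).target :=
    contDiffOn_bilinear_apply _ (hα x) (hβ x)
  exact h.congr fun y _ => inChart_wedge x α β y

theorem inChart_dFun {f : S → ℝ} (hf : ContMDiff (𝓡 3) 𝓘(ℝ, ℝ) ∞ f) (x : S) {y : E3}
    (hy : y ∈ (extChartAt (𝓡 3) x).target) :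
    inChart x (dFun f) y = ContinuousAlternatingMap.ofSubsingleton ℝ E3 ℝ (0 : Fin 1)
      (fderiv ℝ (f ∘ (extChartAt (𝓡 3) x).symm) y) := by
  obtain ⟨p, hp, rfl⟩ : ∃ p ∈ (extChartAt (𝓡 3) x).source, extChartAt (𝓡 3) x p = y :=
    ⟨_, (extChartAt (𝓡 3) x).map_target hy, (extChartAt (𝓡 3) x).right_inv hy⟩
  have hpp := mem_extChartAt_source (I := 𝓡 3) p
  have hcomp : (extChartAt (𝓡 3) p ∘ (extChartAt (𝓡 3) x).symm) (extChartAt (𝓡 3) x p) =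
      extChartAt (𝓡 3) p p := by
    rw [Function.comp_apply, (extChartAt (𝓡 3) x).left_inv hp]
  have hm : MDifferentiableAt (𝓡 3) 𝓘(ℝ, ℝ) f p := (hf p).mdifferentiableAt (by simp)
  have hd : (mfderiv (𝓡 3) 𝓘(ℝ, ℝ) f p : E3 →L[ℝ] ℝ) =
      fderiv ℝ (f ∘ (extChartAt (𝓡 3) p).symm) (extChartAt (𝓡 3) p p) := by
    have h0 := hm.mfderiv
    rw [modelWithCornersSelf_coe, Set.range_id] at h0
    exact h0.trans (congrFun (fderivWithin_univ (𝕜 := ℝ) (E := E3) (F := ℝ)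
      (f := f ∘ (extChartAt (𝓡 3) p).symm)) _)
  have hdiff : DifferentiableAt ℝ (f ∘ (extChartAt (𝓡 3) p).symm) (extChartAt (𝓡 3) p p) :=
    (((contDiffOn_comp_symm hf p).contDiffAt ((isOpen_extChartAt_target p).mem_nhds
      (mem_extChartAt_target p))).differentiableAt (by simp))
  have hev : f ∘ (extChartAt (𝓡 3) x).symm =ᶠ[𝓝 (extChartAt (𝓡 3) x p)]
      (f ∘ (extChartAt (𝓡 3) p).symm) ∘ (extChartAt (𝓡 3) p ∘ (extChartAt (𝓡 3) x).symm) := by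
    filter_upwards [eventually_transition hp hpp] with z hz
    rw [Function.comp_apply, Function.comp_apply, Function.comp_apply, Function.comp_apply,
      (extChartAt (𝓡 3) p).left_inv hz.2]
  have hT := hasFDerivAt_transition hp hpp
  rw [← hcomp] at hdiff
  rw [hev.fderiv_eq, (hdiff.hasFDerivAt.comp _ hT).fderiv, inChart_eq_comp x p _ hp hpp,
    inChart_self, hcomp]
  ext v
  simp [dFun, hd]

theorem dFun_mem {f : S → ℝ} (hf : ContMDiff (𝓡 3) 𝓘(ℝ, ℝ) ∞ f) : dFun f ∈ Omega S 1 := by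
  intro x
  have h : ContDiffOn ℝ ∞ (fun y => ContinuousAlternatingMap.ofSubsingletonLIE (𝕜 := ℝ) (E := E3) (F := ℝ) (0 : Fin 1)
      (fderiv ℝ (f ∘ (extChartAt (𝓡 3) x).symm) y)) (extChartAt (𝓡 3) x).target :=
    (ContinuousAlternatingMap.ofSubsingletonLIE (𝕜 := ℝ) (E := E3) (F := ℝ) (0 : Fin 1)).contDiff.comp_contDiffOn
      ((contDiffOn_comp_symm hf x).fderiv_of_isOpen (isOpen_extChartAt_target x) (by simp))
  exact h.congr fun y hy => inChart_dFun hf x hy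

theorem extD_add {k : ℕ} {α β : Form S k} (hα : α ∈ Omega S k) (hβ : β ∈ Omega S k) :
    extD (α + β) = extD α + extD β := by
  funext p
  exact extDeriv_add (differentiableAt_inChart hα p (mem_extChartAt_target p))
    (differentiableAt_inChart hβ p (mem_extChartAt_target p))

theorem extD_smul {k : ℕ} (c : ℝ) (β : Form S k) : extD (c • β) = c • extD β := by
  funext p
  exact extDeriv_smul c (inChart p β)

theorem extD_extD {k : ℕ} {β : Form S k} (hβ : β ∈ Omega S k) : extD (extD β) = 0 := by
  funext p
  have hev : inChart p (extD β) =ᶠ[𝓝 (extChartAt (𝓡 3) p p)] extDeriv (inChart p β) := by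
    filter_upwards [(isOpen_extChartAt_target p).mem_nhds (mem_extChartAt_target (I := 𝓡 3) p)]
      with y hy using inChart_extD hβ p hy
  rw [extD, hev.extDeriv_eq]
  exact extDeriv_extDeriv_apply (contDiffAt_inChart hβ p (mem_extChartAt_target p))
    (by rw [minSmoothness_of_isRCLikeNormedField]; exact ENat.LEInfty.out)

theorem differentiableAt_comp_symm {f : S → ℝ} (hf : ContMDiff (𝓡 3) 𝓘(ℝ, ℝ) ∞ f) (p : S) :
    DifferentiableAt ℝ (f ∘ (extChartAt (𝓡 3) p).symm) (extChartAt (𝓡 3) p p) :=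
  ((contDiffOn_comp_symm hf p).contDiffAt ((isOpen_extChartAt_target p).mem_nhds
    (mem_extChartAt_target p))).differentiableAt (by simp)

theorem dFun_apply {f : S → ℝ} (hf : ContMDiff (𝓡 3) 𝓘(ℝ, ℝ) ∞ f) (p : S) :
    dFun f p = ContinuousAlternatingMap.ofSubsingleton ℝ E3 ℝ (0 : Fin 1)
      (fderiv ℝ (f ∘ (extChartAt (𝓡 3) p).symm) (extChartAt (𝓡 3) p p)) := by
  rw [← inChart_dFun hf p (mem_extChartAt_target p), inChart_self]

theorem dFun_add {f g : S → ℝ} (hf : ContMDiff (𝓡 3) 𝓘(ℝ, ℝ) ∞ f)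
    (hg : ContMDiff (𝓡 3) 𝓘(ℝ, ℝ) ∞ g) : dFun (f + g) = dFun f + dFun g := by
  funext p
  rw [Pi.add_apply, dFun_apply hf, dFun_apply hg, dFun_apply (hf.add hg)]
  have h : (f + g) ∘ (extChartAt (𝓡 3) p).symm =
    f ∘ (extChartAt (𝓡 3) p).symm + g ∘ (extChartAt (𝓡 3) p).symm := rfl
  rw [h, fderiv_add (differentiableAt_comp_symm hf p) (differentiableAt_comp_symm hg p)]
  rfl

theorem dFun_smul {f : S → ℝ} (hf : ContMDiff (𝓡 3) 𝓘(ℝ, ℝ) ∞ f) (c : ℝ) :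
    dFun (c • f) = c • dFun f := by
  funext p
  have hc : ContMDiff (𝓡 3) 𝓘(ℝ, ℝ) ∞ (c • f) := contMDiff_const.mul hf
  rw [Pi.smul_apply, dFun_apply hf, dFun_apply hc]
  have h : (c • f) ∘ (extChartAt (𝓡 3) p).symm = c • (f ∘ (extChartAt (𝓡 3) p).symm) := rfl
  rw [h, fderiv_const_smul (differentiableAt_comp_symm hf p)]
  rfl

/-- In a chart df is itself the exterior derivative of a 0-form, so this is d² = 0. -/
theorem extD_dFun {f : S → ℝ} (hf : ContMDiff (𝓡 3) 𝓘(ℝ, ℝ) ∞ f) : extD (dFun f) = 0 := by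
  funext p
  have ht := (isOpen_extChartAt_target p).mem_nhds (mem_extChartAt_target (I := 𝓡 3) p)
  have hev : inChart p (dFun f) =ᶠ[𝓝 (extChartAt (𝓡 3) p p)]
      extDeriv fun y => ContinuousAlternatingMap.constOfIsEmpty ℝ E3 (Fin 0)
        ((f ∘ (extChartAt (𝓡 3) p).symm) y) := by
    filter_upwards [ht] with y hy
    rw [inChart_dFun hf p hy, extDeriv_constOfIsEmpty]
  rw [extD, hev.extDeriv_eq]
  refine extDeriv_extDeriv_apply (r := ∞) ?_
    (by rw [minSmoothness_of_isRCLikeNormedField]; exact ENat.LEInfty.out)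
  exact (ContinuousAlternatingMap.constOfIsEmptyLIE ℝ E3 ℝ (Fin 0)).contDiff.contDiffAt.comp _
    ((contDiffOn_comp_symm hf p).contDiffAt ht)

theorem extD_fmul {k : ℕ} {f : S → ℝ} (hf : ContMDiff (𝓡 3) 𝓘(ℝ, ℝ) ∞ f) {β : Form S k}
    (hβ : β ∈ Omega S k) : extD (f ⊙ β) = dFun f ⋏ β + f ⊙ extD β := by
  funext p
  have hd := fderiv_smul (differentiableAt_comp_symm hf p)
    (differentiableAt_inChart hβ p (mem_extChartAt_target p))
  have h1 : inChart p (f ⊙ β) = (f ∘ (extChartAt (𝓡 3) p).symm) • inChart p β := rfl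
  rw [extD, h1, extDeriv, hd, ContinuousAlternatingMap.alternatizeUncurryFin_add,
    ContinuousAlternatingMap.alternatizeUncurryFin_smul, Pi.add_apply, wedge, inChart_self,
    dFun_apply hf]
  refine (add_comm _ _).trans ?_
  congr 1
  rw [Function.comp_apply, (extChartAt (𝓡 3) p).left_inv (mem_extChartAt_source p)]
  rfl

theorem wedgeL_one_apply (a b : E3 [⋀^Fin 1]→L[ℝ] ℝ) (v : Fin 2 → E3) :
    wedgeL 1 a b v = a ![v 0] * b ![v 1] - a ![v 1] * b ![v 0] := by
  have h := wedge_apply (S := E3) (fun _ => a) (fun _ => b) 0 v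
  rw [wedge_eq_wedgeL] at h
  have h0 : (0 : Fin 2).removeNth v = ![v 1] := by ext1 i; fin_cases i; rfl
  have h1 : (1 : Fin 2).removeNth v = ![v 0] := by ext1 i; fin_cases i; rfl
  rw [h, Fin.sum_univ_two, h0, h1]
  simp
  ring

theorem wedgeL_two_apply (a : E3 [⋀^Fin 1]→L[ℝ] ℝ) (b : E3 [⋀^Fin 2]→L[ℝ] ℝ)
    (v : Fin 3 → E3) :
    wedgeL 2 a b v =
      a ![v 0] * b ![v 1, v 2] - a ![v 1] * b ![v 0, v 2] + a ![v 2] * b ![v 0, v 1] := by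
  have h := wedge_apply (S := E3) (fun _ => a) (fun _ => b) 0 v
  rw [wedge_eq_wedgeL] at h
  have h0 : (0 : Fin 3).removeNth v = ![v 1, v 2] := by ext1 i; fin_cases i <;> rfl
  have h1 : (1 : Fin 3).removeNth v = ![v 0, v 2] := by ext1 i; fin_cases i <;> rfl
  have h2 : (2 : Fin 3).removeNth v = ![v 0, v 1] := by ext1 i; fin_cases i <;> rfl
  rw [h, Fin.sum_univ_three, h0, h1, h2]
  simp
  ring

open ContinuousAlternatingMap in
theorem alternatizeUncurryFin_one_apply (a' : E3 →L[ℝ] (E3 [⋀^Fin 1]→L[ℝ] ℝ)) (u w : E3) :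
    alternatizeUncurryFin a' ![u, w] = a' u ![w] - a' w ![u] := by
  have hs0 (a b : E3) : (0 : Fin 2).removeNth ![a, b] = ![b] := by
    ext1 j; fin_cases j; rfl
  have hs1 (a b : E3) : (1 : Fin 2).removeNth ![a, b] = ![a] := by
    ext1 j; fin_cases j; rfl
  rw [alternatizeUncurryFin_apply, Fin.sum_univ_two, hs0, hs1]
  simp [sub_eq_add_neg]

-- The algebra behind the Leibniz rule: `precompR` and `precompL` are the two terms of the
-- derivative of a bilinear expression. The 1-form is moved to the left of the 2-form because
-- `wedge` takes its 1-form there; this costs no sign.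
open ContinuousAlternatingMap in
theorem alternatize_wedgeL (a b : E3 [⋀^Fin 1]→L[ℝ] ℝ)
    (a' b' : E3 →L[ℝ] (E3 [⋀^Fin 1]→L[ℝ] ℝ)) :
    alternatizeUncurryFin ((wedgeL 1).precompR E3 a b' + (wedgeL 1).precompL E3 a' b) =
      wedgeL 2 b (alternatizeUncurryFin a') - wedgeL 2 a (alternatizeUncurryFin b') := by
  ext v
  have hr0 : (0 : Fin 3).removeNth v = ![v 1, v 2] := by ext1 i; fin_cases i <;> rfl
  have hr1 : (1 : Fin 3).removeNth v = ![v 0, v 2] := by ext1 i; fin_cases i <;> rfl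
  have hr2 : (2 : Fin 3).removeNth v = ![v 0, v 1] := by ext1 i; fin_cases i <;> rfl
  rw [ContinuousAlternatingMap.sub_apply, wedgeL_two_apply, wedgeL_two_apply,
    alternatizeUncurryFin_apply, Fin.sum_univ_three, hr0, hr1, hr2]
  simp only [alternatizeUncurryFin_one_apply, _root_.add_apply, ContinuousLinearMap.precompR_apply,
    ContinuousLinearMap.precompL_apply, ContinuousLinearMap.compL_apply, ContinuousLinearMap.comp_apply,
    ContinuousAlternatingMap.add_apply, wedgeL_one_apply,
    Matrix.cons_val_zero, Matrix.cons_val_one, Fin.val_zero, Fin.val_one, Fin.val_two, zsmul_eq_mul]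
  push_cast
  ring

theorem extD_wedge {α β : Form S 1} (hα : α ∈ Omega S 1) (hβ : β ∈ Omega S 1) :
    extD (α ⋏ β) = β ⋏ extD α - α ⋏ extD β := by
  funext p
  have ha := differentiableAt_inChart hα p (mem_extChartAt_target p)
  have hb := differentiableAt_inChart hβ p (mem_extChartAt_target p)
  have h1 : inChart p (α ⋏ β) = fun y => wedgeL 1 (inChart p α y) (inChart p β y) :=
    funext (inChart_wedge p α β)
  have hd := ((wedgeL 1).hasFDerivAt_of_bilinear ha.hasFDerivAt hb.hasFDerivAt).fderiv
  rw [inChart_self, inChart_self] at hd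
  rw [extD, h1, extDeriv, hd, alternatize_wedgeL]
  rfl

end ChartCalculus

/-! ### Integration of 3-forms, Stokes' theorem and the fundamental lemma. -/

section Integration

open MeasureTheory

theorem contDiffOn_sign {V : Type*} [NormedAddCommGroup V] [NormedSpace ℝ V] {f : V → ℝ}
    {s : Set V} (hs : IsOpen s) (hf : ContinuousOn f s) (h0 : ∀ y ∈ s, f y ≠ 0) {y : V}
    (hy : y ∈ s) : (fun z => Real.sign (f z)) =ᶠ[𝓝 y] fun _ => Real.sign (f y) := by
  have hc := hf.continuousAt (hs.mem_nhds hy)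
  rcases lt_or_gt_of_ne (h0 y hy) with h | h
  · filter_upwards [hc.eventually_lt_const h] with z hz
    rw [Real.sign_of_neg hz, Real.sign_of_neg h]
  · filter_upwards [hc.eventually_const_lt h] with z hz
    rw [Real.sign_of_pos hz, Real.sign_of_pos h]

/-- Extension by zero: the open set and the complement of the compact set cover the space, and the
extended function is smooth on each. -/
theorem contDiff_indicator_of_compact {V W : Type*} [NormedAddCommGroup V] [NormedSpace ℝ V]
    [NormedAddCommGroup W] [NormedSpace ℝ W] {h : V → W} {s K : Set V} (hs : IsOpen s)
    (hh : ContDiffOn ℝ ∞ h s) (hK : IsCompact K) (hKs : K ⊆ s) (h0 : ∀ y ∈ s, y ∉ K → h y = 0) :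
    ContDiff ℝ ∞ (s.indicator h) ∧ HasCompactSupport (s.indicator h) ∧
      tsupport (s.indicator h) ⊆ s := by
  have hz : ∀ y ∉ K, s.indicator h y = 0 := fun y hy => by
    by_cases hys : y ∈ s
    · rw [Set.indicator_of_mem hys, h0 y hys hy]
    · rw [Set.indicator_of_notMem hys]
  refine ⟨contDiff_iff_contDiffAt.2 fun y => ?_, HasCompactSupport.intro hK hz,
    (closure_minimal (Function.support_subset_iff'.2 hz) hK.isClosed).trans hKs⟩
  by_cases hys : y ∈ s
  · refine (hh.contDiffAt (hs.mem_nhds hys)).congr_of_eventuallyEq ?_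
    filter_upwards [hs.mem_nhds hys] with z hzs using Set.indicator_of_mem hzs h
  · refine (contDiffAt_const (c := (0 : W))).congr_of_eventuallyEq ?_
    filter_upwards [hK.isClosed.isOpen_compl.mem_nhds (fun hyK => hys (hKs hyK))] with z hzK
      using hz z hzK

theorem integral_fderiv_eq_zero {f : E3 → ℝ} (hf : ContDiff ℝ ∞ f) (hc : HasCompactSupport f)
    (v : E3) : ∫ y, fderiv ℝ f y v = 0 := by
  have hd : Differentiable ℝ f := hf.differentiable (by simp)
  have hi : Integrable (fun y => fderiv ℝ f y v) :=
    ((hf.continuous_fderiv (by simp)).clm_apply continuous_const).integrable_of_hasCompactSupport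
      (hc.fderiv_apply ℝ v)
  have hif : Integrable f := hf.continuous.integrable_of_hasCompactSupport hc
  -- Integration by parts against the constant function 1, whose derivative is 0.
  have h := integral_bilinear_hasLineDerivAt_right_eq_neg_left_of_integrable (μ := volume)
    (f := fun _ : E3 => (1 : ℝ)) (f' := fun _ => 0) (g := f) (g' := fun y => fderiv ℝ f y v)
    (v := v) (B := ContinuousLinearMap.mul ℝ ℝ) (by simp) (by simpa using hi) (by simpa using hif)
    (fun x _ => by simpa using (hasFDerivAt_const (1 : ℝ) x).hasLineDerivAt v)
    (fun x _ => (hd x).hasFDerivAt.hasLineDerivAt v)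
  simpa using h

/-- The standard basis of `E3`. -/
noncomputable def stdBasis : Module.Basis (Fin 3) ℝ E3 := (EuclideanSpace.basisFun (Fin 3) ℝ).toBasis

theorem coe_stdBasis : ⇑stdBasis = stdFrame := by
  funext i
  simp [stdBasis, stdFrame]

theorem top_form_apply (w : E3 [⋀^Fin 3]→L[ℝ] ℝ) (v : Fin 3 → E3) :
    w v = w stdFrame * stdBasis.det v := by
  have h := AlternatingMap.eq_smul_basis_det stdBasis w.toAlternatingMap
  have h2 := congrArg (fun f => f v) h
  rw [coe_stdBasis] at h2
  exact h2

theorem top_form_comp (w : E3 [⋀^Fin 3]→L[ℝ] ℝ) (T : E3 →L[ℝ] E3) :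
    w.compContinuousLinearMap T stdFrame = T.det * w stdFrame := by
  rw [ContinuousAlternatingMap.compContinuousLinearMap_apply, top_form_apply]
  have h := Module.Basis.det_comp stdBasis (T : E3 →ₗ[ℝ] E3) stdFrame
  rw [← coe_stdBasis] at *
  rw [Module.Basis.det_self, mul_one] at h
  rw [mul_comm]
  congr 1

theorem top_form_eq_zero {w : E3 [⋀^Fin 3]→L[ℝ] ℝ} (h : w stdFrame = 0) : w = 0 := by
  ext v
  rw [top_form_apply, h, zero_mul]
  rfl

/-- With `d` a Jacobian determinant, this turns the transformation law of a 3-form into that of a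
density: the orientation sign supplies exactly what separates `d` from `|d|`. -/
theorem sign_mul_mul (d v g : ℝ) : Real.sign (d * v) * (d * g) = |d| * (Real.sign v * g) := by
  rcases lt_trichotomy d 0 with h | rfl | h
  · rcases lt_trichotomy v 0 with h' | rfl | h'
    · rw [Real.sign_of_pos (mul_pos_of_neg_of_neg h h'), Real.sign_of_neg h', abs_of_neg h]; ring
    · simp
    · rw [Real.sign_of_neg (mul_neg_of_neg_of_pos h h'), Real.sign_of_pos h', abs_of_neg h]; ring
  · simp
  · rcases lt_trichotomy v 0 with h' | rfl | h'
    · rw [Real.sign_of_neg (mul_neg_of_pos_of_neg h h'), Real.sign_of_neg h', abs_of_pos h]; ring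
    · simp
    · rw [Real.sign_of_pos (mul_pos h h'), Real.sign_of_pos h', abs_of_pos h]; ring

variable {S : Type*} [TopologicalSpace S] [ChartedSpace E3 S] [IsManifold (𝓡 3) ∞ S]

theorem inChart_top {x x' p : S} (hx : p ∈ (extChartAt (𝓡 3) x).source)
    (hx' : p ∈ (extChartAt (𝓡 3) x').source) (γ : Form S 3) :
    inChart x γ (extChartAt (𝓡 3) x p) stdFrame =
      (tangentCoordChange (𝓡 3) x x' p).det * inChart x' γ (extChartAt (𝓡 3) x' p) stdFrame := by
  rw [inChart_eq_comp x x' γ hx hx', top_form_comp]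

/-- The factor `d` is the determinant of a chart change and does not depend on the form, so
quotients of 3-forms can be taken in any chart. -/
theorem inChart_top_self {x : S} {y : E3} (hy : y ∈ (extChartAt (𝓡 3) x).target) :
    ∃ d : ℝ, d ≠ 0 ∧ ∀ γ : Form S 3,
      inChart x γ y stdFrame = d * γ ((extChartAt (𝓡 3) x).symm y) stdFrame := by
  obtain ⟨p, hp, rfl⟩ : ∃ p ∈ (extChartAt (𝓡 3) x).source, extChartAt (𝓡 3) x p = y :=
    ⟨_, (extChartAt (𝓡 3) x).map_target hy, (extChartAt (𝓡 3) x).right_inv hy⟩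
  have hpp := mem_extChartAt_source (I := 𝓡 3) p
  refine ⟨(tangentCoordChange (𝓡 3) x p p).det, ?_, fun γ => ?_⟩
  · have h : (tangentCoordChange (𝓡 3) x p p) ∘L (tangentCoordChange (𝓡 3) p x p) =
        ContinuousLinearMap.id ℝ E3 := by
      ext1 v
      rw [ContinuousLinearMap.comp_apply, tangentCoordChange_comp ⟨⟨hpp, hp⟩, hpp⟩,
        tangentCoordChange_self hpp]
      rfl
    intro h0
    have h1 : (tangentCoordChange (𝓡 3) x p p ∘L tangentCoordChange (𝓡 3) p x p).det =
        (tangentCoordChange (𝓡 3) x p p).det * (tangentCoordChange (𝓡 3) p x p).det :=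
      LinearMap.det_comp _ _
    rw [h, h0, zero_mul] at h1
    have h2 : (ContinuousLinearMap.id ℝ E3).det = 1 := LinearMap.det_id
    rw [h2] at h1
    exact one_ne_zero h1
  · rw [inChart_top hp hpp, inChart_self, (extChartAt (𝓡 3) x).left_inv hp]

theorem ratio_contMDiff {β v : Form S 3} (hβ : β ∈ Omega S 3) (hv : v ∈ Omega S 3)
    (h0 : ∀ p, v p ≠ 0) : ContMDiff (𝓡 3) 𝓘(ℝ, ℝ) ∞ (ratio β v) := by
  refine contMDiff_of_contDiffOn_comp_symm fun x => ?_
  have hev (γ : Form S 3) (hγ : γ ∈ Omega S 3) : ContDiffOn ℝ ∞ (fun y => inChart x γ y stdFrame)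
      (extChartAt (𝓡 3) x).target :=
    (ContinuousAlternatingMap.apply ℝ E3 ℝ stdFrame).contDiff.comp_contDiffOn (hγ x)
  have h1 : ∀ y ∈ (extChartAt (𝓡 3) x).target, inChart x v y stdFrame ≠ 0 := fun y hy h => by
    obtain ⟨d, hd, hγ⟩ := inChart_top_self hy
    rw [hγ] at h
    exact h0 _ (top_form_eq_zero ((mul_eq_zero.1 h).resolve_left hd))
  refine ((hev β hβ).div (hev v hv) h1).congr fun y hy => ?_
  obtain ⟨d, hd, hγ⟩ := inChart_top_self hy
  simp only [Function.comp_apply, ratio, Pi.div_apply, hγ]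
  rw [mul_div_mul_left _ _ hd]

/-- The integral over a chart domain. -/
noncomputable def chartIntegral (vol₀ : Form S 3) (x : S) (γ : Form S 3) : ℝ :=
  ∫ y in (extChartAt (𝓡 3) x).target,
    Real.sign (inChart x vol₀ y stdFrame) * inChart x γ y stdFrame

/-- Change of variables on the overlap of the two chart domains; the hypothesis says that nothing is
lost outside it. -/
theorem chartIntegral_eq (vol₀ : Form S 3) (x x' : S) (γ : Form S 3)
    (h : ∀ p, ¬(p ∈ (extChartAt (𝓡 3) x).source ∧ p ∈ (extChartAt (𝓡 3) x').source) → γ p = 0) :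
    chartIntegral vol₀ x γ = chartIntegral vol₀ x' γ := by
  have hopen (x x' : S) : IsOpen ((extChartAt (𝓡 3) x).target ∩
      (extChartAt (𝓡 3) x).symm ⁻¹' (extChartAt (𝓡 3) x').source) :=
    (continuousOn_extChartAt_symm x).isOpen_inter_preimage (isOpen_extChartAt_target x)
      (isOpen_extChartAt_source x')
  have hrestr (x x' : S) (h : ∀ p, ¬(p ∈ (extChartAt (𝓡 3) x).source ∧
      p ∈ (extChartAt (𝓡 3) x').source) → γ p = 0) : chartIntegral vol₀ x γ =
      ∫ y in (extChartAt (𝓡 3) x).target ∩ (extChartAt (𝓡 3) x).symm ⁻¹'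
        (extChartAt (𝓡 3) x').source,
        Real.sign (inChart x vol₀ y stdFrame) * inChart x γ y stdFrame := by
    refine setIntegral_eq_of_subset_of_forall_sdiff_eq_zero
      (isOpen_extChartAt_target x).measurableSet Set.inter_subset_left fun y hy => ?_
    have h0 := h ((extChartAt (𝓡 3) x).symm y) fun hc => hy.2 ⟨hy.1, hc.2⟩
    rw [inChart_apply x γ, h0]
    exact mul_zero _
  rw [hrestr x x' h, hrestr x' x fun p hp => h p fun hc => hp ⟨hc.2, hc.1⟩]
  have himg : (extChartAt (𝓡 3) x' ∘ (extChartAt (𝓡 3) x).symm) ''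
      ((extChartAt (𝓡 3) x).target ∩ (extChartAt (𝓡 3) x).symm ⁻¹' (extChartAt (𝓡 3) x').source) =
      (extChartAt (𝓡 3) x').target ∩ (extChartAt (𝓡 3) x').symm ⁻¹'
        (extChartAt (𝓡 3) x).source := by
    ext z
    constructor
    · rintro ⟨y, ⟨hy, hy'⟩, rfl⟩
      refine ⟨(extChartAt (𝓡 3) x').map_source hy', ?_⟩
      rw [Set.mem_preimage, Function.comp_apply, (extChartAt (𝓡 3) x').left_inv hy']
      exact (extChartAt (𝓡 3) x).map_target hy
    · rintro ⟨hz, hz'⟩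
      refine ⟨extChartAt (𝓡 3) x ((extChartAt (𝓡 3) x').symm z),
        ⟨(extChartAt (𝓡 3) x).map_source hz', ?_⟩, ?_⟩
      · rw [Set.mem_preimage, (extChartAt (𝓡 3) x).left_inv hz']
        exact (extChartAt (𝓡 3) x').map_target hz
      · rw [Function.comp_apply, (extChartAt (𝓡 3) x).left_inv hz',
          (extChartAt (𝓡 3) x').right_inv hz]
  rw [← himg, integral_image_eq_integral_abs_det_fderiv_smul volume (hopen x x').measurableSet
    (f' := fun y => tangentCoordChange (𝓡 3) x x' ((extChartAt (𝓡 3) x).symm y))]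
  · refine setIntegral_congr_fun (hopen x x').measurableSet fun y hy => ?_
    have h1 := inChart_top ((extChartAt (𝓡 3) x).map_target hy.1) hy.2
    rw [(extChartAt (𝓡 3) x).right_inv hy.1] at h1
    simp only [h1, sign_mul_mul, Function.comp_apply, smul_eq_mul]
  · intro y hy
    have h1 := hasFDerivAt_transition ((extChartAt (𝓡 3) x).map_target hy.1) hy.2
    rw [(extChartAt (𝓡 3) x).right_inv hy.1] at h1
    exact h1.hasFDerivWithinAt
  · intro y hy z hz hyz
    have h1 := (extChartAt (𝓡 3) x').injOn hy.2 hz.2 hyz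
    exact (extChartAt (𝓡 3) x).symm.injOn hy.1 hz.1 h1

theorem inChart_vol_ne_zero {vol₀ : Form S 3} (hne : ∀ p, vol₀ p ≠ 0) (x : S) {y : E3}
    (hy : y ∈ (extChartAt (𝓡 3) x).target) : inChart x vol₀ y stdFrame ≠ 0 := fun h => by
  obtain ⟨d, hd, hγ⟩ := inChart_top_self hy
  rw [hγ] at h
  exact hne _ (top_form_eq_zero ((mul_eq_zero.1 h).resolve_left hd))

theorem eventually_sign_vol {vol₀ : Form S 3} (hvol₀ : vol₀ ∈ Omega S 3) (hne : ∀ p, vol₀ p ≠ 0)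
    (x : S) {y : E3} (hy : y ∈ (extChartAt (𝓡 3) x).target) :
    (fun z => Real.sign (inChart x vol₀ z stdFrame)) =ᶠ[𝓝 y]
      fun _ => Real.sign (inChart x vol₀ y stdFrame) := by
  refine contDiffOn_sign (isOpen_extChartAt_target x) ?_
    (fun z hz => inChart_vol_ne_zero hne x hz) hy
  exact ((ContinuousAlternatingMap.apply ℝ E3 ℝ stdFrame).contDiff.comp_contDiffOn
    (hvol₀ x)).continuousOn

/-- The orientation sign is locally constant on the chart target, and a closed subset of the compact
manifold has compact image, so the signed expression extends by zero to a smooth compactly supported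
form on `E3`. -/
theorem contDiff_signed_inChart [CompactSpace S] {vol₀ : Form S 3} (hvol₀ : vol₀ ∈ Omega S 3)
    (hne : ∀ p, vol₀ p ≠ 0) {k : ℕ} {γ : Form S k} (hγ : γ ∈ Omega S k) {x : S} {C : Set S}
    (hC : IsClosed C) (hCx : C ⊆ (extChartAt (𝓡 3) x).source) (h0 : ∀ p ∉ C, γ p = 0) :
    ContDiff ℝ ∞ ((extChartAt (𝓡 3) x).target.indicator
        fun y => Real.sign (inChart x vol₀ y stdFrame) • inChart x γ y) ∧
      HasCompactSupport ((extChartAt (𝓡 3) x).target.indicator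
        fun y => Real.sign (inChart x vol₀ y stdFrame) • inChart x γ y) ∧
      tsupport ((extChartAt (𝓡 3) x).target.indicator
        fun y => Real.sign (inChart x vol₀ y stdFrame) • inChart x γ y) ⊆
          (extChartAt (𝓡 3) x).target := by
  refine contDiff_indicator_of_compact (K := extChartAt (𝓡 3) x '' C) (isOpen_extChartAt_target x)
    ?_ ?_ ?_ ?_
  · intro y hy
    refine ContDiffAt.contDiffWithinAt ?_
    refine ((contDiffAt_inChart hγ x hy).const_smul
      (Real.sign (inChart x vol₀ y stdFrame))).congr_of_eventuallyEq ?_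
    filter_upwards [eventually_sign_vol hvol₀ hne x hy] with z hz
    rw [hz]
  · exact hC.isCompact.image_of_continuousOn ((continuousOn_extChartAt x).mono hCx)
  · rintro _ ⟨p, hp, rfl⟩
    exact (extChartAt (𝓡 3) x).map_source (hCx hp)
  · intro y hy hyC
    have h1 : γ ((extChartAt (𝓡 3) x).symm y) = 0 :=
      h0 _ fun hc => hyC ⟨_, hc, (extChartAt (𝓡 3) x).right_inv hy⟩
    ext v
    rw [ContinuousAlternatingMap.smul_apply, inChart_apply x γ, h1]
    simp

theorem chartIntegral_eq_integral (vol₀ : Form S 3) (x : S) (γ : Form S 3) :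
    chartIntegral vol₀ x γ = ∫ y, (extChartAt (𝓡 3) x).target.indicator
      (fun y => Real.sign (inChart x vol₀ y stdFrame) • inChart x γ y) y stdFrame := by
  rw [chartIntegral, ← integral_indicator (isOpen_extChartAt_target x).measurableSet]
  congr 1
  funext y
  by_cases hy : y ∈ (extChartAt (𝓡 3) x).target
  · rw [Set.indicator_of_mem hy, Set.indicator_of_mem hy]
    rfl
  · rw [Set.indicator_of_notMem hy, Set.indicator_of_notMem hy]
    rfl

theorem integrable_signed_inChart [CompactSpace S] {vol₀ : Form S 3} (hvol₀ : vol₀ ∈ Omega S 3)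
    (hne : ∀ p, vol₀ p ≠ 0) {γ : Form S 3} (hγ : γ ∈ Omega S 3) {x : S} {C : Set S}
    (hC : IsClosed C) (hCx : C ⊆ (extChartAt (𝓡 3) x).source) (h0 : ∀ p ∉ C, γ p = 0) :
    Integrable fun y => (extChartAt (𝓡 3) x).target.indicator
      (fun y => Real.sign (inChart x vol₀ y stdFrame) • inChart x γ y) y stdFrame := by
  obtain ⟨h1, h2, -⟩ := contDiff_signed_inChart hvol₀ hne hγ hC hCx h0
  refine Continuous.integrable_of_hasCompactSupport
    ((ContinuousAlternatingMap.apply ℝ E3 ℝ stdFrame).continuous.comp h1.continuous) ?_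
  exact h2.comp_left (g := ContinuousAlternatingMap.apply ℝ E3 ℝ stdFrame) (map_zero _)

theorem chartIntegral_add [CompactSpace S] {vol₀ : Form S 3} (hvol₀ : vol₀ ∈ Omega S 3)
    (hne : ∀ p, vol₀ p ≠ 0) {γ γ' : Form S 3} (hγ : γ ∈ Omega S 3) (hγ' : γ' ∈ Omega S 3) {x : S}
    {C : Set S} (hC : IsClosed C) (hCx : C ⊆ (extChartAt (𝓡 3) x).source)
    (h0 : ∀ p ∉ C, γ p = 0) (h0' : ∀ p ∉ C, γ' p = 0) :
    chartIntegral vol₀ x (γ + γ') = chartIntegral vol₀ x γ + chartIntegral vol₀ x γ' := by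
  rw [chartIntegral_eq_integral, chartIntegral_eq_integral, chartIntegral_eq_integral,
    ← integral_add (integrable_signed_inChart hvol₀ hne hγ hC hCx h0)
      (integrable_signed_inChart hvol₀ hne hγ' hC hCx h0')]
  congr 1
  funext y
  by_cases hy : y ∈ (extChartAt (𝓡 3) x).target
  · simp only [Set.indicator_of_mem hy, inChart_add, Pi.add_apply, smul_add]
    rfl
  · simp only [Set.indicator_of_notMem hy]
    simp

theorem chartIntegral_smul (vol₀ : Form S 3) (x : S) (c : ℝ) (γ : Form S 3) :
    chartIntegral vol₀ x (c • γ) = c * chartIntegral vol₀ x γ := by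
  rw [chartIntegral, chartIntegral, ← integral_const_mul]
  congr 1
  funext y
  rw [inChart_smul, Pi.smul_apply, ContinuousAlternatingMap.smul_apply, smul_eq_mul]
  ring

theorem chartIntegral_zero (vol₀ : Form S 3) (x : S) : chartIntegral vol₀ x 0 = 0 := by
  have h := chartIntegral_smul vol₀ x 0 0
  rwa [zero_smul, zero_mul] at h

theorem chartIntegral_sum [CompactSpace S] {vol₀ : Form S 3} (hvol₀ : vol₀ ∈ Omega S 3)
    (hne : ∀ p, vol₀ p ≠ 0) {ι : Type*} (s : Finset ι) {γ : ι → Form S 3}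
    (hγ : ∀ i, γ i ∈ Omega S 3) {x : S}
    {C : Set S} (hC : IsClosed C) (hCx : C ⊆ (extChartAt (𝓡 3) x).source)
    (h0 : ∀ i, ∀ p ∉ C, γ i p = 0) :
    chartIntegral vol₀ x (∑ i ∈ s, γ i) = ∑ i ∈ s, chartIntegral vol₀ x (γ i) := by
  classical
  induction s using Finset.induction_on with
  | empty => simp [chartIntegral_zero]
  | insert a s ha ih =>
    rw [Finset.sum_insert ha, Finset.sum_insert ha, chartIntegral_add hvol₀ hne (hγ a)
      (Submodule.sum_mem _ fun i _ => hγ i) hC hCx (h0 a), ih]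
    intro p hp
    rw [Finset.sum_apply]
    exact Finset.sum_eq_zero fun i _ => h0 i p hp

/-- Stokes' theorem in one chart: the locally constant sign passes through d, and the integrand
becomes a sum of directional derivatives of compactly supported functions, each of integral 0. -/
theorem chartIntegral_extD [CompactSpace S] {vol₀ : Form S 3} (hvol₀ : vol₀ ∈ Omega S 3)
    (hne : ∀ p, vol₀ p ≠ 0) {η : Form S 2} (hη : η ∈ Omega S 2) {x : S}
    {C : Set S} (hC : IsClosed C) (hCx : C ⊆ (extChartAt (𝓡 3) x).source)
    (h0 : ∀ p ∉ C, η p = 0) : chartIntegral vol₀ x (extD η) = 0 := by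
  obtain ⟨h1, h2, hsub⟩ := contDiff_signed_inChart hvol₀ hne hη hC hCx h0
  set w := (extChartAt (𝓡 3) x).target.indicator
    fun y => Real.sign (inChart x vol₀ y stdFrame) • inChart x η y with hw
  have hd : Differentiable ℝ w := h1.differentiable (by simp)
  have h3 : chartIntegral vol₀ x (extD η) =
      ∫ y in (extChartAt (𝓡 3) x).target, extDeriv w y stdFrame := by
    refine setIntegral_congr_fun (isOpen_extChartAt_target x).measurableSet fun y hy => ?_
    have hev : w =ᶠ[𝓝 y] Real.sign (inChart x vol₀ y stdFrame) • inChart x η := by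
      filter_upwards [eventually_sign_vol hvol₀ hne x hy,
        (isOpen_extChartAt_target x).mem_nhds hy] with z hz hzt
      rw [hw, Set.indicator_of_mem hzt, hz]
      rfl
    simp only [hev.extDeriv_eq, extDeriv_smul, inChart_extD hη x hy,
      ContinuousAlternatingMap.smul_apply, smul_eq_mul]
  have h4 : (∫ y in (extChartAt (𝓡 3) x).target, extDeriv w y stdFrame) =
      ∫ y, extDeriv w y stdFrame := by
    -- A point outside the target is outside the support of `w`, so `w` vanishes near it and its
    -- derivative vanishes there too.
    refine setIntegral_eq_integral_of_forall_compl_eq_zero fun y hy => ?_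
    have hev : w =ᶠ[𝓝 y] fun _ => 0 := notMem_tsupport_iff_eventuallyEq.1 fun h => hy (hsub h)
    rw [hev.extDeriv_eq, extDeriv]
    simp [ContinuousAlternatingMap.alternatizeUncurryFin_apply]
  have h5 (u : Fin 2 → E3) : ContDiff ℝ ∞ (fun y => w y u) ∧ HasCompactSupport fun y => w y u :=
    ⟨(ContinuousAlternatingMap.apply ℝ E3 ℝ u).contDiff.comp h1,
      h2.comp_left (g := ContinuousAlternatingMap.apply ℝ E3 ℝ u) (map_zero _)⟩
  rw [h3, h4]
  simp only [extDeriv_apply (hd _)]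
  rw [integral_finsetSum]
  · refine Finset.sum_eq_zero fun i _ => ?_
    simp only [zsmul_eq_mul]
    rw [integral_const_mul, integral_fderiv_eq_zero (h5 _).1 (h5 _).2, mul_zero]
  · intro i _
    simp only [zsmul_eq_mul]
    refine Integrable.const_mul ?_ _
    exact (((h5 _).1.continuous_fderiv (by simp)).clm_apply
      continuous_const).integrable_of_hasCompactSupport ((h5 _).2.fderiv_apply ℝ _)

theorem extD_eq_zero_of_notMem {k : ℕ} {η : Form S k} {C : Set S} (hC : IsClosed C)
    (h0 : ∀ p ∉ C, η p = 0) : ∀ p ∉ C, extD η p = 0 := by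
  intro p hp
  have hev : inChart p η =ᶠ[𝓝 (extChartAt (𝓡 3) p p)] fun _ => 0 := by
    have hc := (continuousAt_extChartAt_symm (I := 𝓡 3) p).preimage_mem_nhds (t := Cᶜ) (by
      rw [(extChartAt (𝓡 3) p).left_inv (mem_extChartAt_source p)]
      exact hC.isOpen_compl.mem_nhds hp)
    filter_upwards [hc] with y hy
    ext v
    rw [inChart_apply, h0 _ hy]
    rfl
  rw [extD, hev.extDeriv_eq, extDeriv]
  ext v
  simp [ContinuousAlternatingMap.alternatizeUncurryFin_apply]

variable [CompactSpace S] [T2Space S]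

theorem tsupport_chartPartition_subset (x : S) :
    tsupport (chartPartition S x) ⊆ (extChartAt (𝓡 3) x).source := by
  rw [extChartAt_source]
  exact (SmoothPartitionOfUnity.exists_isSubordinate_chartAt_source (𝓡 3) S).choose_spec x

theorem chartPartition_eq_zero {x p : S} (h : p ∉ (extChartAt (𝓡 3) x).source) :
    chartPartition S x p = 0 := by
  by_contra hne
  exact h (tsupport_chartPartition_subset x (subset_tsupport _ hne))

variable (S) in
-- A locally finite family on a compact space has only finitely many nonzero members, which makes
-- the `finsum` in `integral` a finite sum.
theorem exists_chartPartition_finset : ∃ J : Finset S, (∀ x ∉ J, ∀ p, chartPartition S x p = 0) ∧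
    ∀ p, ∑ x ∈ J, chartPartition S x p = 1 := by
  have hfin := (chartPartition S).locallyFinite.finite_nonempty_of_compact
  have hJ : ∀ x ∉ hfin.toFinset, ∀ p, chartPartition S x p = 0 := fun x hx p => by
    by_contra h
    exact hx (hfin.mem_toFinset.2 ⟨p, h⟩)
  refine ⟨hfin.toFinset, hJ, fun p => ?_⟩
  refine (chartPartition S).sum_finsupport' p (Set.mem_univ p) fun x hx => ?_
  by_contra h
  exact ((chartPartition S).mem_finsupport p).1 hx (hJ x h p)

variable (S) in
/-- The indices of the nonzero members of the partition of unity. -/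
noncomputable def chartFinset : Finset S := (exists_chartPartition_finset S).choose

theorem chartPartition_eq_zero_of_notMem {x : S} (hx : x ∉ chartFinset S) (p : S) :
    chartPartition S x p = 0 :=
  (exists_chartPartition_finset S).choose_spec.1 x hx p

theorem sum_chartPartition (p : S) : ∑ x ∈ chartFinset S, chartPartition S x p = 1 :=
  (exists_chartPartition_finset S).choose_spec.2 p

theorem integral_eq_sum (vol₀ β : Form S 3) :
    integral vol₀ β = ∑ x ∈ chartFinset S, chartIntegral vol₀ x (chartPartition S x ⊙ β) := by
  rw [integral]
  have h : ∀ x : S, (∫ y in (extChartAt (𝓡 3) x).target,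
      chartPartition S x ((extChartAt (𝓡 3) x).symm y) *
        Real.sign (inChart x vol₀ y stdFrame) * inChart x β y stdFrame) =
      chartIntegral vol₀ x (chartPartition S x ⊙ β) := fun x => by
    rw [chartIntegral]
    congr 1
    funext y
    rw [inChart_fmul, ContinuousAlternatingMap.smul_apply, smul_eq_mul]
    ring
  rw [finsum_congr h]
  refine finsum_eq_sum_of_support_subset _ fun x hx => ?_
  by_contra hxJ
  refine hx ?_
  have h0 : (chartPartition S x ⊙ β : Form S 3) = 0 := by
    funext p
    rw [fmul, chartPartition_eq_zero_of_notMem (by simpa using hxJ), zero_smul]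
    rfl
  simp only [h0, chartIntegral_zero]

theorem chartPartition_fmul_mem {k : ℕ} (x : S) {β : Form S k} (hβ : β ∈ Omega S k) :
    chartPartition S x ⊙ β ∈ Omega S k :=
  fmul_mem (chartPartition S x).contMDiff hβ

theorem chartPartition_fmul_eq_zero {k : ℕ} (x : S) (β : Form S k) :
    ∀ p ∉ tsupport (chartPartition S x), (chartPartition S x ⊙ β) p = 0 := fun p hp => by
  rw [fmul, image_eq_zero_of_notMem_tsupport hp, zero_smul]

theorem integral_add {vol₀ : Form S 3} (hvol₀ : vol₀ ∈ Omega S 3) (hne : ∀ p, vol₀ p ≠ 0)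
    {γ γ' : Form S 3} (hγ : γ ∈ Omega S 3) (hγ' : γ' ∈ Omega S 3) :
    integral vol₀ (γ + γ') = integral vol₀ γ + integral vol₀ γ' := by
  rw [integral_eq_sum, integral_eq_sum, integral_eq_sum, ← Finset.sum_add_distrib]
  refine Finset.sum_congr rfl fun x _ => ?_
  rw [← chartIntegral_add hvol₀ hne (chartPartition_fmul_mem x hγ) (chartPartition_fmul_mem x hγ')
    (isClosed_tsupport _) (tsupport_chartPartition_subset x) (chartPartition_fmul_eq_zero x _)
    (chartPartition_fmul_eq_zero x _)]
  congr 1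
  funext p
  exact smul_add _ _ _

theorem integral_smul (vol₀ : Form S 3) (c : ℝ) (γ : Form S 3) :
    integral vol₀ (c • γ) = c * integral vol₀ γ := by
  rw [integral_eq_sum, integral_eq_sum, Finset.mul_sum]
  refine Finset.sum_congr rfl fun x _ => ?_
  rw [← chartIntegral_smul]
  congr 1
  funext p
  exact smul_comm (chartPartition S x p) c (γ p)

/-- **Stokes' theorem** on a closed manifold. -/
theorem integral_extD {vol₀ : Form S 3} (hvol₀ : vol₀ ∈ Omega S 3) (hne : ∀ p, vol₀ p ≠ 0)
    {β : Form S 2} (hβ : β ∈ Omega S 2) : integral vol₀ (extD β) = 0 := by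
  have hext : extD β = ∑ x ∈ chartFinset S, extD (chartPartition S x ⊙ β) := by
    have h1 : β = ∑ x ∈ chartFinset S, chartPartition S x ⊙ β := by
      funext p
      rw [Finset.sum_apply]
      simp only [fmul]
      rw [← Finset.sum_smul, sum_chartPartition, one_smul]
    have h2 : ∀ s : Finset S, extD (∑ x ∈ s, chartPartition S x ⊙ β) =
        ∑ x ∈ s, extD (chartPartition S x ⊙ β) := by
      classical
      intro s
      induction s using Finset.induction_on with
      | empty =>
        have h := extD_smul (S := S) (k := 2) 0 0
        rwa [zero_smul, zero_smul] at h
      | insert a s ha ih =>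
        rw [Finset.sum_insert ha, Finset.sum_insert ha, extD_add (chartPartition_fmul_mem a hβ)
          (Submodule.sum_mem _ fun i _ => chartPartition_fmul_mem i hβ), ih]
    conv_lhs => rw [h1]
    exact h2 _
  -- Two copies of the partition occur: one cuts `β` into pieces supported in a single chart `x'`,
  -- the other belongs to the definition of `integral`. For a fixed piece all chart integrals are
  -- transported to the chart `x'`, where the second copy sums to 1.
  have hpiece : ∀ x' : S, integral vol₀ (extD (chartPartition S x' ⊙ β)) = 0 := fun x' => by
    have hη := chartPartition_fmul_mem x' hβ
    have hη' := extD_mem hη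
    have hz := extD_eq_zero_of_notMem (isClosed_tsupport (chartPartition S x'))
      (chartPartition_fmul_eq_zero x' β)
    have hz' : ∀ x, ∀ p ∉ tsupport (chartPartition S x'),
        (chartPartition S x ⊙ extD (chartPartition S x' ⊙ β)) p = 0 := fun x p hp => by
      rw [fmul, hz p hp, smul_zero]
    rw [integral_eq_sum]
    have h1 : ∀ x ∈ chartFinset S,
        chartIntegral vol₀ x (chartPartition S x ⊙ extD (chartPartition S x' ⊙ β)) =
        chartIntegral vol₀ x' (chartPartition S x ⊙ extD (chartPartition S x' ⊙ β)) :=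
      fun x _ => chartIntegral_eq vol₀ x x' _ fun p hp => by
        by_cases hpx : p ∈ (extChartAt (𝓡 3) x).source
        · exact hz' x p fun hc => hp ⟨hpx, tsupport_chartPartition_subset x' hc⟩
        · rw [fmul, chartPartition_eq_zero hpx, zero_smul]
    rw [Finset.sum_congr rfl h1, ← chartIntegral_sum hvol₀ hne _
      (fun x => chartPartition_fmul_mem x hη') (isClosed_tsupport (chartPartition S x'))
      (tsupport_chartPartition_subset x') hz']
    have h2 : ∑ x ∈ chartFinset S, chartPartition S x ⊙ extD (chartPartition S x' ⊙ β) =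
        extD (chartPartition S x' ⊙ β) := by
      funext p
      rw [Finset.sum_apply]
      simp only [fmul]
      rw [← Finset.sum_smul, sum_chartPartition, one_smul]
    rw [h2]
    exact chartIntegral_extD hvol₀ hne hη (isClosed_tsupport (chartPartition S x'))
      (tsupport_chartPartition_subset x') (chartPartition_fmul_eq_zero x' β)
  have hsum : ∀ s : Finset S,
      integral vol₀ (∑ x ∈ s, extD (chartPartition S x ⊙ β)) = 0 := by
    classical
    intro s
    induction s using Finset.induction_on with
    | empty =>
      have h := integral_smul vol₀ 0 0
      rwa [zero_smul, zero_mul] at h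
    | insert a s ha ih =>
      rw [Finset.sum_insert ha, integral_add hvol₀ hne (extD_mem (chartPartition_fmul_mem a hβ))
        (Submodule.sum_mem _ fun i _ => extD_mem (chartPartition_fmul_mem i hβ)), ih, hpiece,
        add_zero]
  rw [hext, hsum]

/-- The fundamental lemma of the calculus of variations. -/
theorem eq_zero_of_integral_fmul_eq_zero {vol₀ : Form S 3} (hvol₀ : vol₀ ∈ Omega S 3)
    (hne : ∀ p, vol₀ p ≠ 0) {γ : Form S 3} (hγ : γ ∈ Omega S 3)
    (h : ∀ f : SmoothFun S, integral vol₀ (f ⊙ γ) = 0) : γ = 0 := by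
  have hr := ratio_contMDiff hγ hvol₀ hne
  have hγr : ∀ p, γ p stdFrame = ratio γ vol₀ p * vol₀ p stdFrame := fun p => by
    rw [ratio, div_mul_cancel₀]
    exact fun h0 => hne p (top_form_eq_zero h0)
  -- The test function is r = γ / vol₀ itself. In each chart the integrand is then the partition
  -- function times r² times |vol₀|, which is nonnegative.
  have hint : integral vol₀ (ratio γ vol₀ ⊙ γ) = 0 := h ⟨ratio γ vol₀, hr⟩
  rw [integral_eq_sum] at hint
  have hmem : ratio γ vol₀ ⊙ γ ∈ Omega S 3 := fmul_mem hr hγ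
  set G : S → E3 → ℝ := fun x y => (extChartAt (𝓡 3) x).target.indicator
      (fun y => Real.sign (inChart x vol₀ y stdFrame) •
        inChart x (chartPartition S x ⊙ (ratio γ vol₀ ⊙ γ)) y) y stdFrame with hG
  have hval : ∀ x, ∀ y ∈ (extChartAt (𝓡 3) x).target, G x y =
      chartPartition S x ((extChartAt (𝓡 3) x).symm y) *
        (ratio γ vol₀ ((extChartAt (𝓡 3) x).symm y)) ^ 2 *
        (Real.sign (inChart x vol₀ y stdFrame) * inChart x vol₀ y stdFrame) := fun x y hy => by
    obtain ⟨d, hd, hdγ⟩ := inChart_top_self hy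
    simp only [hG, Set.indicator_of_mem hy, ContinuousAlternatingMap.smul_apply, inChart_fmul,
      smul_eq_mul, hdγ, hγr]
    ring
  have hnn : ∀ x, 0 ≤ G x := fun x y => by
    by_cases hy : y ∈ (extChartAt (𝓡 3) x).target
    · rw [hval x y hy]
      exact mul_nonneg (mul_nonneg ((chartPartition S).nonneg x _) (sq_nonneg _))
        (Real.sign_mul_nonneg _)
    · simp only [hG, Set.indicator_of_notMem hy]
      exact le_rfl
  have hci : ∀ x, chartIntegral vol₀ x (chartPartition S x ⊙ (ratio γ vol₀ ⊙ γ)) =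
      ∫ y, G x y := fun x => chartIntegral_eq_integral _ _ _
  funext p
  obtain ⟨x, hx⟩ := (chartPartition S).exists_pos_of_mem (Set.mem_univ p)
  have hxJ : x ∈ chartFinset S := by
    by_contra hc
    exact hx.ne' (chartPartition_eq_zero_of_notMem hc p)
  have hpx : p ∈ (extChartAt (𝓡 3) x).source := by
    by_contra hc
    exact hx.ne' (chartPartition_eq_zero hc)
  have hzero : ∫ y, G x y = 0 := by
    have h1 := (Finset.sum_eq_zero_iff_of_nonneg fun x _ => by
      rw [hci x]; exact integral_nonneg (hnn x)).1 hint x hxJ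
    rwa [← hci]
  by_contra hp
  obtain ⟨h1, h2, -⟩ := contDiff_signed_inChart hvol₀ hne (chartPartition_fmul_mem x hmem)
    (isClosed_tsupport _) (tsupport_chartPartition_subset x) (chartPartition_fmul_eq_zero x _)
  -- A continuous nonnegative integrand that is nonzero at the image of `p` would have a positive
  -- integral.
  have hpos := Continuous.integral_pos_of_hasCompactSupport_nonneg_nonzero (μ := volume)
    (f := G x) (x := extChartAt (𝓡 3) x p)
    ((ContinuousAlternatingMap.apply ℝ E3 ℝ stdFrame).continuous.comp h1.continuous)
    (h2.comp_left (g := ContinuousAlternatingMap.apply ℝ E3 ℝ stdFrame) (map_zero _)) (hnn x) (by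
      have hy := (extChartAt (𝓡 3) x).map_source hpx
      rw [hval x _ hy, (extChartAt (𝓡 3) x).left_inv hpx]
      refine mul_ne_zero (mul_ne_zero hx.ne' (pow_ne_zero 2 fun h0 => hp ?_)) ?_
      · exact top_form_eq_zero (by rw [hγr, h0, zero_mul])
      · exact (Real.sign_mul_pos_of_ne_zero _ (inChart_vol_ne_zero hne x hy)).ne')
  exact hpos.ne' hzero

end Integration

/-! ### Components of forms in a frame. -/

section Components

/-- The components of a covector with respect to a frame. -/
def comp1 (b : Fin 3 → E3) (w : E3 [⋀^Fin 1]→L[ℝ] ℝ) (j : Fin 3) : ℝ := w ![b j]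

/-- The components of a 2-covector with respect to a frame, labelled by the complementary index. -/
def comp2 (b : Fin 3 → E3) (w : E3 [⋀^Fin 2]→L[ℝ] ℝ) (j : Fin 3) : ℝ := w ![b (j + 1), b (j + 2)]

/-- The component of a 3-covector with respect to a frame. -/
def comp3 (b : Fin 3 → E3) (w : E3 [⋀^Fin 3]→L[ℝ] ℝ) : ℝ := w b

variable (b : Fin 3 → E3)

theorem comp1_add (v w : E3 [⋀^Fin 1]→L[ℝ] ℝ) (j : Fin 3) :
    comp1 b (v + w) j = comp1 b v j + comp1 b w j := rfl
theorem comp1_sub (v w : E3 [⋀^Fin 1]→L[ℝ] ℝ) (j : Fin 3) :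
    comp1 b (v - w) j = comp1 b v j - comp1 b w j := rfl
theorem comp1_smul (c : ℝ) (w : E3 [⋀^Fin 1]→L[ℝ] ℝ) (j : Fin 3) :
    comp1 b (c • w) j = c * comp1 b w j := rfl
theorem comp2_add (v w : E3 [⋀^Fin 2]→L[ℝ] ℝ) (j : Fin 3) :
    comp2 b (v + w) j = comp2 b v j + comp2 b w j := rfl
theorem comp2_sub (v w : E3 [⋀^Fin 2]→L[ℝ] ℝ) (j : Fin 3) :
    comp2 b (v - w) j = comp2 b v j - comp2 b w j := rfl
theorem comp2_smul (c : ℝ) (w : E3 [⋀^Fin 2]→L[ℝ] ℝ) (j : Fin 3) :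
    comp2 b (c • w) j = c * comp2 b w j := rfl
theorem comp2_zero (j : Fin 3) : comp2 b 0 j = 0 := rfl
theorem comp3_add (v w : E3 [⋀^Fin 3]→L[ℝ] ℝ) : comp3 b (v + w) = comp3 b v + comp3 b w := rfl
theorem comp3_sub (v w : E3 [⋀^Fin 3]→L[ℝ] ℝ) : comp3 b (v - w) = comp3 b v - comp3 b w := rfl
theorem comp3_smul (c : ℝ) (w : E3 [⋀^Fin 3]→L[ℝ] ℝ) : comp3 b (c • w) = c * comp3 b w := rfl
theorem comp3_zero : comp3 b 0 = 0 := rfl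

/-- With 2-forms labelled by the complementary index, the wedge of two 1-forms is a cross product,
and that of a 1-form and a 2-form is a dot product (`comp3_wedge`). Identities between forms thereby
become polynomial identities for `ring`. -/
theorem comp2_wedge_zero {S : Type*} (α β : Form S 1) (p : S) : comp2 b ((α ⋏ β) p) 0 =
    comp1 b (α p) 1 * comp1 b (β p) 2 - comp1 b (α p) 2 * comp1 b (β p) 1 :=
  wedgeL_one_apply _ _ _

theorem comp2_wedge_one {S : Type*} (α β : Form S 1) (p : S) : comp2 b ((α ⋏ β) p) 1 =
    comp1 b (α p) 2 * comp1 b (β p) 0 - comp1 b (α p) 0 * comp1 b (β p) 2 :=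
  wedgeL_one_apply _ _ _

theorem comp2_wedge_two {S : Type*} (α β : Form S 1) (p : S) : comp2 b ((α ⋏ β) p) 2 =
    comp1 b (α p) 0 * comp1 b (β p) 1 - comp1 b (α p) 1 * comp1 b (β p) 0 :=
  wedgeL_one_apply _ _ _

theorem two_form_swap (w : E3 [⋀^Fin 2]→L[ℝ] ℝ) (u v : E3) : w ![u, v] = - w ![v, u] := by
  have h := w.toAlternatingMap.map_swap ![v, u] (i := 0) (j := 1) (by decide)
  have h2 : ![v, u] ∘ Equiv.swap (0 : Fin 2) 1 = ![u, v] := by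
    ext1 i; fin_cases i <;> simp
  rw [h2] at h
  exact h

theorem comp3_wedge {S : Type*} (α : Form S 1) (β : Form S 2) (p : S) : comp3 b ((α ⋏ β) p) =
    comp1 b (α p) 0 * comp2 b (β p) 0 + comp1 b (α p) 1 * comp2 b (β p) 1 +
      comp1 b (α p) 2 * comp2 b (β p) 2 := by
  rw [comp3, wedge_eq_wedgeL, wedgeL_two_apply, two_form_swap _ (b 0) (b 2)]
  simp only [comp1, comp2]
  have h1 : (1 : Fin 3) + 1 = 2 := rfl
  have h2 : (1 : Fin 3) + 2 = 0 := rfl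
  have h3 : (2 : Fin 3) + 1 = 0 := rfl
  have h4 : (2 : Fin 3) + 2 = 1 := rfl
  rw [h1, h2, h3, h4, zero_add, zero_add]
  ring

variable (B : Module.Basis (Fin 3) ℝ E3)

theorem ext_comp1 {v w : E3 [⋀^Fin 1]→L[ℝ] ℝ} (h : ∀ j, comp1 B v j = comp1 B w j) : v = w := by
  refine ContinuousAlternatingMap.toAlternatingMap_injective
    (Module.Basis.ext_alternating B fun f _ => ?_)
  have h1 : (fun i => B (f i)) = ![B (f 0)] := by ext1 i; fin_cases i; rfl
  rw [h1]
  exact h (f 0)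

theorem ext_comp2 {v w : E3 [⋀^Fin 2]→L[ℝ] ℝ} (h : ∀ j, comp2 B v j = comp2 B w j) : v = w := by
  refine ContinuousAlternatingMap.toAlternatingMap_injective
    (Module.Basis.ext_alternating B fun f hf => ?_)
  have h1 : (fun i => B (f i)) = ![B (f 0), B (f 1)] := by ext1 i; fin_cases i <;> rfl
  have h0 : f 0 ≠ f 1 := fun hc => by simpa using hf hc
  rw [h1]
  have key : ∀ j, v ![B (j + 1), B (j + 2)] = w ![B (j + 1), B (j + 2)] ∧
      v ![B (j + 2), B (j + 1)] = w ![B (j + 2), B (j + 1)] := fun j => by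
    refine ⟨h j, ?_⟩
    rw [two_form_swap v, two_form_swap w]
    exact congrArg _ (h j)
  change v ![B (f 0), B (f 1)] = w ![B (f 0), B (f 1)]
  -- Every ordered pair of distinct indices is a cyclic pair or the reversal of one.
  have hcase : ∀ i k : Fin 3, i ≠ k → ∃ j : Fin 3,
      (i = j + 1 ∧ k = j + 2) ∨ (i = j + 2 ∧ k = j + 1) := by decide
  obtain ⟨j, ⟨h2, h3⟩ | ⟨h2, h3⟩⟩ := hcase _ _ h0
  · rw [h2, h3]; exact (key j).1
  · rw [h2, h3]; exact (key j).2

theorem ext_comp3 {v w : E3 [⋀^Fin 3]→L[ℝ] ℝ} (h : comp3 B v = comp3 B w) : v = w := by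
  refine ContinuousAlternatingMap.toAlternatingMap_injective ?_
  have h1 : v.toAlternatingMap B = w.toAlternatingMap B := h
  rw [AlternatingMap.eq_smul_basis_det B v.toAlternatingMap,
    AlternatingMap.eq_smul_basis_det B w.toAlternatingMap, h1]

end Components

/-! ### Contraction with the Levi-Civita symbol. -/

section Epsilon

variable {S : Type*} {k : ℕ}

theorem eps_sum_zero (f : Fin 3 → Fin 3 → Form S k) :
    ∑ j, ∑ k, eps 0 j k • f j k = f 1 2 - f 2 1 := by
  funext p; ext v
  simp only [Fin.sum_univ_three, eps]
  norm_num
  ring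

theorem eps_sum_one (f : Fin 3 → Fin 3 → Form S k) :
    ∑ j, ∑ k, eps 1 j k • f j k = f 2 0 - f 0 2 := by
  funext p; ext v
  simp only [Fin.sum_univ_three, eps]
  norm_num
  ring

theorem eps_sum_two (f : Fin 3 → Fin 3 → Form S k) :
    ∑ j, ∑ k, eps 2 j k • f j k = f 0 1 - f 1 0 := by
  funext p; ext v
  simp only [Fin.sum_univ_three, eps]
  norm_num
  ring

end Epsilon

section Pointwise

variable {S : Type*}

theorem add_form_apply {k : ℕ} (α β : Form S k) (p : S) : (α + β) p = α p + β p := rfl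
theorem sub_form_apply {k : ℕ} (α β : Form S k) (p : S) : (α - β) p = α p - β p := rfl
theorem smul_form_apply {k : ℕ} (c : ℝ) (β : Form S k) (p : S) : (c • β) p = c • β p := rfl
theorem zero_form_apply {k : ℕ} (p : S) : (0 : Form S k) p = 0 := rfl
theorem fmul_apply {k : ℕ} (f : S → ℝ) (β : Form S k) (p : S) : (f ⊙ β) p = f p • β p := rfl

end Pointwise

/-! ### Leibniz rules, Bianchi identity and D² for the covariant derivative. -/

section CovariantCalculus

variable {S : Type*} [TopologicalSpace S] [ChartedSpace E3 S] [IsManifold (𝓡 3) ∞ S]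

theorem extD_zero {k : ℕ} : extD (0 : Form S k) = 0 := by
  have h := extD_smul (S := S) (k := k) 0 0
  rwa [zero_smul, zero_smul] at h

theorem extD_sum {k : ℕ} {ι : Type*} (s : Finset ι) {β : ι → Form S k}
    (hβ : ∀ i, β i ∈ Omega S k) : extD (∑ i ∈ s, β i) = ∑ i ∈ s, extD (β i) := by
  classical
  induction s using Finset.induction_on with
  | empty => simp [extD_zero]
  | insert a s ha ih =>
    rw [Finset.sum_insert ha, Finset.sum_insert ha, extD_add (hβ a)
      (Submodule.sum_mem _ fun i _ => hβ i), ih]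

theorem eps_sum_mem {k : ℕ} {β : Fin 3 → Fin 3 → Form S k} (h : ∀ i j, β i j ∈ Omega S k)
    (i : Fin 3) : ∑ j, ∑ l, eps i j l • β j l ∈ Omega S k :=
  Submodule.sum_mem _ fun _ _ => Submodule.sum_mem _ fun _ _ => Submodule.smul_mem _ _ (h _ _)

theorem extD_eps_sum {k : ℕ} {β : Fin 3 → Fin 3 → Form S k} (h : ∀ i j, β i j ∈ Omega S k)
    (i : Fin 3) : extD (∑ j, ∑ l, eps i j l • β j l) = ∑ j, ∑ l, eps i j l • extD (β j l) := by
  rw [extD_sum _ fun j => Submodule.sum_mem _ fun l _ => Submodule.smul_mem _ _ (h j l)]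
  refine Finset.sum_congr rfl fun j _ => ?_
  rw [extD_sum _ fun l => Submodule.smul_mem _ _ (h j l)]
  exact Finset.sum_congr rfl fun l _ => extD_smul _ _

theorem covD0_mem {A : Fin 3 → Form S 1} (hA : ∀ i, A i ∈ Omega S 1) {f : Fin 3 → S → ℝ}
    (hf : ∀ i, ContMDiff (𝓡 3) 𝓘(ℝ, ℝ) ∞ (f i)) (i : Fin 3) : covD0 A f i ∈ Omega S 1 :=
  Submodule.add_mem _ (dFun_mem (hf i)) (eps_sum_mem (fun j k => fmul_mem (hf k) (hA j)) i)

theorem covD_mem {A : Fin 3 → Form S 1} (hA : ∀ i, A i ∈ Omega S 1) {n : ℕ}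
    {β : Fin 3 → Form S n} (hβ : ∀ i, β i ∈ Omega S n) (i : Fin 3) :
    covD A β i ∈ Omega S (n + 1) :=
  Submodule.add_mem _ (extD_mem (hβ i)) (eps_sum_mem (fun j k => wedge_mem (hA j) (hβ k)) i)

theorem curv_mem {A : Fin 3 → Form S 1} (hA : ∀ i, A i ∈ Omega S 1) (i : Fin 3) :
    curv A i ∈ Omega S 2 :=
  Submodule.add_mem _ (extD_mem (hA i))
    (Submodule.smul_mem _ _ (eps_sum_mem (fun j k => wedge_mem (hA j) (hA k)) i))

/-- The contracted sum is gauge invariant: the connection terms cancel by antisymmetry of ε, so d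
may be replaced by D in the Leibniz rule. The same holds in `extD_sum_wedge`. -/
theorem extD_sum_fmul (A : Fin 3 → Form S 1) {f : Fin 3 → S → ℝ}
    (hf : ∀ i, ContMDiff (𝓡 3) 𝓘(ℝ, ℝ) ∞ (f i))
    {β : Fin 3 → Form S 2} (hβ : ∀ i, β i ∈ Omega S 2) :
    extD (∑ i, f i ⊙ β i) = ∑ i, (covD0 A f i ⋏ β i + f i ⊙ covD A β i) := by
  rw [extD_sum _ fun i => fmul_mem (hf i) (hβ i)]
  simp only [extD_fmul (hf _) (hβ _)]
  funext p
  refine ext_comp3 stdBasis ?_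
  rw [Fin.sum_univ_three, Fin.sum_univ_three]
  simp -index only [covD0, covD, eps_sum_zero, eps_sum_one, eps_sum_two,
    add_form_apply, sub_form_apply, fmul_apply, comp3_add, comp3_smul, comp3_wedge,
    comp3_sub, comp1_add, comp1_sub, comp1_smul]
  ring

theorem extD_sum_wedge (A : Fin 3 → Form S 1) {α β : Fin 3 → Form S 1}
    (hα : ∀ i, α i ∈ Omega S 1) (hβ : ∀ i, β i ∈ Omega S 1) :
    extD (∑ i, α i ⋏ β i) = ∑ i, (β i ⋏ covD A α i - α i ⋏ covD A β i) := by
  rw [extD_sum _ fun i => wedge_mem (hα i) (hβ i)]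
  simp only [extD_wedge (hα _) (hβ _)]
  funext p
  refine ext_comp3 stdBasis ?_
  rw [Fin.sum_univ_three, Fin.sum_univ_three]
  simp -index only [covD, eps_sum_zero, eps_sum_one, eps_sum_two,
    add_form_apply, sub_form_apply, comp3_add, comp3_wedge,
    comp3_sub, comp2_add, comp2_sub, comp2_wedge_zero, comp2_wedge_one, comp2_wedge_two]
  ring

/-- ε is an invariant tensor (the Jacobi identity), so D passes through it and acts by the Leibniz
rule. -/
theorem covD_eps_wedge (A : Fin 3 → Form S 1) {α β : Fin 3 → Form S 1}
    (hα : ∀ i, α i ∈ Omega S 1) (hβ : ∀ i, β i ∈ Omega S 1) (i : Fin 3) :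
    covD A (fun i => ∑ j, ∑ k, eps i j k • (α j ⋏ β k)) i =
      ∑ j, ∑ k, eps i j k • (β k ⋏ covD A α j - α j ⋏ covD A β k) := by
  simp only [covD]
  rw [extD_eps_sum fun j k => wedge_mem (hα j) (hβ k)]
  simp only [extD_wedge (hα _) (hβ _)]
  funext p
  refine ext_comp3 stdBasis ?_
  fin_cases i <;>
  simp only [Fin.zero_eta, Fin.mk_one, Fin.reduceFinMk, eps_sum_zero, eps_sum_one, eps_sum_two,
    eps_sum_zero (k := 1 + 1 + 1), eps_sum_one (k := 1 + 1 + 1), eps_sum_two (k := 1 + 1 + 1)] <;>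
  simp -index only [
    add_form_apply, sub_form_apply, comp3_add, comp3_wedge,
    comp3_sub, comp2_add, comp2_sub, comp2_wedge_zero, comp2_wedge_one, comp2_wedge_two] <;>
  ring

theorem covD_eps_fmul (A : Fin 3 → Form S 1) {f : Fin 3 → S → ℝ}
    (hf : ∀ i, ContMDiff (𝓡 3) 𝓘(ℝ, ℝ) ∞ (f i)) {β : Fin 3 → Form S 2}
    (hβ : ∀ i, β i ∈ Omega S 2) (i : Fin 3) :
    covD A (fun i => ∑ j, ∑ k, eps i j k • (f j ⊙ β k)) i =
      ∑ j, ∑ k, eps i j k • (covD0 A f j ⋏ β k + f j ⊙ covD A β k) := by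
  simp only [covD, covD0]
  rw [extD_eps_sum fun j k => fmul_mem (hf j) (hβ k)]
  simp only [extD_fmul (hf _) (hβ _)]
  funext p
  refine ext_comp3 stdBasis ?_
  fin_cases i <;>
  simp only [Fin.zero_eta, Fin.mk_one, Fin.reduceFinMk, eps_sum_zero, eps_sum_one, eps_sum_two,
    eps_sum_zero (k := 1 + 1 + 1), eps_sum_one (k := 1 + 1 + 1), eps_sum_two (k := 1 + 1 + 1)] <;>
  simp -index only [
    add_form_apply, sub_form_apply, comp3_add, comp3_wedge, fmul_apply, comp3_smul, comp1_smul,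
    comp3_sub, comp2_add, comp2_sub, comp2_smul, comp1_add, comp1_sub] <;>
  ring

theorem covD_eps_fmul_one (A : Fin 3 → Form S 1) {f : Fin 3 → S → ℝ}
    (hf : ∀ i, ContMDiff (𝓡 3) 𝓘(ℝ, ℝ) ∞ (f i)) {β : Fin 3 → Form S 1}
    (hβ : ∀ i, β i ∈ Omega S 1) (i : Fin 3) :
    covD A (fun i => ∑ j, ∑ k, eps i j k • (f k ⊙ β j)) i =
      ∑ j, ∑ k, eps i j k • (covD0 A f k ⋏ β j + f k ⊙ covD A β j) := by
  simp only [covD, covD0]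
  rw [extD_eps_sum fun j k => fmul_mem (hf k) (hβ j)]
  simp only [extD_fmul (hf _) (hβ _)]
  funext p
  refine ext_comp2 stdBasis fun l => ?_
  fin_cases i <;> fin_cases l <;>
  simp only [Fin.zero_eta, Fin.mk_one, Fin.reduceFinMk, eps_sum_zero, eps_sum_one, eps_sum_two,
    eps_sum_zero (k := 1 + 1 + 1), eps_sum_one (k := 1 + 1 + 1), eps_sum_two (k := 1 + 1 + 1)] <;>
  simp -index only [
    add_form_apply, sub_form_apply, fmul_apply, comp1_smul, comp2_wedge_zero, comp2_wedge_one,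
    comp2_wedge_two, comp2_add, comp2_sub, comp2_smul, comp1_add, comp1_sub] <;>
  ring

theorem covD_fmul (A : Fin 3 → Form S 1) {g : S → ℝ} (hg : ContMDiff (𝓡 3) 𝓘(ℝ, ℝ) ∞ g)
    {β : Fin 3 → Form S 2} (hβ : ∀ i, β i ∈ Omega S 2) (i : Fin 3) :
    covD A (fun i => g ⊙ β i) i = dFun g ⋏ β i + g ⊙ covD A β i := by
  simp only [covD, extD_fmul hg (hβ _)]
  funext p
  refine ext_comp3 stdBasis ?_
  fin_cases i <;>
  simp only [Fin.zero_eta, Fin.mk_one, Fin.reduceFinMk, eps_sum_zero, eps_sum_one, eps_sum_two,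
    eps_sum_zero (k := 1 + 1 + 1), eps_sum_one (k := 1 + 1 + 1), eps_sum_two (k := 1 + 1 + 1)] <;>
  simp -index only [
    add_form_apply, sub_form_apply, comp3_add, comp3_wedge, fmul_apply, comp3_smul,
    comp3_sub, comp2_smul] <;>
  ring

/-- The sign comes from moving D past a 1-form; the other Leibniz term contains d(dg) = 0. -/
theorem covD_dFun_wedge (A : Fin 3 → Form S 1) {g : S → ℝ} (hg : ContMDiff (𝓡 3) 𝓘(ℝ, ℝ) ∞ g)
    {β : Fin 3 → Form S 1} (hβ : ∀ i, β i ∈ Omega S 1) (i : Fin 3) :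
    covD A (fun i => dFun g ⋏ β i) i = (-1 : ℝ) • (dFun g ⋏ covD A β i) := by
  simp only [covD, extD_wedge (dFun_mem hg) (hβ _), extD_dFun hg]
  funext p
  refine ext_comp3 stdBasis ?_
  fin_cases i <;>
  simp only [Fin.zero_eta, Fin.mk_one, Fin.reduceFinMk, eps_sum_zero, eps_sum_one, eps_sum_two,
    eps_sum_zero (k := 1 + 1 + 1), eps_sum_one (k := 1 + 1 + 1), eps_sum_two (k := 1 + 1 + 1)] <;>
  simp -index only [
    add_form_apply, sub_form_apply, comp3_add, comp3_wedge, smul_form_apply, comp3_smul,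
    comp3_sub, comp2_add, comp2_sub, comp2_wedge_zero, comp2_wedge_one, comp2_wedge_two,
    zero_form_apply, comp2_zero] <;>
  ring

theorem covD_add (A : Fin 3 → Form S 1) {n : ℕ} {α β : Fin 3 → Form S n}
    (hα : ∀ i, α i ∈ Omega S n) (hβ : ∀ i, β i ∈ Omega S n) (i : Fin 3) :
    covD A (fun i => α i + β i) i = covD A α i + covD A β i := by
  simp only [covD, extD_add (hα _) (hβ _)]
  have hw : ∀ j k, A j ⋏ (α k + β k) = A j ⋏ α k + A j ⋏ β k := fun j k => by
    funext p
    exact ((wedgeL n) (A j p)).map_add _ _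
  simp only [hw, smul_add, Finset.sum_add_distrib]
  abel

theorem covD_smul (A : Fin 3 → Form S 1) {n : ℕ} (c : ℝ) (β : Fin 3 → Form S n) (i : Fin 3) :
    covD A (fun i => c • β i) i = c • covD A β i := by
  simp only [covD, extD_smul]
  have hw : ∀ j k, A j ⋏ (c • β k) = c • (A j ⋏ β k) := fun j k => by
    funext p
    exact ((wedgeL n) (A j p)).map_smul _ _
  simp only [hw, smul_add, Finset.smul_sum, smul_comm c]

theorem covD_sub (A : Fin 3 → Form S 1) {n : ℕ} {α β : Fin 3 → Form S n}
    (hα : ∀ i, α i ∈ Omega S n) (hβ : ∀ i, β i ∈ Omega S n) (i : Fin 3) :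
    covD A (fun i => α i - β i) i = covD A α i - covD A β i := by
  have h := covD_add A (fun i => Submodule.sub_mem _ (hα i) (hβ i)) hβ i
  simp only [sub_add_cancel] at h
  exact eq_sub_of_add_eq h.symm

/-- The Bianchi identity. -/
theorem covD_curv {A : Fin 3 → Form S 1} (hA : ∀ i, A i ∈ Omega S 1) (i : Fin 3) : covD A (curv A) i = 0 := by
  have h1 : ∀ i, extD (curv A i) =
      (1 / 2 : ℝ) • ∑ j, ∑ k, eps i j k • (A k ⋏ extD (A j) - A j ⋏ extD (A k)) := fun i => by
    rw [curv, extD_add (extD_mem (hA i))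
      (Submodule.smul_mem _ _ (eps_sum_mem (fun j k => wedge_mem (hA j) (hA k)) i)),
      extD_extD (hA i), zero_add, extD_smul, extD_eps_sum fun j k => wedge_mem (hA j) (hA k)]
    simp only [extD_wedge (hA _) (hA _)]
  simp only [covD, h1]
  simp only [curv]
  funext p
  refine ext_comp3 stdBasis ?_
  fin_cases i <;>
  simp only [Fin.zero_eta, Fin.mk_one, Fin.reduceFinMk, eps_sum_zero, eps_sum_one, eps_sum_two,
    eps_sum_zero (k := 1 + 1 + 1), eps_sum_one (k := 1 + 1 + 1), eps_sum_two (k := 1 + 1 + 1)] <;>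
  simp -index only [
    add_form_apply, sub_form_apply, comp3_add, comp3_wedge, smul_form_apply, comp3_smul,
    comp3_sub, comp2_add, comp2_sub, comp2_smul, comp2_wedge_zero, comp2_wedge_one,
    comp2_wedge_two, zero_form_apply, comp3_zero] <;>
  ring

/-- D² is the action of the curvature: the second derivatives cancel by d² = 0 and the terms
quadratic in A combine by the Jacobi identity. `covD_covD` is the version for 1-forms. -/
theorem covD_covD0 {A : Fin 3 → Form S 1} (hA : ∀ i, A i ∈ Omega S 1)
    {f : Fin 3 → S → ℝ} (hf : ∀ i, ContMDiff (𝓡 3) 𝓘(ℝ, ℝ) ∞ (f i))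
    (i : Fin 3) : covD A (covD0 A f) i = ∑ j, ∑ k, eps i j k • (f k ⊙ curv A j) := by
  have h1 : ∀ i, extD (covD0 A f i) =
      ∑ j, ∑ k, eps i j k • (dFun (f k) ⋏ A j + f k ⊙ extD (A j)) := fun i => by
    rw [covD0, extD_add (dFun_mem (hf i)) (eps_sum_mem (fun j k => fmul_mem (hf k) (hA j)) i),
      extD_dFun (hf i), zero_add, extD_eps_sum fun j k => fmul_mem (hf k) (hA j)]
    simp only [extD_fmul (hf _) (hA _)]
  simp only [covD, h1]
  simp only [curv, covD0]
  funext p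
  refine ext_comp2 stdBasis fun l => ?_
  fin_cases i <;> fin_cases l <;>
  simp only [Fin.zero_eta, Fin.mk_one, Fin.reduceFinMk, eps_sum_zero, eps_sum_one, eps_sum_two,
    eps_sum_zero (k := 1 + 1 + 1), eps_sum_one (k := 1 + 1 + 1), eps_sum_two (k := 1 + 1 + 1)] <;>
  simp -index only [
    add_form_apply, sub_form_apply, fmul_apply, comp1_smul, comp2_wedge_zero, comp2_wedge_one,
    comp2_wedge_two, comp2_add, comp2_sub, comp2_smul, comp1_add, comp1_sub, smul_form_apply] <;>
  ring

theorem covD_covD {A : Fin 3 → Form S 1} (hA : ∀ i, A i ∈ Omega S 1)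
    {β : Fin 3 → Form S 1} (hβ : ∀ i, β i ∈ Omega S 1) (i : Fin 3) :
    covD A (covD A β) i = ∑ j, ∑ k, eps i j k • (β k ⋏ curv A j) := by
  have h1 : ∀ i, extD (covD A β i) =
      ∑ j, ∑ k, eps i j k • (β k ⋏ extD (A j) - A j ⋏ extD (β k)) := fun i => by
    rw [covD, extD_add (extD_mem (hβ i)) (eps_sum_mem (fun j k => wedge_mem (hA j) (hβ k)) i),
      extD_extD (hβ i), zero_add, extD_eps_sum fun j k => wedge_mem (hA j) (hβ k)]
    simp only [extD_wedge (hA _) (hβ _)]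
  rw [covD, h1]
  simp only [curv, covD]
  funext p
  refine ext_comp3 stdBasis ?_
  fin_cases i <;>
  simp only [Fin.zero_eta, Fin.mk_one, Fin.reduceFinMk, eps_sum_zero, eps_sum_one, eps_sum_two,
    eps_sum_zero (k := 1 + 1 + 1), eps_sum_one (k := 1 + 1 + 1), eps_sum_two (k := 1 + 1 + 1)] <;>
  simp -index only [
    add_form_apply, sub_form_apply, comp3_add, comp3_wedge, smul_form_apply, comp3_smul,
    comp3_sub, comp2_add, comp2_sub, comp2_smul, comp2_wedge_zero, comp2_wedge_one,
    comp2_wedge_two] <;>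
  ring

end CovariantCalculus

theorem eps_sum_add {S : Type*} {k : ℕ} (f g : Fin 3 → Fin 3 → Form S k) (i : Fin 3) :
    ∑ j, ∑ l, eps i j l • (f j l + g j l) =
      ∑ j, ∑ l, eps i j l • f j l + ∑ j, ∑ l, eps i j l • g j l := by
  simp only [smul_add, Finset.sum_add_distrib]

/-! ### Differentiation of form-valued curves that are polynomial in the parameter. -/

section Variations

variable {S : Type*} [TopologicalSpace S] [ChartedSpace E3 S] [IsManifold (𝓡 3) ∞ S]

/-- The curves of smooth forms that depend polynomially on the parameter. -/
def polyCurves (S : Type*) [TopologicalSpace S] [ChartedSpace E3 S] [IsManifold (𝓡 3) ∞ S]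
    (k : ℕ) : Submodule ℝ (ℝ → Form S k) :=
  Submodule.span ℝ {γ | ∃ n : ℕ, ∃ c ∈ Omega S k, γ = fun s => s ^ n • c}

theorem monomial_mem_polyCurves {k : ℕ} (n : ℕ) {c : Form S k} (hc : c ∈ Omega S k) :
    (fun s : ℝ => s ^ n • c) ∈ polyCurves S k :=
  Submodule.subset_span ⟨n, c, hc, rfl⟩

theorem mem_of_mem_polyCurves {k : ℕ} {γ : ℝ → Form S k} (h : γ ∈ polyCurves S k) (s : ℝ) :
    γ s ∈ Omega S k := by
  induction h using Submodule.span_induction with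
  | mem x hx =>
    obtain ⟨n, c, hc, rfl⟩ := hx
    exact Submodule.smul_mem _ _ hc
  | zero => exact Submodule.zero_mem _
  | add x y _ _ hx hy => exact Submodule.add_mem _ hx hy
  | smul a x _ hx => exact Submodule.smul_mem _ _ hx

theorem wedge_mem_polyCurves {k : ℕ} {γ : ℝ → Form S 1} {δ : ℝ → Form S k}
    (hγ : γ ∈ polyCurves S 1) (hδ : δ ∈ polyCurves S k) :
    (fun s => γ s ⋏ δ s) ∈ polyCurves S (k + 1) := by
  induction hγ, hδ using Submodule.span_induction₂ with
  | mem_mem x y hx hy =>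
    obtain ⟨n, c, hc, rfl⟩ := hx
    obtain ⟨m, d, hd, rfl⟩ := hy
    convert monomial_mem_polyCurves (n + m) (wedge_mem hc hd) using 1
    funext s p
    change wedgeL k (s ^ n • c p) (s ^ m • d p) = s ^ (n + m) • wedgeL k (c p) (d p)
    rw [map_smul, ContinuousLinearMap.map_smul₂, smul_smul, mul_comm, pow_add]
  | zero_left y hy =>
    convert Submodule.zero_mem _ using 1
    funext s p
    change wedgeL k 0 _ = 0
    simp
  | zero_right y hy =>
    convert Submodule.zero_mem _ using 1
    funext s p
    change wedgeL k _ 0 = 0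
    simp
  | add_left x y z _ _ _ h1 h2 =>
    convert Submodule.add_mem _ h1 h2 using 1
    funext s p
    change wedgeL k (x s p + y s p) (z s p) = wedgeL k (x s p) (z s p) + wedgeL k (y s p) (z s p)
    simp
  | add_right x y z _ _ _ h1 h2 =>
    convert Submodule.add_mem _ h1 h2 using 1
    funext s p
    change wedgeL k (x s p) (y s p + z s p) = wedgeL k (x s p) (y s p) + wedgeL k (x s p) (z s p)
    simp
  | smul_left r x y _ _ h =>
    convert Submodule.smul_mem _ r h using 1
    funext s p
    change wedgeL k (r • x s p) (y s p) = r • wedgeL k (x s p) (y s p)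
    simp
  | smul_right r x y _ _ h =>
    convert Submodule.smul_mem _ r h using 1
    funext s p
    change wedgeL k (x s p) (r • y s p) = r • wedgeL k (x s p) (y s p)
    simp

theorem fmul_line_mem_polyCurves {k : ℕ} {f g : S → ℝ} (hf : ContMDiff (𝓡 3) 𝓘(ℝ, ℝ) ∞ f)
    (hg : ContMDiff (𝓡 3) 𝓘(ℝ, ℝ) ∞ g) {γ : ℝ → Form S k} (hγ : γ ∈ polyCurves S k) :
    (fun s => (f + s • g) ⊙ γ s) ∈ polyCurves S k := by
  induction hγ using Submodule.span_induction with
  | mem x hx =>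
    obtain ⟨n, c, hc, rfl⟩ := hx
    convert Submodule.add_mem _ (monomial_mem_polyCurves n (fmul_mem hf hc))
      (monomial_mem_polyCurves (n + 1) (fmul_mem hg hc)) using 1
    funext s p
    ext v
    change (f p + s * g p) * (s ^ n * c p v) = s ^ n * (f p * c p v) + s ^ (n + 1) * (g p * c p v)
    ring
  | zero =>
    convert Submodule.zero_mem _ using 1
    funext s p
    exact smul_zero _
  | add x y _ _ hx hy =>
    convert Submodule.add_mem _ hx hy using 1
    funext s p
    exact smul_add _ _ _
  | smul a x _ hx =>
    convert Submodule.smul_mem _ a hx using 1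
    funext s p
    ext v
    exact mul_left_comm _ _ _

/-- A polynomial curve of smooth forms has a smooth derivative at `0`, which can be computed
pointwise and is compatible with every linear map on smooth forms. -/
theorem exists_deriv_of_mem_polyCurves {k : ℕ} {V : Type*} [NormedAddCommGroup V]
    [NormedSpace ℝ V] (T : Omega S k →ₗ[ℝ] V) {γ : ℝ → Form S k} (h : γ ∈ polyCurves S k) :
    ∃ γ' : Omega S k, (∀ p, HasDerivAt (fun s => γ s p) (γ'.1 p) 0) ∧
      HasDerivAt (fun s => T ⟨γ s, mem_of_mem_polyCurves h s⟩) (T γ') 0 := by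
  induction h using Submodule.span_induction with
  | mem x hx =>
    obtain ⟨n, c, hc, rfl⟩ := hx
    -- Only the linear monomial contributes to the derivative at 0.
    have hd : HasDerivAt (fun s : ℝ => s ^ n) (if n = 1 then 1 else 0) 0 := by
      rcases n with _ | _ | n
      · simpa using hasDerivAt_const (0 : ℝ) (1 : ℝ)
      · simp only [zero_add, pow_one, if_true]
        exact hasDerivAt_id' 0
      · simpa using hasDerivAt_pow (n + 2) (0 : ℝ)
    refine ⟨(if n = 1 then (1 : ℝ) else 0) • ⟨c, hc⟩, fun p => hd.smul_const (c p), ?_⟩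
    rw [map_smul]
    have h2 : (fun s : ℝ => T ⟨s ^ n • c, Submodule.smul_mem _ _ hc⟩) =
        fun s : ℝ => s ^ n • T ⟨c, hc⟩ := by
      funext s
      rw [← map_smul]
      rfl
    rw [h2]
    exact hd.smul_const _
  | zero =>
    refine ⟨0, fun p => hasDerivAt_const _ _, ?_⟩
    rw [map_zero]
    have h2 : (fun s : ℝ => T ⟨(0 : ℝ → Form S k) s, Submodule.zero_mem _⟩) = fun _ => 0 := by
      funext s
      exact map_zero T
    rw [h2]
    exact hasDerivAt_const _ _
  | add x y hx' hy' hx hy =>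
    obtain ⟨x1, hx1, hx2⟩ := hx
    obtain ⟨y1, hy1, hy2⟩ := hy
    refine ⟨x1 + y1, fun p => (hx1 p).add (hy1 p), ?_⟩
    rw [map_add]
    have h2 := hx2.add hy2
    convert h2 using 1
    funext s
    exact map_add T ⟨x s, mem_of_mem_polyCurves hx' s⟩ ⟨y s, mem_of_mem_polyCurves hy' s⟩
  | smul a x hx' hx =>
    obtain ⟨x1, hx1, hx2⟩ := hx
    refine ⟨a • x1, fun p => (hx1 p).const_smul a, ?_⟩
    rw [map_smul]
    have h2 := hx2.const_smul a
    convert h2 using 1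
    funext s
    exact map_smul T a ⟨x s, mem_of_mem_polyCurves hx' s⟩

/-- `γ` is a polynomial curve of smooth forms with derivative `γ'` at `0`. -/
def HasVar {k : ℕ} (γ : ℝ → Form S k) (γ' : Form S k) : Prop :=
  γ ∈ polyCurves S k ∧ ∀ p, HasDerivAt (fun s => γ s p) (γ' p) 0

namespace HasVar

variable {k : ℕ} {γ δ : ℝ → Form S k} {γ' δ' : Form S k}

theorem mem (h : HasVar γ γ') (s : ℝ) : γ s ∈ Omega S k := mem_of_mem_polyCurves h.1 s

/-- No continuity of `T` is needed: a polynomial curve lies in the span of finitely many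
coefficients. The pointwise derivative is unique, hence equals the one found algebraically. -/
theorem linearMap {V : Type*} [NormedAddCommGroup V] [NormedSpace ℝ V] (T : Omega S k →ₗ[ℝ] V)
    (h : HasVar γ γ') : ∃ h' : γ' ∈ Omega S k,
      HasDerivAt (fun s => T ⟨γ s, h.mem s⟩) (T ⟨γ', h'⟩) 0 := by
  obtain ⟨γ₁, h1, h2⟩ := exists_deriv_of_mem_polyCurves T h.1
  have h3 : γ₁.1 = γ' := funext fun p => (h1 p).unique (h.2 p)
  subst h3
  exact ⟨γ₁.2, h2⟩

theorem deriv_mem (h : HasVar γ γ') : γ' ∈ Omega S k :=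
  (h.linearMap (0 : Omega S k →ₗ[ℝ] ℝ)).choose

theorem line {α β : Form S k} (hα : α ∈ Omega S k) (hβ : β ∈ Omega S k) :
    HasVar (fun s => α + s • β) β := by
  refine ⟨?_, fun p => ?_⟩
  · convert Submodule.add_mem _ (monomial_mem_polyCurves 0 hα) (monomial_mem_polyCurves 1 hβ)
      using 1
    funext s
    simp
  · have := ((hasDerivAt_id (0 : ℝ)).smul_const (β p)).const_add (α p)
    simpa using this

theorem add (h : HasVar γ γ') (h₂ : HasVar δ δ') : HasVar (fun s => γ s + δ s) (γ' + δ') :=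
  ⟨Submodule.add_mem _ h.1 h₂.1, fun p => (h.2 p).add (h₂.2 p)⟩

theorem sub (h : HasVar γ γ') (h₂ : HasVar δ δ') : HasVar (fun s => γ s - δ s) (γ' - δ') :=
  ⟨Submodule.sub_mem _ h.1 h₂.1, fun p => (h.2 p).sub (h₂.2 p)⟩

theorem smul (c : ℝ) (h : HasVar γ γ') : HasVar (fun s => c • γ s) (c • γ') :=
  ⟨Submodule.smul_mem _ c h.1, fun p => (h.2 p).const_smul c⟩

theorem sum {ι : Type*} (u : Finset ι) {γ : ι → ℝ → Form S k} {γ' : ι → Form S k}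
    (h : ∀ i, HasVar (γ i) (γ' i)) : HasVar (fun s => ∑ i ∈ u, γ i s) (∑ i ∈ u, γ' i) := by
  refine ⟨?_, fun p => ?_⟩
  · have := Submodule.sum_mem (polyCurves S k) (t := u) fun i _ => (h i).1
    convert this using 1
    funext s
    simp
  · have := HasDerivAt.fun_sum (u := u) fun i _ => (h i).2 p
    simpa using this

theorem eps_sum {γ : Fin 3 → Fin 3 → ℝ → Form S k} {γ' : Fin 3 → Fin 3 → Form S k}
    (h : ∀ i j, HasVar (γ i j) (γ' i j)) (i : Fin 3) :
    HasVar (fun s => ∑ j, ∑ l, eps i j l • γ j l s) (∑ j, ∑ l, eps i j l • γ' j l) :=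
  sum _ fun j => sum _ fun l => smul _ (h j l)

theorem wedge {α : ℝ → Form S 1} {α' : Form S 1} (hα : HasVar α α') (h : HasVar γ γ') :
    HasVar (fun s => α s ⋏ γ s) (α' ⋏ γ 0 + α 0 ⋏ γ') := by
  refine ⟨wedge_mem_polyCurves hα.1 h.1, fun p => ?_⟩
  have h1 := (wedgeL k).hasDerivAt_of_bilinear (fun _ => hα.2 p) (fun _ => h.2 p)
  rw [add_comm (α' ⋏ γ 0)]
  exact h1

/-- Scalar coefficients need only be affine in the parameter, since e_t, A_t and φ enter along a
line. -/
theorem fmul {f g : S → ℝ} (hf : ContMDiff (𝓡 3) 𝓘(ℝ, ℝ) ∞ f)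
    (hg : ContMDiff (𝓡 3) 𝓘(ℝ, ℝ) ∞ g) (h : HasVar γ γ') :
    HasVar (fun s => (f + s • g) ⊙ γ s) (g ⊙ γ 0 + f ⊙ γ') := by
  refine ⟨fmul_line_mem_polyCurves hf hg h.1, fun p => ?_⟩
  have h0 : HasDerivAt (fun s : ℝ => f p + s * g p) (g p) 0 := by
    simpa using ((hasDerivAt_id (0 : ℝ)).mul_const (g p)).const_add (f p)
  have h1 := h0.fun_smul (h.2 p)
  rw [zero_mul, add_zero, add_comm] at h1
  exact h1

/-- The value of dβ at a fixed point is a linear map on smooth forms, which is all that `linearMap`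
requires; no derivatives in `s` and on the manifold have to be interchanged analytically. -/
theorem extD (h : HasVar γ γ') : HasVar (fun s => extD (γ s)) (extD γ') := by
  refine ⟨?_, fun p => ?_⟩
  · obtain ⟨h, -⟩ := h
    induction h using Submodule.span_induction with
    | mem x hx =>
      obtain ⟨n, c, hc, rfl⟩ := hx
      convert monomial_mem_polyCurves n (extD_mem hc) using 1
      funext s
      exact extD_smul _ _
    | zero =>
      convert Submodule.zero_mem _ using 1
      funext s
      exact extD_zero
    | add x y hx' hy' hx hy =>
      convert Submodule.add_mem _ hx hy using 1
      funext s
      exact extD_add (mem_of_mem_polyCurves hx' s) (mem_of_mem_polyCurves hy' s)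
    | smul a x _ hx =>
      convert Submodule.smul_mem _ a hx using 1
      funext s
      exact extD_smul _ _
  · let T : Omega S k →ₗ[ℝ] (E3 [⋀^Fin (k + 1)]→L[ℝ] ℝ) :=
      { toFun := fun β => EHK.extD β.1 p
        map_add' := fun α β => congrFun (extD_add α.2 β.2) p
        map_smul' := fun c β => congrFun (extD_smul c β.1) p }
    exact (h.linearMap T).choose_spec

theorem integral [CompactSpace S] [T2Space S] {vol₀ : Form S 3} (hvol₀ : vol₀ ∈ Omega S 3)
    (hne : ∀ p, vol₀ p ≠ 0) {γ : ℝ → Form S 3} {γ' : Form S 3} (h : HasVar γ γ') :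
    HasDerivAt (fun s => EHK.integral vol₀ (γ s)) (EHK.integral vol₀ γ') 0 := by
  let T : Omega S 3 →ₗ[ℝ] ℝ :=
    { toFun := fun β => EHK.integral vol₀ β.1
      map_add' := fun α β => integral_add hvol₀ hne α.2 β.2
      map_smul' := fun c β => integral_smul vol₀ c β.1 }
  exact (h.linearMap T).choose_spec

theorem covD {β : ℝ → Fin 3 → Form S k} {A : ℝ → Fin 3 → Form S 1} {A' : Fin 3 → Form S 1}
    {β' : Fin 3 → Form S k} (hA : ∀ i, HasVar (fun s => A s i) (A' i))
    (hβ : ∀ i, HasVar (fun s => β s i) (β' i)) (i : Fin 3) :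
    HasVar (fun s => covD (A s) (β s) i)
      (covD (A 0) β' i + ∑ j, ∑ l, eps i j l • (A' j ⋏ β 0 l)) := by
  have h := (hβ i).extD.add (eps_sum (fun j l => (hA j).wedge (hβ l)) i)
  rw [eps_sum_add, add_comm (∑ j, ∑ l, eps i j l • (A' j ⋏ β 0 l)), ← add_assoc] at h
  exact h

/-- δF = D(δA): the two halves of the variation of the quadratic term agree, since ε and the wedge
of 1-forms are both antisymmetric. -/
theorem curv {A : ℝ → Fin 3 → Form S 1} {A' : Fin 3 → Form S 1}
    (hA : ∀ i, HasVar (fun s => A s i) (A' i)) (i : Fin 3) :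
    HasVar (fun s => curv (A s) i) (EHK.covD (A 0) A' i) := by
  have h := (hA i).extD.add ((eps_sum (fun j l => (hA j).wedge (hA l)) i).smul (1 / 2))
  suffices h2 : EHK.covD (A 0) A' i = EHK.extD (A' i) +
      (1 / 2 : ℝ) • ∑ j, ∑ l, eps i j l • (A' j ⋏ A 0 l + A 0 j ⋏ A' l) by
    rw [h2]
    exact h
  rw [EHK.covD]
  funext p
  refine ext_comp2 stdBasis fun l => ?_
  fin_cases i <;> fin_cases l <;>
  simp only [Fin.zero_eta, Fin.mk_one, Fin.reduceFinMk, eps_sum_zero, eps_sum_one, eps_sum_two] <;>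
  simp -index only [add_form_apply, sub_form_apply, smul_form_apply, comp2_add, comp2_sub,
    comp2_smul, comp2_wedge_zero, comp2_wedge_one, comp2_wedge_two] <;>
  ring

end HasVar

theorem dFun_line {f g : S → ℝ} (hf : ContMDiff (𝓡 3) 𝓘(ℝ, ℝ) ∞ f)
    (hg : ContMDiff (𝓡 3) 𝓘(ℝ, ℝ) ∞ g) (s : ℝ) : dFun (f + s • g) = dFun f + s • dFun g := by
  have h : ContMDiff (𝓡 3) 𝓘(ℝ, ℝ) ∞ (s • g) := contMDiff_const.mul hg
  rw [dFun_add hf h, dFun_smul hg]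

end Variations

/-! ### First variations of the curvature, De and the constraints. -/

section FieldVariations

variable {S : Type*} [TopologicalSpace S] [ChartedSpace E3 S] [IsManifold (𝓡 3) ∞ S]

theorem contMDiff_cet (q : Fields S) (i : Fin 3) : ContMDiff (𝓡 3) 𝓘(ℝ, ℝ) ∞ (cet q i) :=
  (q.1 i).contMDiff
theorem ce_mem (q : Fields S) (i : Fin 3) : ce q i ∈ Omega S 1 := (q.2.1 i).2
theorem contMDiff_cAt (q : Fields S) (i : Fin 3) : ContMDiff (𝓡 3) 𝓘(ℝ, ℝ) ∞ (cAt q i) :=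
  (q.2.2.1 i).contMDiff
theorem cA_mem (q : Fields S) (i : Fin 3) : cA q i ∈ Omega S 1 := (q.2.2.2.1 i).2
theorem contMDiff_cphi (q : Fields S) : ContMDiff (𝓡 3) 𝓘(ℝ, ℝ) ∞ (cphi q) :=
  q.2.2.2.2.contMDiff

theorem cF_mem (q : Fields S) (i : Fin 3) : cF q i ∈ Omega S 2 := curv_mem (cA_mem q) i
theorem cDe_mem (q : Fields S) (i : Fin 3) : cDe q i ∈ Omega S 2 :=
  covD_mem (cA_mem q) (ce_mem q) i

theorem cH_mem (q : Fields S) (i : Fin 3) : cH q i ∈ Omega S 2 :=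
  Submodule.add_mem _
    (Submodule.smul_mem _ _ (eps_sum_mem (fun j k => wedge_mem (ce_mem q j) (ce_mem q k)) i))
    (wedge_mem (ce_mem q i) (dFun_mem (contMDiff_cphi q)))

theorem constraint1_mem (q : Fields S) (i : Fin 3) : constraint1 q i ∈ Omega S 3 :=
  Submodule.add_mem _ (eps_sum_mem (fun j k => wedge_mem (ce_mem q j) (cF_mem q k)) i)
    (wedge_mem (dFun_mem (contMDiff_cphi q)) (cF_mem q i))

/-- The variation of `½ ε_{ijk} e^j ∧ e^k + e_i ∧ dφ`. -/
noncomputable def varH (q Y : Fields S) (i : Fin 3) : Form S 2 :=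
  (1 / 2 : ℝ) • ∑ j, ∑ k, eps i j k • (ce Y j ⋏ ce q k + ce q j ⋏ ce Y k) +
    (ce Y i ⋏ dFun (cphi q) + ce q i ⋏ dFun (cphi Y))

/-- The variation of the curvature. -/
noncomputable def varF (q Y : Fields S) (i : Fin 3) : Form S 2 := covD (cA q) (cA Y) i

/-- The variation of `De^i`. -/
noncomputable def varDe (q Y : Fields S) (i : Fin 3) : Form S 2 :=
  covD (cA q) (ce Y) i + ∑ j, ∑ k, eps i j k • (cA Y j ⋏ ce q k)

/-- The variation of the first secondary constraint. -/
noncomputable def varConstraint1 (q Y : Fields S) (i : Fin 3) : Form S 3 :=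
  ∑ j, ∑ k, eps i j k • (ce Y j ⋏ cF q k + ce q j ⋏ varF q Y k) +
    (dFun (cphi Y) ⋏ cF q i + dFun (cphi q) ⋏ varF q Y i)

/-- The variation of the second secondary constraint. -/
noncomputable def varConstraint2 (q Y : Fields S) (i : Fin 3) : Form S 3 :=
  ∑ j, ∑ k, eps i j k • (ce Y j ⋏ cDe q k + ce q j ⋏ varDe q Y k) -
    (dFun (cphi Y) ⋏ cDe q i + dFun (cphi q) ⋏ varDe q Y i)

theorem hasVar_ce (q Y : Fields S) (i : Fin 3) :
    HasVar (fun s : ℝ => ce (q + s • Y) i) (ce Y i) :=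
  HasVar.line (ce_mem q i) (ce_mem Y i)

theorem hasVar_cA (q Y : Fields S) (i : Fin 3) :
    HasVar (fun s : ℝ => cA (q + s • Y) i) (cA Y i) :=
  HasVar.line (cA_mem q i) (cA_mem Y i)

theorem hasVar_dFun_cphi (q Y : Fields S) :
    HasVar (fun s : ℝ => dFun (cphi (q + s • Y))) (dFun (cphi Y)) := by
  have h := HasVar.line (dFun_mem (contMDiff_cphi q)) (dFun_mem (contMDiff_cphi Y))
  simp only [← dFun_line (contMDiff_cphi q) (contMDiff_cphi Y)] at h
  exact h

theorem hasVar_cH (q Y : Fields S) (i : Fin 3) :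
    HasVar (fun s : ℝ => cH (q + s • Y) i) (varH q Y i) := by
  have h := ((HasVar.eps_sum (fun j k => (hasVar_ce q Y j).wedge (hasVar_ce q Y k)) i).smul
    (1 / 2)).add ((hasVar_ce q Y i).wedge (hasVar_dFun_cphi q Y))
  simp only [zero_smul, add_zero] at h
  exact h

theorem hasVar_cF (q Y : Fields S) (i : Fin 3) :
    HasVar (fun s : ℝ => cF (q + s • Y) i) (varF q Y i) := by
  have h := HasVar.curv (A := fun s => cA (q + s • Y)) (hasVar_cA q Y) i
  simp only [zero_smul, add_zero] at h
  exact h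

theorem hasVar_cDe (q Y : Fields S) (i : Fin 3) :
    HasVar (fun s : ℝ => cDe (q + s • Y) i) (varDe q Y i) := by
  have h := HasVar.covD (A := fun s => cA (q + s • Y)) (β := fun s => ce (q + s • Y))
    (hasVar_cA q Y) (hasVar_ce q Y) i
  simp only [zero_smul, add_zero] at h
  exact h

theorem hasVar_covD_cH (q Y : Fields S) (i : Fin 3) :
    HasVar (fun s : ℝ => covD (cA (q + s • Y)) (cH (q + s • Y)) i)
      (covD (cA q) (varH q Y) i + ∑ j, ∑ k, eps i j k • (cA Y j ⋏ cH q k)) := by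
  have h := HasVar.covD (A := fun s => cA (q + s • Y)) (β := fun s => cH (q + s • Y))
    (hasVar_cA q Y) (hasVar_cH q Y) i
  simp only [zero_smul, add_zero] at h
  exact h

theorem hasVar_constraint1 (q Y : Fields S) (i : Fin 3) :
    HasVar (fun s : ℝ => constraint1 (q + s • Y) i) (varConstraint1 q Y i) := by
  have h := (HasVar.eps_sum (fun j k => (hasVar_ce q Y j).wedge (hasVar_cF q Y k)) i).add
    ((hasVar_dFun_cphi q Y).wedge (hasVar_cF q Y i))
  simp only [zero_smul, add_zero] at h
  exact h

theorem hasVar_constraint2 (q Y : Fields S) (i : Fin 3) :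
    HasVar (fun s : ℝ => constraint2 (q + s • Y) i) (varConstraint2 q Y i) := by
  have h := (HasVar.eps_sum (fun j k => (hasVar_ce q Y j).wedge (hasVar_cDe q Y k)) i).sub
    ((hasVar_dFun_cphi q Y).wedge (hasVar_cDe q Y i))
  simp only [zero_smul, add_zero] at h
  exact h

theorem tangentToSecondary_of_var_eq_zero {q Z : Fields S} (h1 : ∀ i, varConstraint1 q Z i = 0)
    (h2 : ∀ i, varConstraint2 q Z i = 0) : TangentToSecondary q Z := by
  refine fun i p => ⟨?_, ?_⟩
  · have h := (hasVar_constraint1 q Z i).2 p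
    rwa [h1] at h
  · have h := (hasVar_constraint2 q Z i).2 p
    rwa [h2] at h

end FieldVariations

/-! ### Legendre map, Hamiltonian and their variations. -/

section Dynamics

variable {S : Type*} [TopologicalSpace S] [ChartedSpace E3 S] [IsManifold (𝓡 3) ∞ S]

/-- The integrand of the part of the Lagrangian that is linear in the velocity. -/
noncomputable def momentumForm (q w : Fields S) : Form S 3 :=
  ∑ i, (cA w i ⋏ cH q i - cphi w ⊙ (ce q i ⋏ cF q i))

/-- The integrand of the part of the Lagrangian that does not depend on the velocity. -/
noncomputable def potentialForm (q : Fields S) : Form S 3 :=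
  ∑ i, (cAt q i ⊙ covD (cA q) (cH q) i + cet q i ⊙ constraint1 q i)

/-- The variation of `momentumForm`. -/
noncomputable def varMomentumForm (q Y w : Fields S) : Form S 3 :=
  ∑ i, (cA w i ⋏ varH q Y i - cphi w ⊙ (ce Y i ⋏ cF q i + ce q i ⋏ varF q Y i))

/-- The variation of `potentialForm`. -/
noncomputable def varPotentialForm (q Y : Fields S) : Form S 3 :=
  ∑ i, (cAt Y i ⊙ covD (cA q) (cH q) i +
    cAt q i ⊙ (covD (cA q) (varH q Y) i + ∑ j, ∑ k, eps i j k • (cA Y j ⋏ cH q k)) +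
      (cet Y i ⊙ constraint1 q i + cet q i ⊙ varConstraint1 q Y i))

theorem momentumForm_mem (q w : Fields S) : momentumForm q w ∈ Omega S 3 :=
  Submodule.sum_mem _ fun i _ => Submodule.sub_mem _ (wedge_mem (cA_mem w i) (cH_mem q i))
    (fmul_mem (contMDiff_cphi w) (wedge_mem (ce_mem q i) (cF_mem q i)))

theorem potentialForm_mem (q : Fields S) : potentialForm q ∈ Omega S 3 :=
  Submodule.sum_mem _ fun i _ => Submodule.add_mem _
    (fmul_mem (contMDiff_cAt q i) (covD_mem (cA_mem q) (cH_mem q) i))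
    (fmul_mem (contMDiff_cet q i) (constraint1_mem q i))

theorem fmul_zero_fun {k : ℕ} (β : Form S k) : (0 : S → ℝ) ⊙ β = 0 :=
  funext fun p => zero_smul ℝ (β p)

theorem hasVar_momentumForm (q Y w : Fields S) :
    HasVar (fun s : ℝ => momentumForm (q + s • Y) w) (varMomentumForm q Y w) := by
  refine HasVar.sum _ fun i => HasVar.sub ?_ ?_
  · have h := (HasVar.line (cA_mem w i) (Submodule.zero_mem _)).wedge (hasVar_cH q Y i)
    have h0 : (0 : Form S 1) ⋏ cH q i = 0 :=
      funext fun p => by rw [wedge_eq_wedgeL]; simp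
    simp only [smul_zero, zero_smul, add_zero, h0, zero_add] at h
    exact h
  · have h := HasVar.fmul (contMDiff_cphi w) (g := 0) contMDiff_const
      ((hasVar_ce q Y i).wedge (hasVar_cF q Y i))
    simp only [fmul_zero_fun, smul_zero, zero_smul, add_zero, zero_add] at h
    exact h

theorem hasVar_potentialForm (q Y : Fields S) :
    HasVar (fun s : ℝ => potentialForm (q + s • Y)) (varPotentialForm q Y) := by
  refine HasVar.sum _ fun i => HasVar.add ?_ ?_
  · have h := HasVar.fmul (contMDiff_cAt q i) (contMDiff_cAt Y i) (hasVar_covD_cH q Y i)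
    simp only [zero_smul, add_zero] at h
    exact h
  · have h := HasVar.fmul (contMDiff_cet q i) (contMDiff_cet Y i) (hasVar_constraint1 q Y i)
    simp only [zero_smul, add_zero] at h
    exact h

theorem momentumForm_add_smul (q v w : Fields S) (s : ℝ) :
    momentumForm q (v + s • w) = momentumForm q v + s • momentumForm q w := by
  rw [momentumForm, momentumForm, momentumForm, Finset.smul_sum, ← Finset.sum_add_distrib]
  refine Finset.sum_congr rfl fun i _ => ?_
  funext p
  have h1 : (cA (v + s • w) i) p = cA v i p + s • cA w i p := rfl
  have h2 : cphi (v + s • w) p = cphi v p + s * cphi w p := rfl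
  refine ext_comp3 stdBasis ?_
  simp -index only [add_form_apply, sub_form_apply, smul_form_apply, fmul_apply, comp3_add,
    comp3_sub, comp3_smul, comp3_wedge, comp1_add, comp1_smul, h1, h2]
  ring

variable [CompactSpace S] [T2Space S] {vol₀ : Form S 3}

theorem lagrangian_eq (vol₀ : Form S 3) (q v : Fields S) :
    lagrangian vol₀ q v = integral vol₀ (momentumForm q v + potentialForm q) := by
  rw [lagrangian, momentumForm, potentialForm, ← Finset.sum_add_distrib]
  congr 1
  refine Finset.sum_congr rfl fun i _ => ?_
  abel

theorem lagrangian_add_smul (hvol₀ : vol₀ ∈ Omega S 3) (hne : ∀ p, vol₀ p ≠ 0)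
    (q v w : Fields S) (s : ℝ) : lagrangian vol₀ q (v + s • w) =
      lagrangian vol₀ q v + s * integral vol₀ (momentumForm q w) := by
  rw [lagrangian_eq, lagrangian_eq, momentumForm_add_smul, add_right_comm,
    integral_add hvol₀ hne (Submodule.add_mem _ (momentumForm_mem q v) (potentialForm_mem q))
      (Submodule.smul_mem _ s (momentumForm_mem q w)), integral_smul]

theorem fiberDeriv_eq (hvol₀ : vol₀ ∈ Omega S 3) (hne : ∀ p, vol₀ p ≠ 0) (q v w : Fields S) :
    fiberDeriv vol₀ q v w = integral vol₀ (momentumForm q w) := by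
  rw [fiberDeriv]
  simp only [lagrangian_add_smul hvol₀ hne]
  have h := ((hasDerivAt_id' (0 : ℝ)).mul_const (integral vol₀ (momentumForm q w))).const_add
    (lagrangian vol₀ q v)
  rw [one_mul] at h
  exact h.deriv

/-- The part of the Lagrangian linear in the velocity is its own fibre derivative along the
velocity, so it cancels. -/
theorem energy_eq (hvol₀ : vol₀ ∈ Omega S 3) (hne : ∀ p, vol₀ p ≠ 0) (q v : Fields S) :
    energy vol₀ q v = - integral vol₀ (potentialForm q) := by
  rw [energy, fiberDeriv_eq hvol₀ hne, lagrangian_eq,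
    integral_add hvol₀ hne (momentumForm_mem q v) (potentialForm_mem q)]
  ring

theorem momentumVariation_eq (hvol₀ : vol₀ ∈ Omega S 3) (hne : ∀ p, vol₀ p ≠ 0)
    (q Y w : Fields S) :
    momentumVariation vol₀ q Y w = integral vol₀ (varMomentumForm q Y w) := by
  rw [momentumVariation]
  simp only [momentum, fiberDeriv_eq hvol₀ hne]
  exact ((hasVar_momentumForm q Y w).integral hvol₀ hne).deriv

theorem dHamiltonian_eq (hvol₀ : vol₀ ∈ Omega S 3) (hne : ∀ p, vol₀ p ≠ 0) (q Y : Fields S) :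
    dHamiltonian vol₀ q Y = - integral vol₀ (varPotentialForm q Y) := by
  rw [dHamiltonian]
  simp only [hamiltonian, energy_eq hvol₀ hne]
  exact ((hasVar_potentialForm q Y).integral hvol₀ hne).neg.deriv

end Dynamics

/-! ### Leibniz rules for products of functions and 1-forms. -/

section Calculus

variable {S : Type*} [TopologicalSpace S] [ChartedSpace E3 S] [IsManifold (𝓡 3) ∞ S]

theorem covD_fmul_dFun (A : Fin 3 → Form S 1) {f : Fin 3 → S → ℝ}
    (hf : ∀ i, ContMDiff (𝓡 3) 𝓘(ℝ, ℝ) ∞ (f i)) {g : S → ℝ}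
    (hg : ContMDiff (𝓡 3) 𝓘(ℝ, ℝ) ∞ g) (i : Fin 3) :
    covD A (fun i => f i ⊙ dFun g) i = covD0 A f i ⋏ dFun g := by
  simp only [covD, covD0, extD_fmul (hf _) (dFun_mem hg), extD_dFun hg]
  funext p
  refine ext_comp2 stdBasis fun l => ?_
  fin_cases i <;> fin_cases l <;>
  simp only [Fin.zero_eta, Fin.mk_one, Fin.reduceFinMk, eps_sum_zero, eps_sum_one, eps_sum_two] <;>
  simp -index only [add_form_apply, sub_form_apply, fmul_apply, comp1_smul, comp2_wedge_zero,
    comp2_wedge_one, comp2_wedge_two, comp2_add, comp2_sub, comp2_smul, comp1_add, comp1_sub,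
    zero_form_apply, comp2_zero] <;>
  ring

theorem covD_eps_fmul_left (A : Fin 3 → Form S 1) {f : Fin 3 → S → ℝ}
    (hf : ∀ i, ContMDiff (𝓡 3) 𝓘(ℝ, ℝ) ∞ (f i)) {β : Fin 3 → Form S 1}
    (hβ : ∀ i, β i ∈ Omega S 1) (i : Fin 3) :
    covD A (fun i => ∑ j, ∑ k, eps i j k • (f j ⊙ β k)) i =
      ∑ j, ∑ k, eps i j k • (covD0 A f j ⋏ β k + f j ⊙ covD A β k) := by
  simp only [covD, covD0]
  rw [extD_eps_sum fun j k => fmul_mem (hf j) (hβ k)]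
  simp only [extD_fmul (hf _) (hβ _)]
  funext p
  refine ext_comp2 stdBasis fun l => ?_
  fin_cases i <;> fin_cases l <;>
  simp only [Fin.zero_eta, Fin.mk_one, Fin.reduceFinMk, eps_sum_zero, eps_sum_one, eps_sum_two,
    eps_sum_zero (k := 1 + 1), eps_sum_one (k := 1 + 1), eps_sum_two (k := 1 + 1)] <;>
  simp -index only [add_form_apply, sub_form_apply, fmul_apply, comp1_smul, comp2_wedge_zero,
    comp2_wedge_one, comp2_wedge_two, comp2_add, comp2_sub, comp2_smul, comp1_add, comp1_sub] <;>
  ring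

theorem covD_fmul_one (A : Fin 3 → Form S 1) {g : S → ℝ} (hg : ContMDiff (𝓡 3) 𝓘(ℝ, ℝ) ∞ g)
    {β : Fin 3 → Form S 1} (hβ : ∀ i, β i ∈ Omega S 1) (i : Fin 3) :
    covD A (fun i => g ⊙ β i) i = dFun g ⋏ β i + g ⊙ covD A β i := by
  simp only [covD, extD_fmul hg (hβ _)]
  funext p
  refine ext_comp2 stdBasis fun l => ?_
  fin_cases i <;> fin_cases l <;>
  simp only [Fin.zero_eta, Fin.mk_one, Fin.reduceFinMk, eps_sum_zero, eps_sum_one, eps_sum_two] <;>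
  simp -index only [add_form_apply, sub_form_apply, fmul_apply, comp1_smul, comp2_wedge_zero,
    comp2_wedge_one, comp2_wedge_two, comp2_add, comp2_sub, comp2_smul] <;>
  ring

end Calculus

/-! ### The algebraic identity behind the integration by parts. -/

section Algebra

variable {S : Type*}

-- All derivatives are independent symbols here, tied only by the hypotheses, so the identity is
-- polynomial. Dictionary: `a` = De_t, `b` = DA_t, `θ` = dφ, `dY` and `dz` are the differentials of
-- `y` = Y_φ and `z` = Z_φ, `f` = e_t, `g` = A_t, `x` = X_A, `x'` = X_e, `u` = `connectionFlux`,
-- `DY` and `DZ` are the variations of F, `HY` and `HZ` those of `H`, `C` is the first constraint.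
-- The last four groups on the right become exact once the symbols are genuine derivatives.
set_option maxRecDepth 4000 in
theorem total_variation_identity (Ze ZA Ye YA e a b u : Fin 3 → Form S 1) (θ dY dz : Form S 1)
    (F De Dx DZ DY Du H HY HZ : Fin 3 → Form S 2) (DHY DH C : Fin 3 → Form S 3)
    (f g Yf Yg : Fin 3 → S → ℝ) (z y : S → ℝ) (x x' : Fin 3 → Form S 1)
    (hx : ∀ i, x i = ZA i - b i)
    (hx' : ∀ i, x' i = Ze i - a i - ∑ j, ∑ k, eps i j k • (g k ⊙ e j))
    (hDx : ∀ i, Dx i = DZ i - ∑ j, ∑ k, eps i j k • (g k ⊙ F j))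
    (hu : ∀ i, u i = ∑ j, ∑ k, eps i j k • (f j ⊙ e k) + f i ⊙ θ - z ⊙ e i)
    (hDu : ∀ i, Du i = ∑ j, ∑ k, eps i j k • (a j ⋏ e k + f j ⊙ De k) + a i ⋏ θ
        - (dz ⋏ e i + z ⊙ De i))
    (hH : ∀ i, H i = (1 / 2 : ℝ) • (∑ l, ∑ m, eps i l m • (e l ⋏ e m)) + e i ⋏ θ)
    (hHY : ∀ i, HY i = (1 / 2 : ℝ) • (∑ j, ∑ k, eps i j k • (Ye j ⋏ e k + e j ⋏ Ye k)) +
      (Ye i ⋏ θ + e i ⋏ dY))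
    (hHZ : ∀ i, HZ i = (1 / 2 : ℝ) • (∑ j, ∑ k, eps i j k • (Ze j ⋏ e k + e j ⋏ Ze k)) +
      (Ze i ⋏ θ + e i ⋏ dz)) :
    ∑ i, ((ZA i ⋏ HY i - z ⊙ (Ye i ⋏ F i + e i ⋏ DY i)) -
      (YA i ⋏ HZ i - y ⊙ (Ze i ⋏ F i + e i ⋏ DZ i)) +
      (Yg i ⊙ DH i + g i ⊙ (DHY i + ∑ j, ∑ k, eps i j k • (YA j ⋏ H k)) +
        (Yf i ⊙ C i + f i ⊙ (∑ j, ∑ k, eps i j k • (Ye j ⋏ F k + e j ⋏ DY k) +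
          (dY ⋏ F i + θ ⋏ DY i))))) =
    ∑ i, ((Ye i ⋏ (∑ j, ∑ k, eps i j k • (e j ⋏ x k) + θ ⋏ x i -
        (∑ j, ∑ k, eps i j k • (f j ⊙ F k) + z ⊙ F i)) -
      YA i ⋏ (∑ j, ∑ k, eps i j k • (e j ⋏ x' k) - θ ⋏ x' i -
        (∑ j, ∑ k, eps i j k • (f j ⊙ De k) - z ⊙ De i)) +
      Yg i ⊙ DH i + Yf i ⊙ C i + y ⊙ (x i ⋏ De i + x' i ⋏ F i)) +
    ((b i ⋏ HY i + g i ⊙ DHY i) - (YA i ⋏ Du i - u i ⋏ DY i) +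
      (f i ⊙ (dY ⋏ F i) + y ⊙ (a i ⋏ F i)) +
      (dY ⋏ (x i ⋏ e i) + y ⊙ (e i ⋏ Dx i - x i ⋏ De i)))) := by
  refine (Fin.sum_univ_three _).trans (Eq.trans ?_ (Fin.sum_univ_three _).symm)
  funext p
  refine ext_comp3 stdBasis ?_
  simp only [hx, hx', hDx, hu, hDu, hH, hHY, hHZ, eps_sum_zero, eps_sum_one, eps_sum_two,
    eps_sum_zero (k := 1 + 1), eps_sum_one (k := 1 + 1), eps_sum_two (k := 1 + 1)]
  simp -index only [add_form_apply, sub_form_apply, smul_form_apply, fmul_apply, comp3_add,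
    comp3_sub, comp3_smul, comp3_wedge, comp2_add, comp2_sub, comp2_smul, comp2_wedge_zero,
    comp2_wedge_one, comp2_wedge_two, comp1_add, comp1_sub, comp1_smul]
  ring

end Algebra

/-! ### Reduction of ω(Z, Y) - dH(Y) to an integrand without derivatives of Y. -/

section EulerLagrange

variable {S : Type*} [TopologicalSpace S] [ChartedSpace E3 S] [IsManifold (𝓡 3) ∞ S]

theorem extD_sub {k : ℕ} {α β : Form S k} (hα : α ∈ Omega S k) (hβ : β ∈ Omega S k) :
    extD (α - β) = extD α - extD β := by
  have h := extD_add (Submodule.sub_mem _ hα hβ) hβ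
  rw [sub_add_cancel] at h
  exact eq_sub_of_add_eq h.symm

theorem integral_sub [CompactSpace S] [T2Space S] {vol₀ : Form S 3} (hvol₀ : vol₀ ∈ Omega S 3)
    (hne : ∀ p, vol₀ p ≠ 0) {γ γ' : Form S 3} (hγ : γ ∈ Omega S 3) (hγ' : γ' ∈ Omega S 3) :
    integral vol₀ (γ - γ') = integral vol₀ γ - integral vol₀ γ' := by
  have h := integral_add hvol₀ hne (Submodule.sub_mem _ hγ hγ') hγ'
  rw [sub_add_cancel] at h
  exact eq_sub_of_add_eq h.symm

/-- The difference of the two sides of the equation for `X_A`. -/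
noncomputable def residualA (q Z : Fields S) (i : Fin 3) : Form S 2 :=
  ∑ j, ∑ k, eps i j k • (ce q j ⋏ XA q Z k) + dFun (cphi q) ⋏ XA q Z i -
    (∑ j, ∑ k, eps i j k • (cet q j ⊙ cF q k) + cphi Z ⊙ cF q i)

/-- The difference of the two sides of the equation for `X_e`. -/
noncomputable def residualE (q Z : Fields S) (i : Fin 3) : Form S 2 :=
  ∑ j, ∑ k, eps i j k • (ce q j ⋏ Xe q Z k) - dFun (cphi q) ⋏ Xe q Z i -
    (∑ j, ∑ k, eps i j k • (cet q j ⊙ cDe q k) - cphi Z ⊙ cDe q i)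

/-- The integrand of `ω(Z, Y) - dH(Y)`, after integration by parts. -/
noncomputable def eulerForm (q Z Y : Fields S) : Form S 3 :=
  ∑ i, (ce Y i ⋏ residualA q Z i - cA Y i ⋏ residualE q Z i +
    cAt Y i ⊙ covD (cA q) (cH q) i + cet Y i ⊙ constraint1 q i +
      cphi Y ⊙ (XA q Z i ⋏ cDe q i + Xe q Z i ⋏ cF q i))

theorem XA_mem (q Z : Fields S) (i : Fin 3) : XA q Z i ∈ Omega S 1 :=
  Submodule.sub_mem _ (cA_mem Z i) (covD0_mem (cA_mem q) (contMDiff_cAt q) i)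

theorem Xe_mem (q Z : Fields S) (i : Fin 3) : Xe q Z i ∈ Omega S 1 :=
  Submodule.sub_mem _ (Submodule.sub_mem _ (ce_mem Z i)
    (covD0_mem (cA_mem q) (contMDiff_cet q) i))
    (eps_sum_mem (fun j k => fmul_mem (contMDiff_cAt q k) (ce_mem q j)) i)

theorem residualA_mem (q Z : Fields S) (i : Fin 3) : residualA q Z i ∈ Omega S 2 :=
  Submodule.sub_mem _ (Submodule.add_mem _
    (eps_sum_mem (fun j k => wedge_mem (ce_mem q j) (XA_mem q Z k)) i)
    (wedge_mem (dFun_mem (contMDiff_cphi q)) (XA_mem q Z i))) (Submodule.add_mem _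
    (eps_sum_mem (fun j k => fmul_mem (contMDiff_cet q j) (cF_mem q k)) i)
    (fmul_mem (contMDiff_cphi Z) (cF_mem q i)))

theorem residualE_mem (q Z : Fields S) (i : Fin 3) : residualE q Z i ∈ Omega S 2 :=
  Submodule.sub_mem _ (Submodule.sub_mem _
    (eps_sum_mem (fun j k => wedge_mem (ce_mem q j) (Xe_mem q Z k)) i)
    (wedge_mem (dFun_mem (contMDiff_cphi q)) (Xe_mem q Z i))) (Submodule.sub_mem _
    (eps_sum_mem (fun j k => fmul_mem (contMDiff_cet q j) (cDe_mem q k)) i)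
    (fmul_mem (contMDiff_cphi Z) (cDe_mem q i)))

theorem eulerForm_mem (q Z Y : Fields S) : eulerForm q Z Y ∈ Omega S 3 :=
  Submodule.sum_mem _ fun i _ => Submodule.add_mem _ (Submodule.add_mem _ (Submodule.add_mem _
    (Submodule.sub_mem _ (wedge_mem (ce_mem Y i) (residualA_mem q Z i))
      (wedge_mem (cA_mem Y i) (residualE_mem q Z i)))
    (fmul_mem (contMDiff_cAt Y i) (covD_mem (cA_mem q) (cH_mem q) i)))
    (fmul_mem (contMDiff_cet Y i) (constraint1_mem q i)))
    (fmul_mem (contMDiff_cphi Y) (Submodule.add_mem _ (wedge_mem (XA_mem q Z i) (cDe_mem q i))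
      (wedge_mem (Xe_mem q Z i) (cF_mem q i))))

theorem varH_mem (q Y : Fields S) (i : Fin 3) : varH q Y i ∈ Omega S 2 :=
  (hasVar_cH q Y i).deriv_mem

/-- The coefficient of `D Y_A` in `ω(Z, Y) - dH(Y)` before integration by parts. -/
noncomputable def connectionFlux (q Z : Fields S) (i : Fin 3) : Form S 1 :=
  ∑ j, ∑ k, eps i j k • (cet q j ⊙ ce q k) + cet q i ⊙ dFun (cphi q) - cphi Z ⊙ ce q i

theorem connectionFlux_mem (q Z : Fields S) (i : Fin 3) : connectionFlux q Z i ∈ Omega S 1 :=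
  Submodule.sub_mem _ (Submodule.add_mem _
    (eps_sum_mem (fun j k => fmul_mem (contMDiff_cet q j) (ce_mem q k)) i)
    (fmul_mem (contMDiff_cet q i) (dFun_mem (contMDiff_cphi q))))
    (fmul_mem (contMDiff_cphi Z) (ce_mem q i))

theorem covD_connectionFlux (q Z : Fields S) (i : Fin 3) :
    covD (cA q) (connectionFlux q Z) i =
      ∑ j, ∑ k, eps i j k • (covD0 (cA q) (cet q) j ⋏ ce q k + cet q j ⊙ cDe q k) +
        covD0 (cA q) (cet q) i ⋏ dFun (cphi q) -
        (dFun (cphi Z) ⋏ ce q i + cphi Z ⊙ cDe q i) := by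
  have h1 : ∀ i, ∑ j, ∑ k, eps i j k • (cet q j ⊙ ce q k) ∈ Omega S 1 :=
    eps_sum_mem (fun j k => fmul_mem (contMDiff_cet q j) (ce_mem q k))
  have h2 : ∀ i, cet q i ⊙ dFun (cphi q) ∈ Omega S 1 := fun i =>
    fmul_mem (contMDiff_cet q i) (dFun_mem (contMDiff_cphi q))
  have h3 : ∀ i, cphi Z ⊙ ce q i ∈ Omega S 1 := fun i => fmul_mem (contMDiff_cphi Z) (ce_mem q i)
  have e1 := covD_sub (cA q) (fun i => Submodule.add_mem _ (h1 i) (h2 i)) h3 i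
  rw [covD_add (cA q) h1 h2, covD_eps_fmul_left (cA q) (contMDiff_cet q) (ce_mem q),
    covD_fmul_dFun (cA q) (contMDiff_cet q) (contMDiff_cphi q),
    covD_fmul_one (cA q) (contMDiff_cphi Z) (ce_mem q)] at e1
  exact e1

theorem covD_XA (q Z : Fields S) (i : Fin 3) : covD (cA q) (XA q Z) i =
    varF q Z i - ∑ j, ∑ k, eps i j k • (cAt q k ⊙ cF q j) := by
  have h := covD_sub (cA q) (cA_mem Z) (covD0_mem (cA_mem q) (contMDiff_cAt q)) i
  rw [covD_covD0 (cA_mem q) (contMDiff_cAt q)] at h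
  exact h

/-- Up to an exact form, `eulerForm` is the integrand of `ω(Z, Y) - dH(Y)`. -/
theorem exists_varForm_eq_eulerForm_add_extD (q Z Y : Fields S) : ∃ η ∈ Omega S 2,
    varMomentumForm q Y Z - varMomentumForm q Z Y + varPotentialForm q Y =
      eulerForm q Z Y + extD η := by
  have hθ := dFun_mem (contMDiff_cphi q)
  have m1 : ∑ i, cAt q i ⊙ varH q Y i ∈ Omega S 2 :=
    Submodule.sum_mem _ fun i _ => fmul_mem (contMDiff_cAt q i) (varH_mem q Y i)
  have m2 : ∑ i, connectionFlux q Z i ⋏ cA Y i ∈ Omega S 2 :=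
    Submodule.sum_mem _ fun i _ => wedge_mem (connectionFlux_mem q Z i) (cA_mem Y i)
  have m3 : ∑ i, cet q i ⊙ cF q i ∈ Omega S 2 :=
    Submodule.sum_mem _ fun i _ => fmul_mem (contMDiff_cet q i) (cF_mem q i)
  have m4 : ∑ i, XA q Z i ⋏ ce q i ∈ Omega S 2 :=
    Submodule.sum_mem _ fun i _ => wedge_mem (XA_mem q Z i) (ce_mem q i)
  have m3' := fmul_mem (contMDiff_cphi Y) m3
  have m4' := fmul_mem (contMDiff_cphi Y) m4
  -- The boundary terms: the first moves D off the variation of `cH`, the second moves D off Y_A,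
  -- and the last two move d off Y_φ.
  refine ⟨∑ i, cAt q i ⊙ varH q Y i - ∑ i, connectionFlux q Z i ⋏ cA Y i +
    cphi Y ⊙ (∑ i, cet q i ⊙ cF q i) + cphi Y ⊙ (∑ i, XA q Z i ⋏ ce q i),
    Submodule.add_mem _ (Submodule.add_mem _ (Submodule.sub_mem _ m1 m2) m3') m4', ?_⟩
  have hF : ∀ i, covD (cA q) (cF q) i = 0 := covD_curv (cA_mem q)
  have hw : ∀ β : Fin 3 → Form S 2, dFun (cphi Y) ⋏ ∑ i, β i = ∑ i, dFun (cphi Y) ⋏ β i :=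
    fun β => by
      funext p
      rw [wedge_eq_wedgeL, Finset.sum_apply, Finset.sum_apply, map_sum]
      rfl
  have hf : ∀ β : Fin 3 → Form S 3, cphi Y ⊙ ∑ i, β i = ∑ i, cphi Y ⊙ β i :=
    fun β => by
      funext p
      rw [fmul_apply, Finset.sum_apply, Finset.sum_apply, Finset.smul_sum]
      rfl
  have hc : ∀ i, dFun (cphi Y) ⋏ (cet q i ⊙ cF q i) = cet q i ⊙ (dFun (cphi Y) ⋏ cF q i) :=
    fun i => funext fun p => (wedgeL 2 (dFun (cphi Y) p)).map_smul _ _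
  have hz : ∀ f : S → ℝ, f ⊙ (0 : Form S 3) = 0 := fun f => funext fun p => smul_zero (f p)
  have e1 := extD_sum_fmul (cA q) (contMDiff_cAt q) (varH_mem q Y)
  have e2 := extD_sum_wedge (cA q) (connectionFlux_mem q Z) (cA_mem Y)
  have e3 := extD_fmul (contMDiff_cphi Y) m3
  rw [extD_sum_fmul (cA q) (contMDiff_cet q) (cF_mem q), hw, hf, ← Finset.sum_add_distrib] at e3
  -- The Bianchi identity removes the term with DF.
  simp only [hF, hc, hz, add_zero] at e3
  have e4 := extD_fmul (contMDiff_cphi Y) m4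
  rw [extD_sum_wedge (cA q) (XA_mem q Z) (ce_mem q), hw, hf, ← Finset.sum_add_distrib] at e4
  rw [extD_add (Submodule.add_mem _ (Submodule.sub_mem _ m1 m2) m3') m4',
    extD_add (Submodule.sub_mem _ m1 m2) m3', extD_sub m1 m2, e1, e2, e3, e4, varMomentumForm,
    varMomentumForm, varPotentialForm, eulerForm]
  simp only [← Finset.sum_add_distrib, ← Finset.sum_sub_distrib]
  exact total_variation_identity (ce Z) (cA Z) (ce Y) (cA Y) (ce q) (covD0 (cA q) (cet q))
    (covD0 (cA q) (cAt q)) (connectionFlux q Z) (dFun (cphi q)) (dFun (cphi Y)) (dFun (cphi Z))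
    (cF q) (cDe q) (covD (cA q) (XA q Z)) (varF q Z) (varF q Y)
    (covD (cA q) (connectionFlux q Z)) (cH q) (varH q Y) (varH q Z) (covD (cA q) (varH q Y))
    (covD (cA q) (cH q)) (constraint1 q) (cet q) (cAt q) (cet Y) (cAt Y) (cphi Z) (cphi Y)
    (XA q Z) (Xe q Z) (fun _ => rfl) (fun _ => rfl) (covD_XA q Z) (fun _ => rfl)
    (covD_connectionFlux q Z) (fun _ => rfl) (fun _ => rfl) (fun _ => rfl)

theorem omega_sub_dHamiltonian [CompactSpace S] [T2Space S] {vol₀ : Form S 3}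
    (hvol₀ : vol₀ ∈ Omega S 3) (hne : ∀ p, vol₀ p ≠ 0) (q Z Y : Fields S) :
    omega vol₀ q Z Y - dHamiltonian vol₀ q Y = integral vol₀ (eulerForm q Z Y) := by
  obtain ⟨η, hη, h⟩ := exists_varForm_eq_eulerForm_add_extD q Z Y
  have h1 := integral_add hvol₀ hne (eulerForm_mem q Z Y) (extD_mem hη)
  rw [integral_extD hvol₀ hne hη, add_zero, ← h] at h1
  have mp := (hasVar_potentialForm q Y).deriv_mem
  have mY := (hasVar_momentumForm q Y Z).deriv_mem
  have mZ := (hasVar_momentumForm q Z Y).deriv_mem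
  rw [integral_add hvol₀ hne (Submodule.sub_mem _ mY mZ) mp, integral_sub hvol₀ hne mY mZ] at h1
  rw [← h1, dHamiltonian_eq hvol₀ hne, omega, canonicalForm, momentumVariation_eq hvol₀ hne,
    momentumVariation_eq hvol₀ hne]
  ring

end EulerLagrange

/-! ### The frame dual to the coframe. -/

section Frames

/-- The covector of a 1-form at a point. -/
noncomputable def covector : (E3 [⋀^Fin 1]→L[ℝ] ℝ) →ₗ[ℝ] Module.Dual ℝ E3 where
  toFun w :=
    { toFun := fun v => w ![v]
      map_add' := fun v v' => w.toAlternatingMap.map_vecCons_add ![] v v'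
      map_smul' := fun c v => w.toAlternatingMap.map_vecCons_smul ![] c v }
  map_add' _ _ := rfl
  map_smul' _ _ := rfl

theorem covector_injective : Function.Injective covector := fun v w h =>
  ext_comp1 stdBasis fun j => LinearMap.congr_fun h (stdBasis j)

variable {S : Type*} [TopologicalSpace S] [ChartedSpace E3 S] [IsManifold (𝓡 3) ∞ S]

/-- Three independent covectors form a basis of the dual space; its dual basis lives in the bidual
and is carried back to `E3` by the evaluation isomorphism. -/
theorem exists_dual_frame {q : Fields S} (hq : q ∈ configSpace S) (p : S) :
    ∃ b : Module.Basis (Fin 3) ℝ E3, ∀ i j, comp1 b (ce q i p) j = delta i j := by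
  have h1 : LinearIndependent ℝ fun i => covector (ce q i p) :=
    (hq p).map' covector (LinearMap.ker_eq_bot.2 covector_injective)
  have hc : Fintype.card (Fin 3) = Module.finrank ℝ (Module.Dual ℝ E3) := by
    rw [Subspace.dual_finrank_eq, finrank_euclideanSpace]
  let D := basisOfLinearIndependentOfCardEqFinrank h1 hc
  have hD : ∀ i, D i = covector (ce q i p) := fun i => by
    simp [D]
  refine ⟨D.dualBasis.map (Module.evalEquiv ℝ E3).symm, fun i j => ?_⟩
  have h2 : comp1 (D.dualBasis.map (Module.evalEquiv ℝ E3).symm) (ce q i p) j =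
      D i ((Module.evalEquiv ℝ E3).symm (D.dualBasis j)) := by
    rw [hD]
    rfl
  rw [h2, Module.apply_evalEquiv_symm_apply, Module.Basis.dualBasis_apply_self, delta]


theorem eq_zero_of_coframe_wedge_eq_zero {q : Fields S} (hq : q ∈ configSpace S) {β : Form S 2}
    (h : ∀ i, ce q i ⋏ β = 0) : β = 0 := by
  funext p
  obtain ⟨b, hb⟩ := exists_dual_frame hq p
  refine ext_comp2 b fun j => ?_
  have h1 := congrArg (comp3 b) (congrFun (h j) p)
  rw [comp3_wedge, hb, hb, hb] at h1
  fin_cases j <;> simpa [delta, comp3, comp2] using h1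

end Frames

/-! ### From the vanishing of all integrals to pointwise equations. -/

section Extraction

theorem neg_form_apply {S : Type*} {k : ℕ} (β : Form S k) (p : S) : (-β) p = -β p := rfl
theorem comp3_neg (b : Fin 3 → E3) (w : E3 [⋀^Fin 3]→L[ℝ] ℝ) : comp3 b (-w) = -comp3 b w := rfl

theorem fmul_wedge {S : Type*} {k : ℕ} (f : S → ℝ) (α : Form S 1) (β : Form S k) :
    (f ⊙ α) ⋏ β = f ⊙ (α ⋏ β) :=
  funext fun p => (wedgeL k).map_smul₂ (f p) (α p) (β p)

variable {S : Type*} [TopologicalSpace S] [ChartedSpace E3 S] [IsManifold (𝓡 3) ∞ S]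

/-- Since d(dφ) = 0 and the two Leibniz terms of ½ ε e ∧ e coincide, D of the momentum 2-form is
(L2) up to sign. This is why the coefficient of Y_{A_t} gives the second constraint. -/
theorem covD_cH (q : Fields S) (i : Fin 3) : covD (cA q) (cH q) i = - constraint2 q i := by
  have hθ := dFun_mem (contMDiff_cphi q)
  have m1 : ∀ i, ∑ j, ∑ k, eps i j k • (ce q j ⋏ ce q k) ∈ Omega S 2 :=
    eps_sum_mem (fun j k => wedge_mem (ce_mem q j) (ce_mem q k))
  have m3 : ∀ i, dFun (cphi q) ⋏ ce q i ∈ Omega S 2 := fun i => wedge_mem hθ (ce_mem q i)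
  have hc : ∀ i, cH q i = (1 / 2 : ℝ) • (∑ j, ∑ k, eps i j k • (ce q j ⋏ ce q k)) -
      dFun (cphi q) ⋏ ce q i := fun i => by
    rw [cH]
    funext p
    refine ext_comp2 stdBasis fun l => ?_
    fin_cases l <;>
    simp -index only [Fin.zero_eta, Fin.mk_one, Fin.reduceFinMk, add_form_apply, sub_form_apply,
      comp2_add, comp2_sub, comp2_wedge_zero, comp2_wedge_one, comp2_wedge_two] <;>
    ring
  have h1 := covD_sub (cA q) (fun i => Submodule.smul_mem _ (1 / 2 : ℝ) (m1 i)) m3 i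
  rw [covD_smul, covD_eps_wedge (cA q) (ce_mem q) (ce_mem q),
    covD_dFun_wedge (cA q) (contMDiff_cphi q) (ce_mem q)] at h1
  rw [funext hc, h1, constraint2]
  funext p
  refine ext_comp3 stdBasis ?_
  rw [neg_form_apply, comp3_neg]
  simp only [cDe]
  fin_cases i <;>
  simp only [Fin.zero_eta, Fin.mk_one, Fin.reduceFinMk, eps_sum_zero, eps_sum_one, eps_sum_two,
    eps_sum_zero (k := 1 + 1 + 1), eps_sum_one (k := 1 + 1 + 1), eps_sum_two (k := 1 + 1 + 1)] <;>
  simp -index only [add_form_apply, sub_form_apply, smul_form_apply, comp3_add, comp3_wedge,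
    comp3_smul, comp3_sub] <;>
  ring

theorem zero_wedge {k : ℕ} (β : Form S k) : (0 : Form S 1) ⋏ β = 0 :=
  funext fun p => by rw [wedge_eq_wedgeL]; simp

/-- Test vectors with a single nonzero component; this lemma and the next four isolate the
coefficients of `eulerForm`. -/
theorem eulerForm_single_cet (q Z : Fields S) (i : Fin 3) (f : SmoothFun S) :
    eulerForm q Z (Pi.single i f, 0, 0, 0, 0) = ⇑f ⊙ constraint1 q i := by
  set Y : Fields S := (Pi.single i f, 0, 0, 0, 0)
  have h1 : ∀ j, ce Y j = 0 := fun j => rfl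
  have h2 : ∀ j, cA Y j = 0 := fun j => rfl
  have h3 : ∀ j, cAt Y j = 0 := fun j => rfl
  have h4 : cphi Y = 0 := rfl
  have h5 : cet Y i = f := by simp [cet, Y]
  have h6 : ∀ j, j ≠ i → cet Y j = 0 := fun j hj => by simp [cet, Y, hj]
  rw [eulerForm, Finset.sum_eq_single i]
  · rw [h1, h2, h3, h4, h5, zero_wedge, zero_wedge, fmul_zero_fun, fmul_zero_fun]
    simp
  · intro j _ hj
    rw [h1, h2, h3, h4, h6 j hj, zero_wedge, zero_wedge, fmul_zero_fun, fmul_zero_fun,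
      fmul_zero_fun]
    simp
  · simp

theorem eulerForm_single_cAt (q Z : Fields S) (i : Fin 3) (f : SmoothFun S) :
    eulerForm q Z (0, 0, Pi.single i f, 0, 0) = ⇑f ⊙ covD (cA q) (cH q) i := by
  set Y : Fields S := (0, 0, Pi.single i f, 0, 0)
  have h1 : ∀ j, ce Y j = 0 := fun j => rfl
  have h2 : ∀ j, cA Y j = 0 := fun j => rfl
  have h3 : ∀ j, cet Y j = 0 := fun j => rfl
  have h4 : cphi Y = 0 := rfl
  have h5 : cAt Y i = f := by simp [cAt, Y]
  have h6 : ∀ j, j ≠ i → cAt Y j = 0 := fun j hj => by simp [cAt, Y, hj]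
  rw [eulerForm, Finset.sum_eq_single i]
  · rw [h1, h2, h3, h4, h5, zero_wedge, zero_wedge, fmul_zero_fun, fmul_zero_fun]
    simp
  · intro j _ hj
    rw [h1, h2, h3, h4, h6 j hj, zero_wedge, zero_wedge, fmul_zero_fun, fmul_zero_fun,
      fmul_zero_fun]
    simp
  · simp

theorem eulerForm_cphi (q Z : Fields S) (f : SmoothFun S) :
    eulerForm q Z (0, 0, 0, 0, f) =
      ⇑f ⊙ ∑ i, (XA q Z i ⋏ cDe q i + Xe q Z i ⋏ cF q i) := by
  set Y : Fields S := (0, 0, 0, 0, f)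
  have h1 : ∀ j, ce Y j = 0 := fun j => rfl
  have h2 : ∀ j, cA Y j = 0 := fun j => rfl
  have h3 : ∀ j, cet Y j = 0 := fun j => rfl
  have h4 : cphi Y = f := rfl
  have h5 : ∀ j, cAt Y j = 0 := fun j => rfl
  have hf : ∀ β : Fin 3 → Form S 3, ⇑f ⊙ ∑ i, β i = ∑ i, ⇑f ⊙ β i := fun β => by
    funext p
    rw [fmul_apply, Finset.sum_apply, Finset.sum_apply, Finset.smul_sum]
    rfl
  rw [eulerForm, hf]
  refine Finset.sum_congr rfl fun j _ => ?_
  rw [h1, h2, h3, h4, h5, zero_wedge, zero_wedge, fmul_zero_fun, fmul_zero_fun]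
  simp

theorem eulerForm_single_ce (q Z : Fields S) (i : Fin 3) (β : Omega S 1) :
    eulerForm q Z (0, Pi.single i β, 0, 0, 0) = β.1 ⋏ residualA q Z i := by
  set Y : Fields S := (0, Pi.single i β, 0, 0, 0)
  have h1 : ∀ j, cet Y j = 0 := fun j => rfl
  have h2 : ∀ j, cA Y j = 0 := fun j => rfl
  have h3 : ∀ j, cAt Y j = 0 := fun j => rfl
  have h4 : cphi Y = 0 := rfl
  have h5 : ce Y i = β.1 := by simp [ce, Y]
  have h6 : ∀ j, j ≠ i → ce Y j = 0 := fun j hj => by simp [ce, Y, hj]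
  rw [eulerForm, Finset.sum_eq_single i]
  · rw [h1, h2, h3, h4, h5, zero_wedge, fmul_zero_fun, fmul_zero_fun, fmul_zero_fun]
    simp
  · intro j _ hj
    rw [h1, h2, h3, h4, h6 j hj, zero_wedge, zero_wedge, fmul_zero_fun, fmul_zero_fun,
      fmul_zero_fun]
    simp
  · simp

theorem eulerForm_single_cA (q Z : Fields S) (i : Fin 3) (β : Omega S 1) :
    eulerForm q Z (0, 0, 0, Pi.single i β, 0) = - (β.1 ⋏ residualE q Z i) := by
  set Y : Fields S := (0, 0, 0, Pi.single i β, 0)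
  have h1 : ∀ j, cet Y j = 0 := fun j => rfl
  have h2 : ∀ j, ce Y j = 0 := fun j => rfl
  have h3 : ∀ j, cAt Y j = 0 := fun j => rfl
  have h4 : cphi Y = 0 := rfl
  have h5 : cA Y i = β.1 := by simp [cA, Y]
  have h6 : ∀ j, j ≠ i → cA Y j = 0 := fun j hj => by simp [cA, Y, hj]
  rw [eulerForm, Finset.sum_eq_single i]
  · rw [h1, h2, h3, h4, h5, zero_wedge, fmul_zero_fun, fmul_zero_fun, fmul_zero_fun]
    simp
  · intro j _ hj
    rw [h1, h2, h3, h4, h6 j hj, zero_wedge, zero_wedge, fmul_zero_fun, fmul_zero_fun,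
      fmul_zero_fun]
    simp
  · simp

variable [CompactSpace S] [T2Space S] {vol₀ : Form S 3}

theorem gnh_iff_residuals (hvol₀ : vol₀ ∈ Omega S 3) (hne : ∀ p, vol₀ p ≠ 0) {q : Fields S}
    (hq : q ∈ configSpace S) (Z : Fields S) : GNH vol₀ q Z ↔
      (∀ i, constraint1 q i = 0) ∧ (∀ i, constraint2 q i = 0) ∧
        (∀ i, residualA q Z i = 0) ∧ (∀ i, residualE q Z i = 0) ∧ EqPhi q Z := by
  have h0 : GNH vol₀ q Z ↔ ∀ Y, integral vol₀ (eulerForm q Z Y) = 0 :=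
    forall_congr' fun Y => by rw [← omega_sub_dHamiltonian hvol₀ hne, sub_eq_zero]
  rw [h0]
  constructor
  · intro h
    refine ⟨fun i => ?_, fun i => ?_, fun i => ?_, fun i => ?_, ?_⟩
    · refine eq_zero_of_integral_fmul_eq_zero hvol₀ hne (constraint1_mem q i) fun f => ?_
      rw [← eulerForm_single_cet q Z]
      exact h _
    · have h1 : covD (cA q) (cH q) i = 0 := by
        refine eq_zero_of_integral_fmul_eq_zero hvol₀ hne (covD_mem (cA_mem q) (cH_mem q) i)
          fun f => ?_
        rw [← eulerForm_single_cAt q Z]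
        exact h _
      rwa [covD_cH, neg_eq_zero] at h1
    -- The test 1-form is f e^j with f arbitrary: the fundamental lemma gives e^j ∧ residual = 0 for
    -- every j, and these are all the components of the residual.
    · refine eq_zero_of_coframe_wedge_eq_zero hq fun j => ?_
      refine eq_zero_of_integral_fmul_eq_zero hvol₀ hne
        (wedge_mem (ce_mem q j) (residualA_mem q Z i)) fun f => ?_
      rw [← fmul_wedge]
      have h1 := h (0, Pi.single i ⟨⇑f ⊙ ce q j, fmul_mem f.contMDiff (ce_mem q j)⟩, 0, 0, 0)
      rwa [eulerForm_single_ce] at h1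
    · refine eq_zero_of_coframe_wedge_eq_zero hq fun j => ?_
      refine eq_zero_of_integral_fmul_eq_zero hvol₀ hne
        (wedge_mem (ce_mem q j) (residualE_mem q Z i)) fun f => ?_
      rw [← fmul_wedge]
      have h1 := h (0, 0, 0, Pi.single i ⟨⇑f ⊙ ce q j, fmul_mem f.contMDiff (ce_mem q j)⟩, 0)
      rw [eulerForm_single_cA, ← neg_one_smul ℝ, integral_smul] at h1
      simpa using h1
    · refine eq_zero_of_integral_fmul_eq_zero hvol₀ hne (Submodule.sum_mem _ fun i _ =>
        Submodule.add_mem _ (wedge_mem (XA_mem q Z i) (cDe_mem q i))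
          (wedge_mem (Xe_mem q Z i) (cF_mem q i))) fun f => ?_
      rw [← eulerForm_cphi q Z]
      exact h _
  · rintro ⟨h1, h2, h3, h4, h5⟩ Y
    have hw : ∀ α : Form S 1, α ⋏ (0 : Form S 2) = 0 := fun α =>
      funext fun p => (wedgeL 2 (α p)).map_zero
    have hz : ∀ f : S → ℝ, f ⊙ (0 : Form S 3) = 0 := fun f => funext fun p => smul_zero (f p)
    have hf : ∑ i, cphi Y ⊙ (XA q Z i ⋏ cDe q i + Xe q Z i ⋏ cF q i) =
        cphi Y ⊙ ∑ i, (XA q Z i ⋏ cDe q i + Xe q Z i ⋏ cF q i) := by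
      funext p
      rw [fmul_apply, Finset.sum_apply, Finset.sum_apply, Finset.smul_sum]
      rfl
    have h6 : eulerForm q Z Y = 0 := by
      rw [eulerForm]
      simp only [covD_cH, h1, h2, h3, h4, hw, hz, neg_zero, sub_zero, add_zero, zero_add]
      rw [hf, h5, hz]
    rw [h6]
    have h7 := integral_smul vol₀ 0 (0 : Form S 3)
    rwa [zero_smul, zero_mul] at h7

theorem gnh_iff (hvol₀ : vol₀ ∈ Omega S 3) (hne : ∀ p, vol₀ p ≠ 0) {q : Fields S}
    (hq : q ∈ configSpace S) (Z : Fields S) : GNH vol₀ q Z ↔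
      (∀ i, constraint1 q i = 0) ∧ (∀ i, constraint2 q i = 0) ∧
        EqA q Z ∧ EqE q Z ∧ EqPhi q Z := by
  rw [gnh_iff_residuals hvol₀ hne hq]
  simp only [residualA, residualE, sub_eq_zero, EqA, EqE]

end Extraction

/-! ### The linear system at a point. -/

section PointwiseAlgebra

/-- The components of `(ε_{ijk} e^j + δ_{ik} α) ∧ X^k` in the coframe `e`, for 1-forms `X^k` with
components `X k a`. -/
noncomputable def coframeOp (α : Fin 3 → ℝ) (X : Fin 3 → Fin 3 → ℝ) (i a : Fin 3) : ℝ :=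
  delta i a * (X 0 0 + X 1 1 + X 2 2) - X a i + (α (a + 1) * X i (a + 2) - α (a + 2) * X i (a + 1))

/-- The components of `(ε_{ijk} f^j + δ_{ik} z) F^k`. -/
noncomputable def sourceTerm (f : Fin 3 → ℝ) (z : ℝ) (F : Fin 3 → Fin 3 → ℝ) (i a : Fin 3) : ℝ :=
  f (i + 1) * F (i + 2) a - f (i + 2) * F (i + 1) a + z * F i a

/-- The adjugate of `δ_{ik} + ε_{ikl} α_l`. -/
noncomputable def adjOp (α : Fin 3 → ℝ) (i k : Fin 3) : ℝ :=
  delta i k + α i * α k - ∑ l, eps i k l * α l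

/-- The matrix that becomes the solution of the equation for `X` after multiplication with the
inverse of `δ_{ik} + ε_{ikl} α_l`. -/
noncomputable def reducedSource (f α : Fin 3 → ℝ) (z : ℝ) (F : Fin 3 → Fin 3 → ℝ)
    (i j : Fin 3) : ℝ :=
  (∑ k, f k * F k i) * α j - (f (j + 1) * F (j + 2) i - f (j + 2) * F (j + 1) i) - z * F j i +
    (F 0 0 + F 1 1 + F 2 2) *
      (1 / 2 * delta i j * z + 1 / 2 * delta i j * (∑ k, f k * α k) - f i * α j)

theorem fin3_reduce : (0 : Fin 3) + 1 = 1 ∧ (0 : Fin 3) + 2 = 2 ∧ (1 : Fin 3) + 1 = 2 ∧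
    (1 : Fin 3) + 2 = 0 ∧ (2 : Fin 3) + 1 = 0 ∧ (2 : Fin 3) + 2 = 1 := by decide

theorem delta_values : delta 0 0 = 1 ∧ delta 0 1 = 0 ∧ delta 0 2 = 0 ∧ delta 1 0 = 0 ∧
    delta 1 1 = 1 ∧ delta 1 2 = 0 ∧ delta 2 0 = 0 ∧ delta 2 1 = 0 ∧ delta 2 2 = 1 := by
  simp [delta]

theorem adjOp_values (α : Fin 3 → ℝ) :
    adjOp α 0 0 = 1 + α 0 * α 0 ∧ adjOp α 0 1 = α 0 * α 1 - α 2 ∧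
    adjOp α 0 2 = α 0 * α 2 + α 1 ∧ adjOp α 1 0 = α 1 * α 0 + α 2 ∧
    adjOp α 1 1 = 1 + α 1 * α 1 ∧ adjOp α 1 2 = α 1 * α 2 - α 0 ∧
    adjOp α 2 0 = α 2 * α 0 - α 1 ∧ adjOp α 2 1 = α 2 * α 1 + α 0 ∧
    adjOp α 2 2 = 1 + α 2 * α 2 := by
  refine ⟨?_, ?_, ?_, ?_, ?_, ?_, ?_, ?_, ?_⟩ <;>
  · simp only [adjOp, delta_values, Fin.sum_univ_three, eps]
    norm_num

variable {α : Fin 3 → ℝ} {X R : Fin 3 → Fin 3 → ℝ}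

/-- The right-hand sides are, up to sign, the constraint expression evaluated on `R`. So the image
of `X` satisfies the constraint exactly when `X` is symmetric. -/
theorem coframeOp_antisymm (h : ∀ i a, coframeOp α X i a = R i a) :
    (X 1 2 - X 2 1 = R 1 2 - R 2 1 - (R 0 0 * α 0 + R 0 1 * α 1 + R 0 2 * α 2)) ∧
    (X 2 0 - X 0 2 = R 2 0 - R 0 2 - (R 1 0 * α 0 + R 1 1 * α 1 + R 1 2 * α 2)) ∧
    (X 0 1 - X 1 0 = R 0 1 - R 1 0 - (R 2 0 * α 0 + R 2 1 * α 1 + R 2 2 * α 2)) := by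
  simp only [← h, coframeOp, fin3_reduce, delta_values]
  refine ⟨?_, ?_, ?_⟩ <;> ring

theorem coframeOp_trace (h : ∀ i a, coframeOp α X i a = R i a) :
    2 * (X 0 0 + X 1 1 + X 2 2) = R 0 0 + R 1 1 + R 2 2 + (α 0 * (X 1 2 - X 2 1) +
      α 1 * (X 2 0 - X 0 2) + α 2 * (X 0 1 - X 1 0)) := by
  simp only [← h, coframeOp, fin3_reduce, delta_values]
  ring

/-- Exchanging the indices of `X` in the α-terms at the cost of its antisymmetric part leaves the
matrix δ_{ck} + ε_{ckl} α_l acting on the first index of `X`; its adjugate `adjOp α` multiplies it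
to the determinant 1 + α². Trace and antisymmetric part are supplied by `coframeOp_trace` and
`coframeOp_antisymm`. -/
theorem coframeOp_solve (h : ∀ i a, coframeOp α X i a = R i a) (a i : Fin 3) :
    (1 + α 0 ^ 2 + α 1 ^ 2 + α 2 ^ 2) * X a i = ∑ c, adjOp α a c *
      (delta c i * (X 0 0 + X 1 1 + X 2 2) - R i c +
        (α (c + 1) * (X i (c + 2) - X (c + 2) i) - α (c + 2) * (X i (c + 1) - X (c + 1) i))) := by
  simp only [← h, coframeOp, fin3_reduce, delta_values, Fin.sum_univ_three]
  fin_cases a <;> fin_cases i <;>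
  simp only [Fin.zero_eta, Fin.mk_one, Fin.reduceFinMk, fin3_reduce, delta_values,
    adjOp_values] <;>
  ring

/-- Antisymmetric part, trace and then the whole matrix vanish in turn; the last step divides by 1 +
α² > 0. -/
theorem coframeOp_eq_zero (h : ∀ i a, coframeOp α X i a = 0) (a i : Fin 3) : X a i = 0 := by
  obtain ⟨h1, h2, h3⟩ := coframeOp_antisymm h
  have h4 := coframeOp_trace h
  simp only [zero_mul, add_zero, sub_zero] at h1 h2 h3
  rw [h1, h2, h3] at h4
  have h5 : X 0 0 + X 1 1 + X 2 2 = 0 := by linarith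
  have hanti : ∀ j k, X j k - X k j = 0 := by
    intro j k
    fin_cases j <;> fin_cases k <;>
    simp only [Fin.zero_eta, Fin.mk_one, Fin.reduceFinMk] <;> linarith
  have h6 := coframeOp_solve h a i
  simp only [h5, hanti, mul_zero, sub_zero, add_zero, Finset.sum_const_zero] at h6
  have h7 : 0 < 1 + α 0 ^ 2 + α 1 ^ 2 + α 2 ^ 2 := by positivity
  exact (mul_eq_zero.1 h6).resolve_left h7.ne'

theorem coframeOp_surjective (α : Fin 3 → ℝ) (R : Fin 3 → Fin 3 → ℝ) :
    ∃ X : Fin 3 → Fin 3 → ℝ, ∀ i a, coframeOp α X i a = R i a := by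
  let T : (Fin 3 → Fin 3 → ℝ) →ₗ[ℝ] (Fin 3 → Fin 3 → ℝ) :=
    { toFun := coframeOp α
      map_add' := fun X Y => by
        funext i a
        simp only [coframeOp, Pi.add_apply]
        ring
      map_smul' := fun c X => by
        funext i a
        simp only [coframeOp, Pi.smul_apply, smul_eq_mul, RingHom.id_apply]
        ring }
  have hinj : Function.Injective T := by
    rw [injective_iff_map_eq_zero]
    intro X hX
    funext a i
    exact coframeOp_eq_zero (fun i a => congrFun (congrFun hX i) a) a i
  obtain ⟨X, hX⟩ := (LinearMap.injective_iff_surjective.1 hinj) R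
  exact ⟨X, fun i a => congrFun (congrFun hX i) a⟩

/-- The solutions of the algebraic secondary constraint are the images of symmetric matrices. -/
theorem exists_symm_of_constraint {F : Fin 3 → Fin 3 → ℝ}
    (h : ∀ i, F (i + 2) (i + 1) - F (i + 1) (i + 2) +
      (α 0 * F i 0 + α 1 * F i 1 + α 2 * F i 2) = 0) :
    ∃ Y : Fin 3 → Fin 3 → ℝ, (∀ i a, F i a = coframeOp α Y i a) ∧
      Y 1 0 = Y 0 1 ∧ Y 2 0 = Y 0 2 ∧ Y 2 1 = Y 1 2 := by
  obtain ⟨Y, hY⟩ := coframeOp_surjective α F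
  obtain ⟨h1, h2, h3⟩ := coframeOp_antisymm hY
  have c0 := h 0
  have c1 := h 1
  have c2 := h 2
  simp only [fin3_reduce] at c0 c1 c2
  refine ⟨Y, fun i a => (hY i a).symm, ?_, ?_, ?_⟩ <;> linarith

/-- Substituting `F` = `coframeOp α Y` with `Y` symmetric makes the constraint automatic. The two
sides then agree for each `c` separately, already before multiplication by `adjOp`, as polynomials
in α, `f`, `z` and the six free entries of `Y`. -/
theorem coframeOp_solve_source {f : Fin 3 → ℝ} {z : ℝ} {F Y : Fin 3 → Fin 3 → ℝ}
    (hF : ∀ i a, F i a = coframeOp α Y i a)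
    (hs : Y 1 0 = Y 0 1 ∧ Y 2 0 = Y 0 2 ∧ Y 2 1 = Y 1 2)
    (h : ∀ i a, coframeOp α X i a = sourceTerm f z F i a) (a i : Fin 3) :
    (1 + α 0 ^ 2 + α 1 ^ 2 + α 2 ^ 2) * X a i = ∑ c, adjOp α a c *
      reducedSource f α z F c i := by
  obtain ⟨s1, s2, s3⟩ := hs
  rw [coframeOp_solve h]
  refine Finset.sum_congr rfl fun c _ => congrArg _ ?_
  obtain ⟨h1, h2, h3⟩ := coframeOp_antisymm h
  have h4 := coframeOp_trace h
  rw [h1, h2, h3] at h4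
  -- `coframeOp_trace` determines twice the trace, so the trace is written as half of its double to
  -- allow rewriting.
  have h5 : X 0 0 + X 1 1 + X 2 2 = (2 * (X 0 0 + X 1 1 + X 2 2)) / 2 := by ring
  rw [h5, h4]
  have h1' : X 2 1 - X 1 2 = - (X 1 2 - X 2 1) := by ring
  have h2' : X 0 2 - X 2 0 = - (X 2 0 - X 0 2) := by ring
  have h3' : X 1 0 - X 0 1 = - (X 0 1 - X 1 0) := by ring
  have h0 : ∀ j, X j j - X j j = 0 := fun j => sub_self _
  fin_cases c <;> fin_cases i <;>
  simp only [Fin.zero_eta, Fin.mk_one, Fin.reduceFinMk, fin3_reduce, delta_values,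
    h0, h1', h2', h3', h1, h2, h3, sourceTerm, reducedSource, Fin.sum_univ_three, hF,
    coframeOp, s1, s2, s3] <;>
  ring

end PointwiseAlgebra

/-! ### Pointwise identities for (EE3) and for the tangency of (L1). -/

section PointwiseIdentities

variable {f α : Fin 3 → ℝ} {z : ℝ} {F B X E Y Y' : Fin 3 → Fin 3 → ℝ}

/-- `coframeOp α` and `coframeOp (-α)` are adjoint for the Euclidean pairing of matrices, so the sum
equals the pairing of the two source terms with `Y'` and `Y`. There the `z` terms cancel by the same
adjointness and the `f` terms by antisymmetry of ε and symmetry of `Y`, `Y'`. The explicit solutions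
are not needed. -/
theorem scalar_equation_identity (hF : ∀ i a, F i a = coframeOp α Y i a)
    (hs : Y 1 0 = Y 0 1 ∧ Y 2 0 = Y 0 2 ∧ Y 2 1 = Y 1 2)
    (hB : ∀ i a, B i a = coframeOp (-α) Y' i a)
    (hs' : Y' 1 0 = Y' 0 1 ∧ Y' 2 0 = Y' 0 2 ∧ Y' 2 1 = Y' 1 2)
    (hX : ∀ i a, coframeOp α X i a = sourceTerm f z F i a)
    (hE : ∀ i a, coframeOp (-α) E i a = sourceTerm f (-z) B i a) :
    ∑ i, ((X i 0 * B i 0 + X i 1 * B i 1 + X i 2 * B i 2) +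
      (E i 0 * F i 0 + E i 1 * F i 1 + E i 2 * F i 2)) = 0 := by
  obtain ⟨s1, s2, s3⟩ := hs
  obtain ⟨r1, r2, r3⟩ := hs'
  have h : ∑ i, ∑ a, (Y' i a * (coframeOp α X i a - sourceTerm f z F i a) +
      Y i a * (coframeOp (-α) E i a - sourceTerm f (-z) B i a)) = 0 := by
    simp only [hX, hE, sub_self, mul_zero, add_zero, Finset.sum_const_zero]
  rw [← h]
  simp only [hF, hB, sourceTerm, coframeOp, Fin.sum_univ_three, fin3_reduce, delta_values,
    Pi.neg_apply, s1, s2, s3, r1, r2, r3]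
  ring

/-- After multiplication by 1 + α² > 0 the explicit solutions replace `X` and `E`. With `F` and `B`
expressed by the symmetric `Y` and `Y'` no relation among the variables is left, and the claim is a
polynomial identity. -/
theorem tangency_identity_F (hF : ∀ i a, F i a = coframeOp α Y i a)
    (hs : Y 1 0 = Y 0 1 ∧ Y 2 0 = Y 0 2 ∧ Y 2 1 = Y 1 2)
    (hB : ∀ i a, B i a = coframeOp (-α) Y' i a)
    (hs' : Y' 1 0 = Y' 0 1 ∧ Y' 2 0 = Y' 0 2 ∧ Y' 2 1 = Y' 1 2)
    (hX : ∀ i a, coframeOp α X i a = sourceTerm f z F i a)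
    (hE : ∀ i a, coframeOp (-α) E i a = sourceTerm f (-z) B i a) (i : Fin 3) :
    (E (i + 1) 0 * F (i + 2) 0 + E (i + 1) 1 * F (i + 2) 1 + E (i + 1) 2 * F (i + 2) 2) -
      (E (i + 2) 0 * F (i + 1) 0 + E (i + 2) 1 * F (i + 1) 1 + E (i + 2) 2 * F (i + 1) 2) +
      ((X (i + 2) 0 * B (i + 1) 0 + X (i + 2) 1 * B (i + 1) 1 + X (i + 2) 2 * B (i + 1) 2) -
      (X (i + 1) 0 * B (i + 2) 0 + X (i + 1) 1 * B (i + 2) 1 + X (i + 1) 2 * B (i + 2) 2)) = 0 := by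
  have kX := coframeOp_solve_source hF hs hX
  have kE := coframeOp_solve_source hB hs' hE
  have h7 : 0 < 1 + α 0 ^ 2 + α 1 ^ 2 + α 2 ^ 2 := by positivity
  refine (mul_eq_zero.1 ?_).resolve_left h7.ne'
  have h8 : (1 + (-α) 0 ^ 2 + (-α) 1 ^ 2 + (-α) 2 ^ 2) = 1 + α 0 ^ 2 + α 1 ^ 2 + α 2 ^ 2 := by
    simp only [Pi.neg_apply]
    ring
  simp only [h8] at kE
  obtain ⟨s1, s2, s3⟩ := hs
  obtain ⟨r1, r2, r3⟩ := hs'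
  have e : ∀ (j k l : Fin 3), (1 + α 0 ^ 2 + α 1 ^ 2 + α 2 ^ 2) * (E j l * F k l) =
      (∑ c, adjOp (-α) j c * reducedSource f (-α) (-z) B c l) * F k l := fun j k l => by
    rw [← mul_assoc, kE]
  have x : ∀ (j k l : Fin 3), (1 + α 0 ^ 2 + α 1 ^ 2 + α 2 ^ 2) * (X j l * B k l) =
      (∑ c, adjOp α j c * reducedSource f α z F c l) * B k l := fun j k l => by
    rw [← mul_assoc, kX]
  simp only [mul_add, mul_sub, e, x]
  fin_cases i <;>
  simp only [Fin.zero_eta, Fin.mk_one, Fin.reduceFinMk, fin3_reduce, delta_values, adjOp_values,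
    reducedSource, Fin.sum_univ_three, hF, hB, coframeOp, s1, s2, s3, r1, r2, r3,
    Pi.neg_apply] <;>
  ring

end PointwiseIdentities

/-! ### Translation of the form equations into components in the dual frame. -/

section FrameComponents

variable {S : Type*} {b : Fin 3 → E3} {e : Fin 3 → Form S 1} {p : S}

theorem comp2_coframe_wedge (he : ∀ i j, comp1 b (e i p) j = delta i j) (θ : Form S 1)
    (X : Fin 3 → Form S 1) (i a : Fin 3) :
    comp2 b ((∑ j, ∑ k, eps i j k • (e j ⋏ X k) + θ ⋏ X i) p) a =
      coframeOp (comp1 b (θ p)) (fun k => comp1 b (X k p)) i a := by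
  fin_cases i <;> fin_cases a <;>
  simp only [Fin.zero_eta, Fin.mk_one, Fin.reduceFinMk, eps_sum_zero, eps_sum_one, eps_sum_two,
    eps_sum_zero (k := 1 + 1), eps_sum_one (k := 1 + 1), eps_sum_two (k := 1 + 1)] <;>
  simp -index only [add_form_apply, sub_form_apply, comp2_add, comp2_sub, comp2_wedge_zero,
    comp2_wedge_one, comp2_wedge_two, he, coframeOp, delta_values, fin3_reduce] <;>
  ring

theorem comp2_coframe_wedge_sub (he : ∀ i j, comp1 b (e i p) j = delta i j) (θ : Form S 1)
    (X : Fin 3 → Form S 1) (i a : Fin 3) :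
    comp2 b ((∑ j, ∑ k, eps i j k • (e j ⋏ X k) - θ ⋏ X i) p) a =
      coframeOp (-comp1 b (θ p)) (fun k => comp1 b (X k p)) i a := by
  fin_cases i <;> fin_cases a <;>
  simp only [Fin.zero_eta, Fin.mk_one, Fin.reduceFinMk, eps_sum_zero, eps_sum_one, eps_sum_two,
    eps_sum_zero (k := 1 + 1), eps_sum_one (k := 1 + 1), eps_sum_two (k := 1 + 1)] <;>
  simp -index only [add_form_apply, sub_form_apply, comp2_add, comp2_sub, comp2_wedge_zero,
    comp2_wedge_one, comp2_wedge_two, he, coframeOp, delta_values, fin3_reduce, Pi.neg_apply] <;>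
  ring

theorem comp2_source (b : Fin 3 → E3) (f : Fin 3 → S → ℝ) (z : S → ℝ) (F : Fin 3 → Form S 2)
    (i a : Fin 3) :
    comp2 b ((∑ j, ∑ k, eps i j k • (f j ⊙ F k) + z ⊙ F i) p) a =
      sourceTerm (fun j => f j p) (z p) (fun k => comp2 b (F k p)) i a := by
  fin_cases i <;>
  simp -index only [Fin.zero_eta, Fin.mk_one, Fin.reduceFinMk, eps_sum_zero, eps_sum_one,
    eps_sum_two, add_form_apply, sub_form_apply, fmul_apply, comp2_add, comp2_sub, comp2_smul,
    sourceTerm, fin3_reduce]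

theorem comp2_source_sub (b : Fin 3 → E3) (f : Fin 3 → S → ℝ) (z : S → ℝ) (F : Fin 3 → Form S 2)
    (i a : Fin 3) :
    comp2 b ((∑ j, ∑ k, eps i j k • (f j ⊙ F k) - z ⊙ F i) p) a =
      sourceTerm (fun j => f j p) (-z p) (fun k => comp2 b (F k p)) i a := by
  fin_cases i <;>
  simp -index only [Fin.zero_eta, Fin.mk_one, Fin.reduceFinMk, eps_sum_zero, eps_sum_one,
    eps_sum_two, add_form_apply, sub_form_apply, fmul_apply, comp2_add, comp2_sub, comp2_smul,
    sourceTerm, fin3_reduce] <;>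
  ring

theorem comp3_constraint (he : ∀ i j, comp1 b (e i p) j = delta i j) (θ : Form S 1)
    (F : Fin 3 → Form S 2) (i : Fin 3) :
    comp3 b ((∑ j, ∑ k, eps i j k • (e j ⋏ F k) + θ ⋏ F i) p) =
      comp2 b (F (i + 2) p) (i + 1) - comp2 b (F (i + 1) p) (i + 2) +
        (comp1 b (θ p) 0 * comp2 b (F i p) 0 + comp1 b (θ p) 1 * comp2 b (F i p) 1 +
          comp1 b (θ p) 2 * comp2 b (F i p) 2) := by
  fin_cases i <;>
  simp only [Fin.zero_eta, Fin.mk_one, Fin.reduceFinMk, eps_sum_zero, eps_sum_one, eps_sum_two,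
    eps_sum_zero (k := 1 + 1 + 1), eps_sum_one (k := 1 + 1 + 1), eps_sum_two (k := 1 + 1 + 1)] <;>
  simp -index only [add_form_apply, sub_form_apply, comp3_add, comp3_sub, comp3_wedge, he,
    delta_values, fin3_reduce] <;>
  ring

theorem comp3_constraint_sub (he : ∀ i j, comp1 b (e i p) j = delta i j) (θ : Form S 1)
    (F : Fin 3 → Form S 2) (i : Fin 3) :
    comp3 b ((∑ j, ∑ k, eps i j k • (e j ⋏ F k) - θ ⋏ F i) p) =
      comp2 b (F (i + 2) p) (i + 1) - comp2 b (F (i + 1) p) (i + 2) +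
        ((-comp1 b (θ p)) 0 * comp2 b (F i p) 0 + (-comp1 b (θ p)) 1 * comp2 b (F i p) 1 +
          (-comp1 b (θ p)) 2 * comp2 b (F i p) 2) := by
  fin_cases i <;>
  simp only [Fin.zero_eta, Fin.mk_one, Fin.reduceFinMk, eps_sum_zero, eps_sum_one, eps_sum_two,
    eps_sum_zero (k := 1 + 1 + 1), eps_sum_one (k := 1 + 1 + 1), eps_sum_two (k := 1 + 1 + 1)] <;>
  simp -index only [add_form_apply, sub_form_apply, comp3_add, comp3_sub, comp3_wedge, he,
    delta_values, fin3_reduce, Pi.neg_apply] <;>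
  ring

theorem comp3_volume (he : ∀ i j, comp1 b (e i p) j = delta i j) :
    comp3 b (((1 / 6 : ℝ) • ∑ i, ∑ j, ∑ k, eps i j k • (e i ⋏ e j ⋏ e k)) p) = 1 := by
  have h : (1 / 6 : ℝ) • ∑ i, ∑ j, ∑ k, eps i j k • (e i ⋏ e j ⋏ e k) = (1 / 6 : ℝ) •
      ((∑ j, ∑ k, eps 0 j k • (e 0 ⋏ e j ⋏ e k)) + (∑ j, ∑ k, eps 1 j k • (e 1 ⋏ e j ⋏ e k)) +
        (∑ j, ∑ k, eps 2 j k • (e 2 ⋏ e j ⋏ e k))) := congrArg _ (Fin.sum_univ_three _)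
  rw [h]
  simp only [eps_sum_zero, eps_sum_one, eps_sum_two,
    eps_sum_zero (k := 1 + 1 + 1), eps_sum_one (k := 1 + 1 + 1), eps_sum_two (k := 1 + 1 + 1)]
  simp -index only [add_form_apply, sub_form_apply, smul_form_apply, comp3_add, comp3_sub,
    comp3_smul, comp3_wedge, comp2_wedge_zero, comp2_wedge_one, comp2_wedge_two, he, delta_values]
  norm_num

theorem comp3_coframe_dual (he : ∀ i j, comp1 b (e i p) j = delta i j) (θ : Form S 1)
    (i : Fin 3) :
    comp3 b ((θ ⋏ ((1 / 2 : ℝ) • ∑ j, ∑ k, eps i j k • (e j ⋏ e k))) p) = comp1 b (θ p) i := by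
  fin_cases i <;>
  simp only [Fin.zero_eta, Fin.mk_one, Fin.reduceFinMk, eps_sum_zero, eps_sum_one, eps_sum_two,
    eps_sum_zero (k := 1 + 1), eps_sum_one (k := 1 + 1), eps_sum_two (k := 1 + 1)] <;>
  simp -index only [sub_form_apply, smul_form_apply, comp3_wedge, comp2_sub, comp2_smul,
    comp2_wedge_zero, comp2_wedge_one, comp2_wedge_two, he, delta_values] <;>
  ring

theorem comp3_coframe_wedge (he : ∀ i j, comp1 b (e i p) j = delta i j) (β : Form S 2)
    (i : Fin 3) : comp3 b ((e i ⋏ β) p) = comp2 b (β p) i := by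
  fin_cases i <;> simp [comp3_wedge, he, delta_values]

end FrameComponents

/-! ### The coefficient functions and the solution matrices in the dual frame. -/

section Ratios

variable {S : Type*} [TopologicalSpace S] [ChartedSpace E3 S] [IsManifold (𝓡 3) ∞ S]

/-- The 3-covectors at a point form a line, so the quotient does not depend on the frame in which it
is evaluated. -/
theorem ratio_eq_comp3_div (b : Fin 3 → E3) {β v : Form S 3} {p : S} (hv : comp3 b (v p) ≠ 0) :
    ratio β v p = comp3 b (β p) / comp3 b (v p) := by
  have h1 : (v p stdFrame) • β p - (β p stdFrame) • v p = 0 := by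
    refine top_form_eq_zero ?_
    change v p stdFrame * β p stdFrame - β p stdFrame * v p stdFrame = 0
    ring
  have h2 : v p stdFrame * comp3 b (β p) - β p stdFrame * comp3 b (v p) = 0 :=
    congrArg (comp3 b) h1
  have h3 : v p stdFrame ≠ 0 := by
    intro h
    have h4 : v p = 0 := top_form_eq_zero h
    rw [h4] at hv
    exact hv rfl
  rw [ratio, div_eq_div_iff h3 hv]
  linarith

variable {q : Fields S} {p : S} {b : Fin 3 → E3}

theorem comp3_volE (he : ∀ i j, comp1 b (ce q i p) j = delta i j) : comp3 b (volE q p) = 1 :=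
  comp3_volume he

theorem alpha_eq_comp1 (he : ∀ i j, comp1 b (ce q i p) j = delta i j) (i : Fin 3) :
    alpha q i p = comp1 b (dFun (cphi q) p) i := by
  have hv := comp3_volE he
  rw [alpha, ratio_eq_comp3_div b (by rw [hv]; exact one_ne_zero), hv, div_one,
    comp3_coframe_dual he]

theorem FF_eq_comp2 (he : ∀ i j, comp1 b (ce q i p) j = delta i j) (i j : Fin 3) :
    FF q i j p = comp2 b (cF q i p) j := by
  have hv := comp3_volE he
  rw [FF, ratio_eq_comp3_div b (by rw [hv]; exact one_ne_zero), hv, div_one,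
    comp3_coframe_wedge he]

theorem BB_eq_comp2 (he : ∀ i j, comp1 b (ce q i p) j = delta i j) (i j : Fin 3) :
    BB q i j p = comp2 b (cDe q i p) j := by
  have hv := comp3_volE he
  rw [BB, ratio_eq_comp3_div b (by rw [hv]; exact one_ne_zero), hv, div_one,
    comp3_coframe_wedge he]

theorem volE_ne_zero (hq : q ∈ configSpace S) (p : S) : volE q p ≠ 0 := by
  obtain ⟨b, hb⟩ := exists_dual_frame hq p
  intro h
  have h1 := comp3_volE hb
  rw [h, comp3_zero] at h1
  exact zero_ne_one h1

theorem dFun_cphi_eq_sum (hq : q ∈ configSpace S) :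
    dFun (cphi q) = ∑ i, alpha q i ⊙ ce q i := by
  funext p
  obtain ⟨b, hb⟩ := exists_dual_frame hq p
  refine ext_comp1 b fun j => ?_
  rw [Fin.sum_univ_three]
  simp only [add_form_apply, fmul_apply, comp1_add, comp1_smul, hb, alpha_eq_comp1 hb]
  fin_cases j <;> simp [delta_values]

theorem eps_sum_apply (g : Fin 3 → Fin 3 → ℝ) (i : Fin 3) :
    ∑ j, ∑ k, eps i j k * g j k = g (i + 1) (i + 2) - g (i + 2) (i + 1) := by
  fin_cases i <;>
  · simp only [Fin.sum_univ_three, eps, Fin.zero_eta, Fin.mk_one, Fin.reduceFinMk, fin3_reduce]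
    norm_num
    try ring

theorem matM_eq (q : Fields S) (z : S → ℝ) (i j : Fin 3) (p : S) : matM q z i j p =
    reducedSource (fun k => cet q k p) (fun k => alpha q k p) (z p) (fun k l => FF q k l p) i j := by
  have h := eps_sum_apply (fun k l => cet q k p * FF q l i p) j
  simp only [← mul_assoc] at h
  rw [matM, h, trF, etAlpha, Fin.sum_univ_three (fun i => FF q i i p)]
  rfl

/-- N is M with 𝔽, α, Z_φ replaced by 𝔹, -α, -Z_φ; likewise E comes from W in `matE_eq`. One
analysis of the linear system therefore serves both equations. -/
theorem matN_eq (q : Fields S) (z : S → ℝ) (i j : Fin 3) (p : S) : matN q z i j p =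
    reducedSource (fun k => cet q k p) (-fun k => alpha q k p) (-z p)
      (fun k l => BB q k l p) i j := by
  have h := eps_sum_apply (fun k l => cet q k p * BB q l i p) j
  simp only [← mul_assoc] at h
  rw [matN, h, trB, etAlpha, Fin.sum_univ_three (fun i => BB q i i p), reducedSource]
  simp only [Pi.neg_apply, mul_neg, Finset.sum_neg_distrib]
  ring

theorem matW_eq (q : Fields S) (z : S → ℝ) (i j : Fin 3) (p : S) : matW q z i j p =
    (∑ k, adjOp (fun k => alpha q k p) i k * reducedSource (fun k => cet q k p)
      (fun k => alpha q k p) (z p) (fun k l => FF q k l p) k j) /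
      (1 + alpha q 0 p ^ 2 + alpha q 1 p ^ 2 + alpha q 2 p ^ 2) := by
  simp only [matW, matM_eq, alphaSq, adjOp]
  rw [Fin.sum_univ_three (fun i => alpha q i p ^ 2), one_div, inv_mul_eq_div]
  simp only [add_assoc]

theorem matE_eq (q : Fields S) (z : S → ℝ) (i j : Fin 3) (p : S) : matE q z i j p =
    (∑ k, adjOp (-fun k => alpha q k p) i k * reducedSource (fun k => cet q k p)
      (-fun k => alpha q k p) (-z p) (fun k l => BB q k l p) k j) /
      (1 + alpha q 0 p ^ 2 + alpha q 1 p ^ 2 + alpha q 2 p ^ 2) := by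
  simp only [matE, matN_eq, alphaSq, adjOp, Pi.neg_apply, mul_neg, neg_mul, neg_neg,
    Finset.sum_neg_distrib, sub_neg_eq_add]
  rw [Fin.sum_univ_three (fun i => alpha q i p ^ 2), one_div, inv_mul_eq_div]
  simp only [add_assoc]

end Ratios

/-! ### Solution of (EE1) and (EE2), and the redundancy of (EE3). -/

section Solution

variable {S : Type*} [TopologicalSpace S] [ChartedSpace E3 S] [IsManifold (𝓡 3) ∞ S]
  {q Z : Fields S}

/-- Equality of 2-forms is equality of components in the frames dual to the coframe. -/
theorem form_two_ext_iff (hq : q ∈ configSpace S) {β γ : Form S 2} :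
    β = γ ↔ ∀ (p : S) (b : Fin 3 → E3), (∀ i j, comp1 b (ce q i p) j = delta i j) →
      ∀ a, comp2 b (β p) a = comp2 b (γ p) a := by
  refine ⟨fun h p b _ a => by rw [h], fun h => ?_⟩
  funext p
  obtain ⟨b, hb⟩ := exists_dual_frame hq p
  exact ext_comp2 b (h p b hb)

theorem form_one_ext_iff (hq : q ∈ configSpace S) {β γ : Form S 1} :
    β = γ ↔ ∀ (p : S) (b : Fin 3 → E3), (∀ i j, comp1 b (ce q i p) j = delta i j) →
      ∀ a, comp1 b (β p) a = comp1 b (γ p) a := by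
  refine ⟨fun h p b _ a => by rw [h], fun h => ?_⟩
  funext p
  obtain ⟨b, hb⟩ := exists_dual_frame hq p
  exact ext_comp1 b (h p b hb)

/-- `EqA` in the frames dual to the coframe. -/
theorem eqA_iff_components (hq : q ∈ configSpace S) : EqA q Z ↔
    ∀ (p : S) (b : Fin 3 → E3), (∀ i j, comp1 b (ce q i p) j = delta i j) → ∀ i a,
      coframeOp (comp1 b (dFun (cphi q) p)) (fun k => comp1 b (XA q Z k p)) i a =
        sourceTerm (fun j => cet q j p) (cphi Z p) (fun k => comp2 b (cF q k p)) i a := by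
  simp only [EqA, form_two_ext_iff hq]
  constructor
  · intro h p b hb i a
    rw [← comp2_coframe_wedge hb, ← comp2_source]
    exact h i p b hb a
  · intro h i p b hb a
    rw [comp2_source]
    exact (comp2_coframe_wedge hb _ _ i a).trans (h p b hb i a)

/-- `EqE` in the frames dual to the coframe. -/
theorem eqE_iff_components (hq : q ∈ configSpace S) : EqE q Z ↔
    ∀ (p : S) (b : Fin 3 → E3), (∀ i j, comp1 b (ce q i p) j = delta i j) → ∀ i a,
      coframeOp (-comp1 b (dFun (cphi q) p)) (fun k => comp1 b (Xe q Z k p)) i a =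
        sourceTerm (fun j => cet q j p) (-cphi Z p) (fun k => comp2 b (cDe q k p)) i a := by
  simp only [EqE, form_two_ext_iff hq]
  constructor
  · intro h p b hb i a
    rw [← comp2_coframe_wedge_sub hb, ← comp2_source_sub]
    exact h i p b hb a
  · intro h i p b hb a
    rw [comp2_source_sub]
    exact (comp2_coframe_wedge_sub hb _ _ i a).trans (h p b hb i a)

theorem comp1_sum_fmul_coframe {b : Fin 3 → E3} {p : S}
    (hb : ∀ i j, comp1 b (ce q i p) j = delta i j) (g : Fin 3 → S → ℝ) (a : Fin 3) :
    comp1 b ((∑ j, g j ⊙ ce q j) p) a = g a p := by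
  rw [Fin.sum_univ_three]
  simp only [add_form_apply, fmul_apply, comp1_add, comp1_smul, hb]
  fin_cases a <;> simp [delta_values]

theorem exists_symm_F {b : Fin 3 → E3} {p : S} (hb : ∀ i j, comp1 b (ce q i p) j = delta i j)
    (h1 : ∀ i, constraint1 q i = 0) : ∃ Y : Fin 3 → Fin 3 → ℝ,
      (∀ i a, comp2 b (cF q i p) a = coframeOp (comp1 b (dFun (cphi q) p)) Y i a) ∧
        Y 1 0 = Y 0 1 ∧ Y 2 0 = Y 0 2 ∧ Y 2 1 = Y 1 2 := by
  refine exists_symm_of_constraint fun i => ?_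
  rw [← comp3_constraint hb]
  exact congrArg (comp3 b) (congrFun (h1 i) p)

theorem exists_symm_B {b : Fin 3 → E3} {p : S} (hb : ∀ i j, comp1 b (ce q i p) j = delta i j)
    (h2 : ∀ i, constraint2 q i = 0) : ∃ Y : Fin 3 → Fin 3 → ℝ,
      (∀ i a, comp2 b (cDe q i p) a = coframeOp (-comp1 b (dFun (cphi q) p)) Y i a) ∧
        Y 1 0 = Y 0 1 ∧ Y 2 0 = Y 0 2 ∧ Y 2 1 = Y 1 2 := by
  refine exists_symm_of_constraint fun i => ?_
  rw [← comp3_constraint_sub hb]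
  exact congrArg (comp3 b) (congrFun (h2 i) p)

/-- On the image of the symmetric matrices, the linear system has exactly the stated solution. -/
theorem coframeOp_eq_source_iff {f α : Fin 3 → ℝ} {z : ℝ} {F X Y : Fin 3 → Fin 3 → ℝ}
    (hF : ∀ i a, F i a = coframeOp α Y i a)
    (hs : Y 1 0 = Y 0 1 ∧ Y 2 0 = Y 0 2 ∧ Y 2 1 = Y 1 2) :
    (∀ i a, coframeOp α X i a = sourceTerm f z F i a) ↔ ∀ i a, X i a =
      (∑ k, adjOp α i k * reducedSource f α z F k a) / (1 + α 0 ^ 2 + α 1 ^ 2 + α 2 ^ 2) := by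
  have h7 : 0 < 1 + α 0 ^ 2 + α 1 ^ 2 + α 2 ^ 2 := by positivity
  have key : ∀ X : Fin 3 → Fin 3 → ℝ, (∀ i a, coframeOp α X i a = sourceTerm f z F i a) →
      ∀ i a, X i a = (∑ k, adjOp α i k * reducedSource f α z F k a) /
        (1 + α 0 ^ 2 + α 1 ^ 2 + α 2 ^ 2) := fun X h i a => by
    rw [← coframeOp_solve_source hF hs h, mul_div_cancel_left₀ _ h7.ne']
  refine ⟨key X, fun h => ?_⟩
  -- For the converse, some solution exists by surjectivity, and `key` shows that it is given by the
  -- formula; no direct substitution is required.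
  obtain ⟨X', hX'⟩ := coframeOp_surjective α (sourceTerm f z F)
  have h1 : X = X' := by
    funext i a
    rw [h, key X' hX']
  rwa [h1]

theorem eqA_iff_solA (hq : q ∈ configSpace S) (h1 : ∀ i, constraint1 q i = 0) :
    EqA q Z ↔ SolA q Z := by
  have h3 : SolA q Z ↔ ∀ (p : S) (b : Fin 3 → E3),
      (∀ i j, comp1 b (ce q i p) j = delta i j) → ∀ i a,
        comp1 b (XA q Z i p) a = matW q (cphi Z) i a p := by
    simp only [SolA, form_one_ext_iff hq]
    refine ⟨fun h p b hb i a => ?_, fun h i p b hb a => ?_⟩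
    · rw [h i p b hb a, comp1_sum_fmul_coframe hb]
    · rw [h p b hb i a, comp1_sum_fmul_coframe hb]
  rw [eqA_iff_components hq, h3]
  refine forall_congr' fun p => forall_congr' fun b => forall_congr' fun hb => ?_
  obtain ⟨Y, hY, hs⟩ := exists_symm_F hb h1
  rw [coframeOp_eq_source_iff hY hs]
  simp only [matW_eq, alpha_eq_comp1 hb, FF_eq_comp2 hb]

theorem eqE_iff_solE (hq : q ∈ configSpace S) (h2 : ∀ i, constraint2 q i = 0) :
    EqE q Z ↔ SolE q Z := by
  have h3 : SolE q Z ↔ ∀ (p : S) (b : Fin 3 → E3),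
      (∀ i j, comp1 b (ce q i p) j = delta i j) → ∀ i a,
        comp1 b (Xe q Z i p) a = matE q (cphi Z) i a p := by
    simp only [SolE, form_one_ext_iff hq]
    refine ⟨fun h p b hb i a => ?_, fun h i p b hb a => ?_⟩
    · rw [h i p b hb a, comp1_sum_fmul_coframe hb]
    · rw [h p b hb i a, comp1_sum_fmul_coframe hb]
  rw [eqE_iff_components hq, h3]
  refine forall_congr' fun p => forall_congr' fun b => forall_congr' fun hb => ?_
  obtain ⟨Y, hY, hs⟩ := exists_symm_B hb h2
  rw [coframeOp_eq_source_iff hY hs]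
  have h5 : (1 + (-comp1 b (dFun (cphi q) p)) 0 ^ 2 + (-comp1 b (dFun (cphi q) p)) 1 ^ 2 +
      (-comp1 b (dFun (cphi q) p)) 2 ^ 2) = 1 + comp1 b (dFun (cphi q) p) 0 ^ 2 +
        comp1 b (dFun (cphi q) p) 1 ^ 2 + comp1 b (dFun (cphi q) p) 2 ^ 2 := by
    simp only [Pi.neg_apply, neg_sq]
  simp only [matE_eq, alpha_eq_comp1 hb, BB_eq_comp2 hb, h5]

theorem eqPhi_of_eqA_of_eqE (hq : q ∈ configSpace S) (h1 : ∀ i, constraint1 q i = 0)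
    (h2 : ∀ i, constraint2 q i = 0) (hA : EqA q Z) (hE : EqE q Z) : EqPhi q Z := by
  rw [EqPhi]
  funext p
  obtain ⟨b, hb⟩ := exists_dual_frame hq p
  obtain ⟨Y, hY, hs⟩ := exists_symm_F hb h1
  obtain ⟨Y', hY', hs'⟩ := exists_symm_B hb h2
  refine ext_comp3 b ?_
  have h := scalar_equation_identity hY hs hY' hs' ((eqA_iff_components hq).1 hA p b hb)
    ((eqE_iff_components hq).1 hE p b hb)
  rw [Fin.sum_univ_three] at h ⊢
  simp -index only [add_form_apply, comp3_add, comp3_wedge]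
  exact h

end Solution

/-! ### Algebraic reduction of the variations of the constraints. -/

section VariationAlgebra

variable {S : Type*}

/-- `hD` is the covariant derivative of (EE1). It trades the terms with D X_A for algebraic ones, so
the variation of (L1) contains no derivatives of Z any more. The part of the variation generated by
A_t is a rotation of the constraints themselves and vanishes by `hC`. -/
theorem constraint1_variation_identity {Ze e a x x' : Fin 3 → Form S 1} {θ dz : Form S 1}
    {F De Dx VF : Fin 3 → Form S 2} {g : Fin 3 → S → ℝ}
    (hx' : ∀ i, x' i = Ze i - a i - ∑ j, ∑ k, eps i j k • (g k ⊙ e j))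
    (hDx : ∀ i, Dx i = VF i - ∑ j, ∑ k, eps i j k • (g k ⊙ F j))
    (hD : ∀ i, ∑ j, ∑ k, eps i j k • (x k ⋏ De j - e j ⋏ Dx k) + (-1 : ℝ) • (θ ⋏ Dx i) =
      ∑ j, ∑ k, eps i j k • (a j ⋏ F k) + dz ⋏ F i)
    (hC : ∀ i, ∑ j, ∑ k, eps i j k • (e j ⋏ F k) + θ ⋏ F i = 0) (i : Fin 3) :
    ∑ j, ∑ k, eps i j k • (Ze j ⋏ F k + e j ⋏ VF k) + (dz ⋏ F i + θ ⋏ VF i) =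
      ∑ j, ∑ k, eps i j k • (x' j ⋏ F k + x k ⋏ De j) := by
  funext p
  refine ext_comp3 stdBasis ?_
  have hD' := fun i => congrArg (comp3 stdBasis) (congrFun (hD i) p)
  have hC' := fun i => congrArg (comp3 stdBasis) (congrFun (hC i) p)
  have d0 := hD' 0
  have d1 := hD' 1
  have d2 := hD' 2
  have c0 := hC' 0
  have c1 := hC' 1
  have c2 := hC' 2
  simp only [hDx, eps_sum_zero, eps_sum_one, eps_sum_two, eps_sum_zero (k := 1 + 1 + 1),
    eps_sum_one (k := 1 + 1 + 1), eps_sum_two (k := 1 + 1 + 1)] at d0 d1 d2 c0 c1 c2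
  simp -index only [add_form_apply, sub_form_apply, smul_form_apply, zero_form_apply, fmul_apply,
    comp3_add, comp3_sub, comp3_smul, comp3_zero, comp3_wedge, comp2_sub, comp2_add, comp2_smul]
    at d0 d1 d2 c0 c1 c2
  simp only [hx']
  fin_cases i <;>
  simp only [Fin.zero_eta, Fin.mk_one, Fin.reduceFinMk, eps_sum_zero, eps_sum_one, eps_sum_two,
    eps_sum_zero (k := 1 + 1 + 1), eps_sum_one (k := 1 + 1 + 1), eps_sum_two (k := 1 + 1 + 1)] <;>
  simp -index only [add_form_apply, sub_form_apply, comp3_add, comp3_sub, comp3_wedge, fmul_apply,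
    comp1_add, comp1_sub, comp1_smul]
  -- The coefficients `g` express this rotation by A_t: they are the components of ε_{ijk} A_t^k C^j
  -- up to sign.
  · linear_combination (-1) * d0 + g 2 p * c1 - g 1 p * c2
  · linear_combination (-1) * d1 + g 0 p * c2 - g 2 p * c0
  · linear_combination (-1) * d2 + g 1 p * c0 - g 0 p * c1

/-- The variation of De differs from D X_e by D²e_t, by X_A ∧ e and by the rotation by A_t. The
covariant derivative of (EE2), which is `hD`, eliminates D X_e; X_e drops out as well, and X_A, F
and D²e (here `DDe`) remain. -/
theorem constraint2_variation_identity {Ze ZA e a b x x' : Fin 3 → Form S 1} {θ dz : Form S 1}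
    {F De Dx' DZ VDe : Fin 3 → Form S 2} {DDe : Fin 3 → Form S 3} {f g : Fin 3 → S → ℝ}
    {z : S → ℝ} (hx : ∀ i, x i = ZA i - b i)
    (hx' : ∀ i, x' i = Ze i - a i - ∑ j, ∑ k, eps i j k • (g k ⊙ e j))
    (hV : ∀ i, VDe i = DZ i + ∑ j, ∑ k, eps i j k • (ZA j ⋏ e k))
    (hDx' : ∀ i, Dx' i = DZ i - ∑ j, ∑ k, eps i j k • (f k ⊙ F j) -
      ∑ j, ∑ k, eps i j k • (b k ⋏ e j + g k ⊙ De j))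
    (hD : ∀ i, ∑ j, ∑ k, eps i j k • (x' k ⋏ De j - e j ⋏ Dx' k) - (-1 : ℝ) • (θ ⋏ Dx' i) =
      ∑ j, ∑ k, eps i j k • (a j ⋏ De k + f j ⊙ DDe k) - (dz ⋏ De i + z ⊙ DDe i))
    (hC : ∀ i, ∑ j, ∑ k, eps i j k • (e j ⋏ De k) - θ ⋏ De i = 0) (i : Fin 3) :
    ∑ j, ∑ k, eps i j k • (Ze j ⋏ De k + e j ⋏ VDe k) - (dz ⋏ De i + θ ⋏ VDe i) =
      ∑ j, ∑ k, eps i j k • (e j ⋏ ∑ l, ∑ m, eps k l m • (f m ⊙ F l + x l ⋏ e m)) -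
        θ ⋏ (∑ l, ∑ m, eps i l m • (f m ⊙ F l + x l ⋏ e m)) -
        (∑ j, ∑ k, eps i j k • (f j ⊙ DDe k) - z ⊙ DDe i) := by
  funext p
  refine ext_comp3 stdBasis ?_
  have hD' := fun i => congrArg (comp3 stdBasis) (congrFun (hD i) p)
  have hC' := fun i => congrArg (comp3 stdBasis) (congrFun (hC i) p)
  have d0 := hD' 0
  have d1 := hD' 1
  have d2 := hD' 2
  have c0 := hC' 0
  have c1 := hC' 1
  have c2 := hC' 2
  simp only [hDx', hx', eps_sum_zero, eps_sum_one, eps_sum_two, eps_sum_zero (k := 1 + 1 + 1),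
    eps_sum_one (k := 1 + 1 + 1), eps_sum_two (k := 1 + 1 + 1), eps_sum_zero (k := 1 + 1),
    eps_sum_one (k := 1 + 1), eps_sum_two (k := 1 + 1)] at d0 d1 d2 c0 c1 c2
  simp -index only [add_form_apply, sub_form_apply, smul_form_apply, zero_form_apply, fmul_apply,
    comp3_add, comp3_sub, comp3_smul, comp3_zero, comp3_wedge, comp2_sub, comp2_add, comp2_smul,
    comp1_add, comp1_sub, comp1_smul, comp2_wedge_zero, comp2_wedge_one, comp2_wedge_two]
    at d0 d1 d2 c0 c1 c2
  simp only [hx, hV]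
  fin_cases i <;>
  simp only [Fin.zero_eta, Fin.mk_one, Fin.reduceFinMk, eps_sum_zero, eps_sum_one, eps_sum_two,
    eps_sum_zero (k := 1 + 1 + 1), eps_sum_one (k := 1 + 1 + 1), eps_sum_two (k := 1 + 1 + 1),
    eps_sum_zero (k := 1 + 1), eps_sum_one (k := 1 + 1), eps_sum_two (k := 1 + 1)] <;>
  simp -index only [add_form_apply, sub_form_apply, comp3_add, comp3_sub, comp3_wedge, fmul_apply,
    comp1_add, comp1_sub, comp1_smul, comp2_sub, comp2_add, comp2_smul, comp3_smul,
    comp2_wedge_zero, comp2_wedge_one, comp2_wedge_two]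
  · linear_combination (-1) * d0 + g 2 p * c1 - g 1 p * c2
  · linear_combination (-1) * d1 + g 0 p * c2 - g 2 p * c0
  · linear_combination (-1) * d2 + g 1 p * c0 - g 0 p * c1

/-- With D²e expressed by the curvature, what is left is the antisymmetric part of (EE1) plus
multiples of (L1). Neither (EE2) nor (L2) is used at this stage. -/
theorem tangency_identity_B {b : Fin 3 → E3} {p : S} {e x : Fin 3 → Form S 1}
    (he : ∀ i j, comp1 b (e i p) j = delta i j) {θ : Form S 1} {F : Fin 3 → Form S 2}
    {f : Fin 3 → S → ℝ} {z : S → ℝ} (hC : ∀ i, ∑ j, ∑ k, eps i j k • (e j ⋏ F k) + θ ⋏ F i = 0)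
    (hA : ∀ i a, coframeOp (comp1 b (θ p)) (fun k => comp1 b (x k p)) i a =
        sourceTerm (fun j => f j p) (z p) (fun k => comp2 b (F k p)) i a) (i : Fin 3) :
    comp3 b ((∑ j, ∑ k, eps i j k • (e j ⋏ ∑ l, ∑ m, eps k l m • (f m ⊙ F l + x l ⋏ e m)) -
        θ ⋏ (∑ l, ∑ m, eps i l m • (f m ⊙ F l + x l ⋏ e m)) -
        (∑ j, ∑ k, eps i j k • (f j ⊙ ∑ l, ∑ m, eps k l m • (e m ⋏ F l)) -
          z ⊙ ∑ l, ∑ m, eps i l m • (e m ⋏ F l))) p) = 0 := by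
  have hC' := fun i => congrArg (comp3 b) (congrFun (hC i) p)
  have c0 := hC' 0
  have c1 := hC' 1
  have c2 := hC' 2
  rw [comp3_constraint he, zero_form_apply, comp3_zero] at c0 c1 c2
  simp only [fin3_reduce] at c0 c1 c2
  have a01 := hA 0 1
  have a02 := hA 0 2
  have a10 := hA 1 0
  have a12 := hA 1 2
  have a20 := hA 2 0
  have a21 := hA 2 1
  simp only [coframeOp, sourceTerm, fin3_reduce, delta_values] at a01 a02 a10 a12 a20 a21
  fin_cases i <;>
  simp only [Fin.zero_eta, Fin.mk_one, Fin.reduceFinMk, eps_sum_zero, eps_sum_one, eps_sum_two,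
    eps_sum_zero (k := 1 + 1 + 1), eps_sum_one (k := 1 + 1 + 1), eps_sum_two (k := 1 + 1 + 1),
    eps_sum_zero (k := 1 + 1), eps_sum_one (k := 1 + 1), eps_sum_two (k := 1 + 1)] <;>
  simp -index only [add_form_apply, sub_form_apply, comp3_add, comp3_sub, comp3_wedge, fmul_apply,
    comp2_sub, comp2_add, comp2_smul, comp3_smul, comp2_wedge_zero, comp2_wedge_one,
    comp2_wedge_two, he, delta_values]
  · linear_combination a21 - a12 - f 2 p * c1 + f 1 p * c2
  · linear_combination a02 - a20 - f 0 p * c2 + f 2 p * c0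
  · linear_combination a10 - a01 - f 1 p * c0 + f 0 p * c1

end VariationAlgebra

/-! ### Tangency of every solution to the secondary constraint submanifold. -/

section Tangency

variable {S : Type*} [TopologicalSpace S] [ChartedSpace E3 S] [IsManifold (𝓡 3) ∞ S]
  {q Z : Fields S}

theorem fmul_zero_form {k : ℕ} (f : S → ℝ) : f ⊙ (0 : Form S k) = 0 :=
  funext fun p => smul_zero (f p)

/-- The covariant exterior derivative of `EqA`. -/
theorem covD_eqA (hA : EqA q Z) (i : Fin 3) :
    ∑ j, ∑ k, eps i j k • (XA q Z k ⋏ cDe q j - ce q j ⋏ covD (cA q) (XA q Z) k) +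
        (-1 : ℝ) • (dFun (cphi q) ⋏ covD (cA q) (XA q Z) i) =
      ∑ j, ∑ k, eps i j k • (covD0 (cA q) (cet q) j ⋏ cF q k) + dFun (cphi Z) ⋏ cF q i := by
  have hF : ∀ i, covD (cA q) (cF q) i = 0 := covD_curv (cA_mem q)
  have hθ := dFun_mem (contMDiff_cphi q)
  have h : covD (cA q) (fun i => ∑ j, ∑ k, eps i j k • (ce q j ⋏ XA q Z k) +
      dFun (cphi q) ⋏ XA q Z i) i = covD (cA q) (fun i => ∑ j, ∑ k, eps i j k • (cet q j ⊙ cF q k) +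
        cphi Z ⊙ cF q i) i := congrArg (fun β => covD (cA q) β i) (funext hA)
  rw [covD_add (cA q) (eps_sum_mem fun j k => wedge_mem (ce_mem q j) (XA_mem q Z k))
      (fun i => wedge_mem hθ (XA_mem q Z i)),
    covD_add (cA q) (eps_sum_mem fun j k => fmul_mem (contMDiff_cet q j) (cF_mem q k))
      (fun i => fmul_mem (contMDiff_cphi Z) (cF_mem q i)),
    covD_eps_wedge (cA q) (ce_mem q) (XA_mem q Z),
    covD_dFun_wedge (cA q) (contMDiff_cphi q) (XA_mem q Z),
    covD_eps_fmul (cA q) (contMDiff_cet q) (cF_mem q),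
    covD_fmul (cA q) (contMDiff_cphi Z) (cF_mem q)] at h
  simp only [hF, fmul_zero_form, add_zero] at h
  exact h

/-- The covariant exterior derivative of `EqE`. -/
theorem covD_eqE (hE : EqE q Z) (i : Fin 3) :
    ∑ j, ∑ k, eps i j k • (Xe q Z k ⋏ cDe q j - ce q j ⋏ covD (cA q) (Xe q Z) k) -
        (-1 : ℝ) • (dFun (cphi q) ⋏ covD (cA q) (Xe q Z) i) =
      ∑ j, ∑ k, eps i j k • (covD0 (cA q) (cet q) j ⋏ cDe q k +
          cet q j ⊙ ∑ l, ∑ m, eps k l m • (ce q m ⋏ cF q l)) -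
        (dFun (cphi Z) ⋏ cDe q i + cphi Z ⊙ ∑ l, ∑ m, eps i l m • (ce q m ⋏ cF q l)) := by
  have hDe : ∀ i, covD (cA q) (cDe q) i = ∑ l, ∑ m, eps i l m • (ce q m ⋏ cF q l) :=
    covD_covD (cA_mem q) (ce_mem q)
  have hθ := dFun_mem (contMDiff_cphi q)
  have h : covD (cA q) (fun i => ∑ j, ∑ k, eps i j k • (ce q j ⋏ Xe q Z k) -
      dFun (cphi q) ⋏ Xe q Z i) i =
        covD (cA q) (fun i => ∑ j, ∑ k, eps i j k • (cet q j ⊙ cDe q k) - cphi Z ⊙ cDe q i) i :=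
    congrArg (fun β => covD (cA q) β i) (funext hE)
  rw [covD_sub (cA q) (eps_sum_mem fun j k => wedge_mem (ce_mem q j) (Xe_mem q Z k))
      (fun i => wedge_mem hθ (Xe_mem q Z i)),
    covD_sub (cA q) (eps_sum_mem fun j k => fmul_mem (contMDiff_cet q j) (cDe_mem q k))
      (fun i => fmul_mem (contMDiff_cphi Z) (cDe_mem q i)),
    covD_eps_wedge (cA q) (ce_mem q) (Xe_mem q Z),
    covD_dFun_wedge (cA q) (contMDiff_cphi q) (Xe_mem q Z),
    covD_eps_fmul (cA q) (contMDiff_cet q) (cDe_mem q),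
    covD_fmul (cA q) (contMDiff_cphi Z) (cDe_mem q)] at h
  simp only [hDe] at h
  exact h

theorem covD_Xe (q Z : Fields S) (i : Fin 3) : covD (cA q) (Xe q Z) i =
    covD (cA q) (ce Z) i - ∑ j, ∑ k, eps i j k • (cet q k ⊙ cF q j) -
      ∑ j, ∑ k, eps i j k • (covD0 (cA q) (cAt q) k ⋏ ce q j + cAt q k ⊙ cDe q j) := by
  have m1 := covD0_mem (cA_mem q) (contMDiff_cet q)
  have h := covD_sub (cA q) (fun i => Submodule.sub_mem _ (ce_mem Z i) (m1 i))
    (eps_sum_mem fun j k => fmul_mem (contMDiff_cAt q k) (ce_mem q j)) i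
  rw [covD_sub (cA q) (ce_mem Z) m1, covD_covD0 (cA_mem q) (contMDiff_cet q),
    covD_eps_fmul_one (cA q) (contMDiff_cAt q) (ce_mem q)] at h
  exact h

theorem varConstraint1_eq_zero (hq : q ∈ configSpace S) (h1 : ∀ i, constraint1 q i = 0)
    (h2 : ∀ i, constraint2 q i = 0) (hA : EqA q Z) (hE : EqE q Z) (i : Fin 3) :
    varConstraint1 q Z i = 0 := by
  have h : varConstraint1 q Z i = ∑ j, ∑ k, eps i j k • (Xe q Z j ⋏ cF q k + XA q Z k ⋏ cDe q j) :=
    constraint1_variation_identity (fun _ => rfl) (covD_XA q Z) (covD_eqA hA) h1 i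
  rw [h]
  funext p
  obtain ⟨b, hb⟩ := exists_dual_frame hq p
  obtain ⟨Y, hY, hs⟩ := exists_symm_F hb h1
  obtain ⟨Y', hY', hs'⟩ := exists_symm_B hb h2
  refine ext_comp3 b ?_
  have h3 := tangency_identity_F hY hs hY' hs' ((eqA_iff_components hq).1 hA p b hb)
    ((eqE_iff_components hq).1 hE p b hb) i
  rw [zero_form_apply, comp3_zero, ← h3]
  fin_cases i <;>
  simp only [Fin.zero_eta, Fin.mk_one, Fin.reduceFinMk, eps_sum_zero, eps_sum_one, eps_sum_two,
    eps_sum_zero (k := 1 + 1 + 1), eps_sum_one (k := 1 + 1 + 1), eps_sum_two (k := 1 + 1 + 1)] <;>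
  simp -index only [add_form_apply, sub_form_apply, comp3_add, comp3_sub, comp3_wedge,
    fin3_reduce] <;>
  ring

theorem varConstraint2_eq_zero (hq : q ∈ configSpace S) (h1 : ∀ i, constraint1 q i = 0)
    (h2 : ∀ i, constraint2 q i = 0) (hA : EqA q Z) (hE : EqE q Z) (i : Fin 3) :
    varConstraint2 q Z i = 0 := by
  have h := constraint2_variation_identity (Ze := ce Z) (ZA := cA Z) (e := ce q)
    (b := covD0 (cA q) (cAt q)) (x := XA q Z) (VDe := varDe q Z) (fun _ => rfl) (fun _ => rfl)
    (fun _ => rfl) (covD_Xe q Z) (covD_eqE hE) h2 i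
  funext p
  obtain ⟨b, hb⟩ := exists_dual_frame hq p
  refine ext_comp3 b ?_
  rw [varConstraint2, h, tangency_identity_B hb h1 ((eqA_iff_components hq).1 hA p b hb) i]
  rfl

end Tangency

/-! ### Smoothness of the coefficients and existence of solutions. -/

section Existence

variable {S : Type*} [TopologicalSpace S] [ChartedSpace E3 S] [IsManifold (𝓡 3) ∞ S]
  {q : Fields S}

theorem volE_mem (q : Fields S) : volE q ∈ Omega S 3 :=
  Submodule.smul_mem _ _ (Submodule.sum_mem _ fun i _ => eps_sum_mem
    (fun j k => wedge_mem (ce_mem q i) (wedge_mem (ce_mem q j) (ce_mem q k))) i)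

theorem contMDiff_alpha (hq : q ∈ configSpace S) (i : Fin 3) :
    ContMDiff (𝓡 3) 𝓘(ℝ, ℝ) ∞ (alpha q i) :=
  ratio_contMDiff (wedge_mem (dFun_mem (contMDiff_cphi q)) (Submodule.smul_mem _ _
    (eps_sum_mem (fun j k => wedge_mem (ce_mem q j) (ce_mem q k)) i))) (volE_mem q)
    (volE_ne_zero hq)

theorem contMDiff_FF (hq : q ∈ configSpace S) (i j : Fin 3) :
    ContMDiff (𝓡 3) 𝓘(ℝ, ℝ) ∞ (FF q i j) :=
  ratio_contMDiff (wedge_mem (ce_mem q j) (cF_mem q i)) (volE_mem q) (volE_ne_zero hq)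

theorem contMDiff_BB (hq : q ∈ configSpace S) (i j : Fin 3) :
    ContMDiff (𝓡 3) 𝓘(ℝ, ℝ) ∞ (BB q i j) :=
  ratio_contMDiff (wedge_mem (ce_mem q j) (cDe_mem q i)) (volE_mem q) (volE_ne_zero hq)

theorem contMDiff_sum_three {f : Fin 3 → S → ℝ} (hf : ∀ i, ContMDiff (𝓡 3) 𝓘(ℝ, ℝ) ∞ (f i)) :
    ContMDiff (𝓡 3) 𝓘(ℝ, ℝ) ∞ (fun p => ∑ i, f i p) := by
  simp only [Fin.sum_univ_three]
  exact ((hf 0).add (hf 1)).add (hf 2)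

theorem contMDiff_reducedSource {f α : Fin 3 → S → ℝ} {z : S → ℝ} {F : Fin 3 → Fin 3 → S → ℝ}
    (hf : ∀ i, ContMDiff (𝓡 3) 𝓘(ℝ, ℝ) ∞ (f i)) (hα : ∀ i, ContMDiff (𝓡 3) 𝓘(ℝ, ℝ) ∞ (α i))
    (hz : ContMDiff (𝓡 3) 𝓘(ℝ, ℝ) ∞ z) (hF : ∀ i j, ContMDiff (𝓡 3) 𝓘(ℝ, ℝ) ∞ (F i j))
    (i j : Fin 3) : ContMDiff (𝓡 3) 𝓘(ℝ, ℝ) ∞ (fun p => reducedSource (fun k => f k p)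
      (fun k => α k p) (z p) (fun k l => F k l p) i j) := by
  have hc : ∀ c : ℝ, ContMDiff (𝓡 3) 𝓘(ℝ, ℝ) ∞ (fun _ : S => c) := fun c => contMDiff_const
  have h1 := (contMDiff_sum_three fun k => (hf k).mul (hF k i)).mul (hα j)
  have h2 := ((hf (j + 1)).mul (hF (j + 2) i)).sub ((hf (j + 2)).mul (hF (j + 1) i))
  have h3 := hz.mul (hF j i)
  have h4 := ((hF 0 0).add (hF 1 1)).add (hF 2 2)
  have h5 := (((hc (1 / 2 * delta i j)).mul hz).add ((hc (1 / 2 * delta i j)).mul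
    (contMDiff_sum_three fun k => (hf k).mul (hα k)))).sub ((hf i).mul (hα j))
  exact ((h1.sub h2).sub h3).add (h4.mul h5)

/-- Smoothness of the quotient rests on its denominator being positive everywhere, whatever the
zeros of dφ. -/
theorem contMDiff_solution {f α : Fin 3 → S → ℝ} {z : S → ℝ} {F : Fin 3 → Fin 3 → S → ℝ}
    (hf : ∀ i, ContMDiff (𝓡 3) 𝓘(ℝ, ℝ) ∞ (f i)) (hα : ∀ i, ContMDiff (𝓡 3) 𝓘(ℝ, ℝ) ∞ (α i))
    (hz : ContMDiff (𝓡 3) 𝓘(ℝ, ℝ) ∞ z) (hF : ∀ i j, ContMDiff (𝓡 3) 𝓘(ℝ, ℝ) ∞ (F i j))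
    (i j : Fin 3) : ContMDiff (𝓡 3) 𝓘(ℝ, ℝ) ∞ (fun p =>
      (∑ k, adjOp (fun k => α k p) i k * reducedSource (fun k => f k p)
        (fun k => α k p) (z p) (fun k l => F k l p) k j) /
          (1 + α 0 p ^ 2 + α 1 p ^ 2 + α 2 p ^ 2)) := by
  have hc : ∀ c : ℝ, ContMDiff (𝓡 3) 𝓘(ℝ, ℝ) ∞ (fun _ : S => c) := fun c => contMDiff_const
  have h1 : ∀ k, ContMDiff (𝓡 3) 𝓘(ℝ, ℝ) ∞ (fun p => adjOp (fun k => α k p) i k) := fun k =>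
    ((hc _).add ((hα i).mul (hα k))).sub (contMDiff_sum_three fun l => (hc _).mul (hα l))
  have h2 := contMDiff_sum_three fun k => (h1 k).mul (contMDiff_reducedSource hf hα hz hF k j)
  have h3 := (((hc 1).add ((hα 0).pow 2)).add ((hα 1).pow 2)).add ((hα 2).pow 2)
  refine h2.div₀ h3 fun p => ?_
  have : 0 < 1 + α 0 p ^ 2 + α 1 p ^ 2 + α 2 p ^ 2 := by positivity
  exact this.ne'

theorem contMDiff_matW (hq : q ∈ configSpace S) {z : S → ℝ}
    (hz : ContMDiff (𝓡 3) 𝓘(ℝ, ℝ) ∞ z) (i j : Fin 3) :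
    ContMDiff (𝓡 3) 𝓘(ℝ, ℝ) ∞ (matW q z i j) := by
  rw [funext (matW_eq q z i j)]
  exact contMDiff_solution (contMDiff_cet q) (contMDiff_alpha hq) hz (contMDiff_FF hq) i j

theorem contMDiff_matE (hq : q ∈ configSpace S) {z : S → ℝ}
    (hz : ContMDiff (𝓡 3) 𝓘(ℝ, ℝ) ∞ z) (i j : Fin 3) :
    ContMDiff (𝓡 3) 𝓘(ℝ, ℝ) ∞ (matE q z i j) := by
  have h := contMDiff_solution (contMDiff_cet q) (fun i => (contMDiff_alpha hq i).neg) hz.neg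
    (contMDiff_BB hq) i j
  simp only [Pi.neg_apply, neg_sq] at h
  rw [funext (matE_eq q z i j)]
  exact h

/-- The equations for `X_A` and `X_e` have a unique solution with given time components and given
scalar component. -/
theorem existsUnique_sol (hq : q ∈ configSpace S) (zet zAt : Fin 3 → SmoothFun S)
    (zphi : SmoothFun S) : ∃! Z : Fields S, cet Z = (fun i => ⇑(zet i)) ∧
      cAt Z = (fun i => ⇑(zAt i)) ∧ cphi Z = ⇑zphi ∧ SolA q Z ∧ SolE q Z := by
  have hA : ∀ i, ∑ j, matW q zphi i j ⊙ ce q j + covD0 (cA q) (cAt q) i ∈ Omega S 1 := fun i =>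
    Submodule.add_mem _ (Submodule.sum_mem _ fun j _ =>
      fmul_mem (contMDiff_matW hq zphi.contMDiff i j) (ce_mem q j))
      (covD0_mem (cA_mem q) (contMDiff_cAt q) i)
  have hE : ∀ i, ∑ j, matE q zphi i j ⊙ ce q j + ∑ j, ∑ k, eps i j k • (cAt q k ⊙ ce q j) +
      covD0 (cA q) (cet q) i ∈ Omega S 1 := fun i =>
    Submodule.add_mem _ (Submodule.add_mem _ (Submodule.sum_mem _ fun j _ =>
      fmul_mem (contMDiff_matE hq zphi.contMDiff i j) (ce_mem q j))
      (eps_sum_mem (fun j k => fmul_mem (contMDiff_cAt q k) (ce_mem q j)) i))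
      (covD0_mem (cA_mem q) (contMDiff_cet q) i)
  -- Z_A and Z_e are recovered from X_A and X_e by adding back the gauge terms, which depend on `q`
  -- only.
  refine ⟨(zet, fun i => ⟨_, hE i⟩, zAt, fun i => ⟨_, hA i⟩, zphi),
    ⟨rfl, rfl, rfl, fun i => ?_, fun i => ?_⟩, ?_⟩
  · exact add_sub_cancel_right _ _
  · change _ + _ + _ - _ - _ = _
    rw [add_sub_cancel_right, add_sub_cancel_right]
    rfl
  · rintro ⟨et, e, At, A, φ⟩ ⟨h1, h2, h3, h4, h5⟩
    have k1 : et = zet := funext fun i => DFunLike.coe_injective (congrFun h1 i)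
    have k2 : At = zAt := funext fun i => DFunLike.coe_injective (congrFun h2 i)
    have k3 : φ = zphi := DFunLike.coe_injective h3
    subst k1 k2 k3
    have k4 : A = fun i => ⟨_, hA i⟩ := by
      funext i
      exact Subtype.ext (sub_eq_iff_eq_add.1 (h4 i))
    have k5 : e = fun i => ⟨_, hE i⟩ := by
      funext i
      exact Subtype.ext (sub_eq_iff_eq_add.1 (sub_eq_iff_eq_add.1 (h5 i)))
    rw [k4, k5]

end Existence

end EHK

/-! ### Assembly of the theorem. -/

theorem mainTheorem1 {S : Type*} [TopologicalSpace S] [ChartedSpace (EuclideanSpace ℝ (Fin 3)) S]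
    [IsManifold (𝓡 3) ∞ S] [CompactSpace S] [T2Space S]
    (vol₀ : EHK.Form S 3) (hvol₀ : vol₀ ∈ EHK.Omega S 3) (hne : ∀ p, vol₀ p ≠ 0) :
    -- the fibre derivative and the energy depend on the base point only, so that the primary
    -- constraint submanifold is a graph over `Q` and the Hamiltonian is a function on it
    (∀ q ∈ EHK.configSpace S, ∀ v, EHK.energy vol₀ q v = EHK.hamiltonian vol₀ q ∧
      ∀ w, EHK.fiberDeriv vol₀ q v w = EHK.momentum vol₀ q w) ∧
    EHK.primarySubmanifold vol₀ =
      {m | m.1 ∈ EHK.configSpace S ∧ ∀ w, m.2 w = EHK.momentum vol₀ m.1 w} ∧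
    -- `ι_Z ω = dH`: secondary constraints and equations for the components of `Z`
    (∀ q ∈ EHK.configSpace S, ∀ Z : EHK.Fields S, EHK.GNH vol₀ q Z ↔
      (∀ i, EHK.constraint1 q i = 0) ∧ (∀ i, EHK.constraint2 q i = 0) ∧
        EHK.EqA q Z ∧ EHK.EqE q Z ∧ EHK.EqPhi q Z) ∧
    -- `dφ = α_i e^i`
    (∀ q ∈ EHK.configSpace S,
      EHK.dFun (EHK.cphi q) = ∑ i, EHK.fmul (EHK.alpha q i) (EHK.ce q i)) ∧
    -- on `M₁`, the first two equations are solved by `X_A^i = W^i_j e^j`, `X_e^i = E^i_j e^j`,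
    -- and the third one then holds
    (∀ q ∈ EHK.secondarySubmanifold S, ∀ Z : EHK.Fields S,
      (EHK.EqA q Z ↔ EHK.SolA q Z) ∧ (EHK.EqE q Z ↔ EHK.SolE q Z) ∧
        (EHK.SolA q Z → EHK.SolE q Z → EHK.EqPhi q Z) ∧
        (EHK.GNH vol₀ q Z ↔ EHK.SolA q Z ∧ EHK.SolE q Z)) ∧
    -- on `M₁`, the components `Z_{e_t}`, `Z_{A_t}`, `Z_φ` are arbitrary and determine the rest
    (∀ q ∈ EHK.secondarySubmanifold S, ∀ (zet zAt : Fin 3 → EHK.SmoothFun S)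
      (zphi : EHK.SmoothFun S), ∃! Z : EHK.Fields S,
        EHK.cet Z = (fun i => ⇑(zet i)) ∧ EHK.cAt Z = (fun i => ⇑(zAt i)) ∧
          EHK.cphi Z = ⇑zphi ∧ EHK.GNH vol₀ q Z) ∧
    -- all solutions are tangent to `M₁`
    (∀ q ∈ EHK.secondarySubmanifold S, ∀ Z : EHK.Fields S,
      EHK.GNH vol₀ q Z → EHK.TangentToSecondary q Z) ∧
    -- the constraint algorithm stops at `M₁`
    {q | q ∈ EHK.configSpace S ∧ ∃ Z, EHK.GNH vol₀ q Z} = EHK.secondarySubmanifold S ∧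
    {q | q ∈ EHK.secondarySubmanifold S ∧
      ∃ Z, EHK.GNH vol₀ q Z ∧ EHK.TangentToSecondary q Z} = EHK.secondarySubmanifold S := by
  have hgnh : ∀ q ∈ EHK.secondarySubmanifold S, ∀ Z : EHK.Fields S,
      EHK.GNH vol₀ q Z ↔ EHK.SolA q Z ∧ EHK.SolE q Z := fun q hq Z => by
    rw [EHK.gnh_iff hvol₀ hne hq.1, ← EHK.eqA_iff_solA hq.1 hq.2.1,
      ← EHK.eqE_iff_solE hq.1 hq.2.2]
    exact ⟨fun h => ⟨h.2.2.1, h.2.2.2.1⟩, fun h => ⟨hq.2.1, hq.2.2, h.1, h.2,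
      EHK.eqPhi_of_eqA_of_eqE hq.1 hq.2.1 hq.2.2 h.1 h.2⟩⟩
  have hex : ∀ q ∈ EHK.secondarySubmanifold S, ∃ Z : EHK.Fields S, EHK.GNH vol₀ q Z :=
    fun q hq => by
      -- Any choice of the arbitrary components would do; zero is the simplest.
      obtain ⟨Z, hZ, -⟩ := EHK.existsUnique_sol hq.1 0 0 0
      exact ⟨Z, (hgnh q hq Z).2 hZ.2.2.2⟩
  have htan : ∀ q ∈ EHK.secondarySubmanifold S, ∀ Z : EHK.Fields S,
      EHK.GNH vol₀ q Z → EHK.TangentToSecondary q Z := fun q hq Z hZ => by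
    obtain ⟨h1, h2, hA, hE, -⟩ := (EHK.gnh_iff hvol₀ hne hq.1 Z).1 hZ
    exact EHK.tangentToSecondary_of_var_eq_zero (EHK.varConstraint1_eq_zero hq.1 h1 h2 hA hE)
      (EHK.varConstraint2_eq_zero hq.1 h1 h2 hA hE)
  refine ⟨fun q _ v => ⟨?_, fun w => ?_⟩, ?_, fun q hq Z => EHK.gnh_iff hvol₀ hne hq Z,
    fun q hq => EHK.dFun_cphi_eq_sum hq, fun q hq Z => ⟨EHK.eqA_iff_solA hq.1 hq.2.1,
      EHK.eqE_iff_solE hq.1 hq.2.2, fun hA hE => ?_, hgnh q hq Z⟩, ?_, htan, ?_, ?_⟩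
  · rw [EHK.hamiltonian, EHK.energy_eq hvol₀ hne, EHK.energy_eq hvol₀ hne]
  · rw [EHK.momentum, EHK.fiberDeriv_eq hvol₀ hne, EHK.fiberDeriv_eq hvol₀ hne]
  · ext m
    simp only [EHK.primarySubmanifold, EHK.momentum, EHK.fiberDeriv_eq hvol₀ hne, exists_const]
  · exact EHK.eqPhi_of_eqA_of_eqE hq.1 hq.2.1 hq.2.2 ((EHK.eqA_iff_solA hq.1 hq.2.1).2 hA)
      ((EHK.eqE_iff_solE hq.1 hq.2.2).2 hE)
  · intro q hq zet zAt zphi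
    simp only [hgnh q hq]
    exact EHK.existsUnique_sol hq.1 zet zAt zphi
  · ext q
    refine ⟨fun ⟨hq, Z, hZ⟩ => ?_, fun hq => ⟨hq.1, hex q hq⟩⟩
    obtain ⟨h1, h2, -⟩ := (EHK.gnh_iff hvol₀ hne hq Z).1 hZ
    exact ⟨hq, h1, h2⟩
  · ext q
    refine ⟨fun h => h.1, fun hq => ⟨hq, ?_⟩⟩
    obtain ⟨Z, hZ⟩ := hex q hq
    exact ⟨Z, hZ, htan q hq Z hZ⟩
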